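/- **Setting.** Let $k>0$, $\alpha\neq 0$, $\Omega\ne 0$. Consider a Kepler binary perturbed by a normally incident circularly polarized gravitational wave, in the Cartesian frame rotating with angular velocity $\Omega/2$: $$\ddot x-\Omega\dot y-(\tfrac14-\epsilon\alpha)\Omega^2x+\frac{kx}{r^3}=0,\qquad \ddot y+\Omega\dot x-(\tfrac14+\epsilon\alpha)\Omega^2y+\frac{ky}{r^3}=0,\qquad r=\sqrt{x^2+y^2}$$ ($\Omega>0$: right circular polarization; $\Omega<0$: left circular polarization). With $X=\dot x-\Omega y/2$, $Y=\dot y+\Omega x/2$ this is the Hamiltonian system which in Delaunay elements $(L,G,\ell,g)$, $0<|G|<L$, has the Hamiltonian $$H=-\frac{k^2}{2L^2}-\frac{\Omega}{2}G+\frac{\epsilon}{2}\alpha\Omega^2\,\mathcal C(L,G,\ell,g),\qquad \mathcal C=r^2\cos2\theta .$$ Here $a=L^2/k$, $e=\sqrt{L^2-G^2}/L$, $\omega=k^2/L^3$, $\hat u-e\sin\hat u=\ell$, $\theta=g+v$ with $r\cos v=a(\cos\hat u-e)$, $r\sin v=a\frac GL\sin\hat u$. For an integer $m\ge1$ and $0<e<1$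 put $$A_m(e)=\frac{4}{m^2e^2}\bigl(2me(1-e^2)J_m'(me)-(2-e^2)J_m(me)\bigr),\qquad B_m(e)=-\frac{8}{m^2e^2}\sqrt{1-e^2}\,\bigl(eJ_m'(me)-m(1-e^2)J_m(me)\bigr),$$ where $J_m$ is the Bessel function. Fix $m\ge 1$ and let $L_0>0$ be the $(m:1)$-resonant value, $m\,k^2/L_0^3=|\Omega|$. For $0<e<1$ and $\eta\in\{+1,-1\}$ consider the unperturbed elliptical orbits with $L=L_0$ and $G=G_0:=\eta\,\operatorname{sgn}(\Omega)\,L_0\sqrt{1-e^2}$ (co-rotating with the wave if $\eta=+1$, counter-rotating if $\eta=-1$). **Theorem.** There is a constant $c\ne0$, depending only on $k,\Omega,\alpha,m$ (and so $L_0$), such that for both values of $\eta$: 1. For almost all $e\in(0,1)$ the function $\ell\mapsto(A_m(e)+\eta B_m(e))\sin m\ell$ has zeros, and all of them are simple (a simple zero is a zero at which the derivative does not vanish). 2. For every $e\in(0,1)$ there are $\delta>0$ and a real-analytic function $\mathcal G(L,\ell,g,\epsilon)$, defined for $|L-L_0|<\delta$, $|\epsilon|<\delta$ and all $\ell,g$,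 with $0<|\mathcal G|<L$, $2\pi$-periodic in $\ell$ and $\pi$-periodic in $g$, that solves the energy equation $H(L,\mathcal G,\ell,g)=-\frac{k^2}{2L_0^2}-\frac\Omega2G_0$ (isoenergetic reduction), and such that for the reduced system $$\frac{dL}{dg}=-\frac{\partial H/\partial\ell}{\partial H/\partial G}\Big|_{G=\mathcal G},\qquad \frac{d\ell}{dg}=\frac{\partial H/\partial L}{\partial H/\partial G}\Big|_{G=\mathcal G}$$ the following holds. - At $\epsilon=0$ the derivative of $d\ell/dg$ with respect to $L$ is nonzero at $L_0$, so that the resonant torus is normally nondegenerate. - The bifurcation function, that is, the average over $0\le g\le m\pi$ of the first-order part in $\epsilon$ of $dL/dg$ along the unperturbed orbit $g\mapsto(L_0,\ell-\frac{2\omega}{\Omega}g)$, equals $c\,(A_m(e)+\eta B_m(e))\sin m\ell$ for all $\ell$. - If $\ell_0$ is a simple zero of the bifurcation function, then the resonant orbit through $(L_0,\ell_0)$ at $g=0$ is continuable: for some $\epsilon_0>0$ and all $|\epsilon|<\epsilon_0$ there are solutions $g\mapsto(L(g,\epsilon),\ell(g,\epsilon))$ of the reduced system, whose initial values at $g=0$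 depend continuously on $\epsilon$ and equal $(L_0,\ell_0)$ at $\epsilon=0$, with $L(g+m\pi,\epsilon)=L(g,\epsilon)$ and $\ell(g+m\pi,\epsilon)=\ell(g,\epsilon)-2\pi\operatorname{sgn}\Omega$. Moreover, with $G=\mathcal G(L(g,\epsilon),\ell(g,\epsilon),g,\epsilon)$, for each such $\epsilon$ there are $T>0$ and a function $g(t)$ of time with $g(0)=0$, $g(t+T)=g(t)-2\pi m\operatorname{sgn}\Omega$, such that $t\mapsto(L,G,\ell,g)$ is a $T$-periodic solution of Hamilton's equations ($\ell$, $g$ modulo $2\pi$), and the corresponding $t\mapsto(x(t),y(t))$ is a $T$-periodic solution of the equations of motion in the rotating frame, with $(x,y,X,Y)$ having the Delaunay elements $(L,G,\ell,g)$. -/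

import Mathlib

open MeasureTheory Set

noncomputable section

namespace GravWave

/-- Bessel function of integer order `ν`: `J_ν(x) = (1/2π) ∫₀^{2π} cos (ν t - x sin t) dt`. -/
def besselJ (ν : ℕ) (x : ℝ) : ℝ :=
  (1 / (2 * Real.pi)) * ∫ t in (0 : ℝ)..(2 * Real.pi), Real.cos (ν * t - x * Real.sin t)

/-- The coefficient `A_ν(e)`. -/
def coeffA (ν : ℕ) (e : ℝ) : ℝ :=
  4 / ((ν : ℝ) ^ 2 * e ^ 2) *
    (2 * ν * e * (1 - e ^ 2) * deriv (besselJ ν) (ν * e) - (2 - e ^ 2) * besselJ ν (ν * e))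

/-- The coefficient `B_ν(e)`. -/
def coeffB (ν : ℕ) (e : ℝ) : ℝ :=
  -(8 / ((ν : ℝ) ^ 2 * e ^ 2)) * Real.sqrt (1 - e ^ 2) *
    (e * deriv (besselJ ν) (ν * e) - ν * (1 - e ^ 2) * besselJ ν (ν * e))

/-! ### Delaunay elements `(L, G, ℓ, g)` with `0 < |G| < L` -/

/-- Keplerian frequency `ω = k² / L³`. -/
def keplerFreq (k L : ℝ) : ℝ := k ^ 2 / L ^ 3

/-- Semimajor axis `a = L² / k`. -/
def semiAxis (k L : ℝ) : ℝ := L ^ 2 / k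

/-- Eccentricity `e = (L² - G²)^{1/2} / L`. -/
def ecc (L G : ℝ) : ℝ := Real.sqrt (L ^ 2 - G ^ 2) / L

/-- The eccentric anomaly: the solution `u` of Kepler's equation `u - e sin u = ℓ`. -/
def eccAnomaly (e l : ℝ) : ℝ := Function.invFun (fun u : ℝ => u - e * Real.sin u) l

/-- Kepler's equation holds for `eccAnomaly`, for every real mean anomaly. -/
theorem eccAnomaly_spec (e l : ℝ) :
    eccAnomaly e l - e * Real.sin (eccAnomaly e l) = l := by
  have hc : Continuous (fun u : ℝ => u - e * Real.sin u) := by fun_prop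
  have hb : ∀ u : ℝ, |e * Real.sin u| ≤ |e| := fun u => by
    rw [abs_mul]
    exact mul_le_of_le_one_right (abs_nonneg e) (Real.abs_sin_le_one u)
  have h : ∃ u : ℝ, (fun u : ℝ => u - e * Real.sin u) u = l := by
    have h1 := abs_le.1 (hb (l - |e|))
    have h2 := abs_le.1 (hb (l + |e|))
    have := intermediate_value_Icc (a := l - |e|) (b := l + |e|)
      (by linarith [abs_nonneg e]) hc.continuousOn
    obtain ⟨u, -, hu⟩ := this (show l ∈ Icc _ _ from ⟨by linarith, by linarith⟩)
    exact ⟨u, hu⟩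
  exact Function.invFun_eq h

/-- `r cos v`, with `v` the true anomaly; `cos v = (cos u - e) / (1 - e cos u)` and
`r = a (1 - e cos u)`. -/
def orbX (k L G l : ℝ) : ℝ :=
  semiAxis k L * (Real.cos (eccAnomaly (ecc L G) l) - ecc L G)

/-- `r sin v`. The factor `G / L` is `√(1 - e²)` with the sign of the angular momentum `G`, so that
`v` is the signed angle from the pericentre, for orbits of either orientation. -/
def orbY (k L G l : ℝ) : ℝ :=
  semiAxis k L * (G / L) * Real.sin (eccAnomaly (ecc L G) l)

/-- `(d/dt) (r cos v)` along the Kepler motion. -/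
def orbPX (k L G l : ℝ) : ℝ :=
  -(k / L) * Real.sin (eccAnomaly (ecc L G) l) /
    (1 - ecc L G * Real.cos (eccAnomaly (ecc L G) l))

/-- `(d/dt) (r sin v)` along the Kepler motion. -/
def orbPY (k L G l : ℝ) : ℝ :=
  (k * G / L ^ 2) * Real.cos (eccAnomaly (ecc L G) l) /
    (1 - ecc L G * Real.cos (eccAnomaly (ecc L G) l))

/-- Cartesian position `x = r cos θ`, `θ = g + v`, in terms of the Delaunay elements. -/
def posX (k L G l g : ℝ) : ℝ := orbX k L G l * Real.cos g - orbY k L G l * Real.sin g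

/-- Cartesian position `y = r sin θ`, `θ = g + v`. -/
def posY (k L G l g : ℝ) : ℝ := orbX k L G l * Real.sin g + orbY k L G l * Real.cos g

/-- Cartesian momentum `X` in terms of the Delaunay elements. -/
def momX (k L G l g : ℝ) : ℝ := orbPX k L G l * Real.cos g - orbPY k L G l * Real.sin g

/-- Cartesian momentum `Y` in terms of the Delaunay elements. -/
def momY (k L G l g : ℝ) : ℝ := orbPX k L G l * Real.sin g + orbPY k L G l * Real.cos g

/-- The function `r² cos 2θ = x² - y²` expressed in Delaunay elements. -/
def funC (k L G l g : ℝ) : ℝ := posX k L G l g ^ 2 - posY k L G l g ^ 2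

/-! ### The Hamiltonian system in the rotating frame -/

/-- `H = -k²/(2L²) - (Ω/2) G + (ε/2) α Ω² r² cos 2θ`. -/
def ham (k Ω α ε L G l g : ℝ) : ℝ :=
  -(k ^ 2 / (2 * L ^ 2)) - Ω / 2 * G + ε / 2 * α * Ω ^ 2 * funC k L G l g

def hamL (k Ω α ε L G l g : ℝ) : ℝ := deriv (fun z => ham k Ω α ε z G l g) L
def hamG (k Ω α ε L G l g : ℝ) : ℝ := deriv (fun z => ham k Ω α ε L z l g) G
def hamEll (k Ω α ε L G l g : ℝ) : ℝ := deriv (fun z => ham k Ω α ε L G z g) l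
def hamg (k Ω α ε L G l g : ℝ) : ℝ := deriv (fun z => ham k Ω α ε L G l z) g

/-- `t ↦ (L, G, ℓ, g)` is a noncircular, nonrectilinear elliptical solution, for all times, of
Hamilton's equations in Delaunay elements. -/
def IsDelaunaySolution (k Ω α ε : ℝ) (L G l g : ℝ → ℝ) : Prop :=
  ∀ t : ℝ, 0 < |G t| ∧ |G t| < L t ∧
    HasDerivAt L (-hamEll k Ω α ε (L t) (G t) (l t) (g t)) t ∧
    HasDerivAt G (-hamg k Ω α ε (L t) (G t) (l t) (g t)) t ∧
    HasDerivAt l (hamL k Ω α ε (L t) (G t) (l t) (g t)) t ∧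
    HasDerivAt g (hamG k Ω α ε (L t) (G t) (l t) (g t)) t

/-- `t ↦ (x, y)` is a solution, for all times, of the Cartesian equations of motion in the frame
that rotates with angular velocity `Ω/2`. -/
def IsRotatingSolution (k Ω α ε : ℝ) (x y : ℝ → ℝ) : Prop :=
  ∀ t : ℝ, 0 < x t ^ 2 + y t ^ 2 ∧
    HasDerivAt x (deriv x t) t ∧ HasDerivAt y (deriv y t) t ∧
    HasDerivAt (deriv x) (Ω * deriv y t + (1 / 4 - ε * α) * Ω ^ 2 * x t
      - k * x t / Real.sqrt (x t ^ 2 + y t ^ 2) ^ 3) t ∧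
    HasDerivAt (deriv y) (-(Ω * deriv x t) + (1 / 4 + ε * α) * Ω ^ 2 * y t
      - k * y t / Real.sqrt (x t ^ 2 + y t ^ 2) ^ 3) t

/-! ### Isoenergetic reduction -/

/-- `𝒢 L ℓ g ε` is the solution for the angular momentum `G` of the energy equation
`H = h` near the unperturbed orbit with elements `L₀, G₀`, where `h` is the unperturbed energy
of that orbit. It is real-analytic, hence a power series in `ε`. At `ε = 0` the energy equation has
only one root `G`, so that these conditions determine `𝒢` near `ε = 0`. -/
structure IsIsoenergetic (k Ω α L₀ G₀ δ : ℝ) (𝒢 : ℝ → ℝ → ℝ → ℝ → ℝ) : Prop where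
  analytic : AnalyticOnNhd ℝ (fun p : ℝ × ℝ × ℝ × ℝ => 𝒢 p.1 p.2.1 p.2.2.1 p.2.2.2)
    {p | |p.1 - L₀| < δ ∧ |p.2.2.2| < δ}
  range : ∀ L l g ε, |L - L₀| < δ → |ε| < δ → 0 < |𝒢 L l g ε| ∧ |𝒢 L l g ε| < L
  energy : ∀ L l g ε, |L - L₀| < δ → |ε| < δ →
    ham k Ω α ε L (𝒢 L l g ε) l g = -(k ^ 2 / (2 * L₀ ^ 2)) - Ω / 2 * G₀
  periodic_ell : ∀ L l g ε, |L - L₀| < δ → |ε| < δ →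
    𝒢 L (l + 2 * Real.pi) g ε = 𝒢 L l g ε
  periodic_g : ∀ L l g ε, |L - L₀| < δ → |ε| < δ → 𝒢 L l (g + Real.pi) ε = 𝒢 L l g ε

/-- `dL/dg = (dL/dt) / (dg/dt)` on the energy level, as a function of `L, ℓ, g`. -/
def redL (k Ω α : ℝ) (𝒢 : ℝ → ℝ → ℝ → ℝ → ℝ) (ε L l g : ℝ) : ℝ :=
  -hamEll k Ω α ε L (𝒢 L l g ε) l g / hamG k Ω α ε L (𝒢 L l g ε) l g

/-- `dℓ/dg = (dℓ/dt) / (dg/dt)` on the energy level, as a function of `L, ℓ, g`. -/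
def redEll (k Ω α : ℝ) (𝒢 : ℝ → ℝ → ℝ → ℝ → ℝ) (ε L l g : ℝ) : ℝ :=
  hamL k Ω α ε L (𝒢 L l g ε) l g / hamG k Ω α ε L (𝒢 L l g ε) l g

/-- The bifurcation function: the average, over the `g`-interval of length `mπ`, of the part of
first order in `ε` of `dL/dg` along the unperturbed orbit `g ↦ (L₀, ℓ - (2ω/Ω) g)`. -/
def bifurcation (k Ω α : ℝ) (m : ℕ) (L₀ : ℝ) (𝒢 : ℝ → ℝ → ℝ → ℝ → ℝ) (l : ℝ) : ℝ :=
  (1 / (m * Real.pi)) * ∫ g in (0 : ℝ)..(m * Real.pi),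
    deriv (fun ε => redL k Ω α 𝒢 ε L₀ (l - 2 * keplerFreq k L₀ / Ω * g) g) 0

def IsSimpleZero (f : ℝ → ℝ) (z : ℝ) : Prop := f z = 0 ∧ deriv f z ≠ 0

/-- `g ↦ (L, ℓ)` solves the reduced system for all `g`, and closes up (with `ℓ` an angle modulo
`2π`) after `m` strobes, that is, after a `g`-interval of length `mπ`. -/
def IsReducedPeriodic (k Ω α : ℝ) (m : ℕ) (𝒢 : ℝ → ℝ → ℝ → ℝ → ℝ) (ε : ℝ) (L l : ℝ → ℝ) : Prop :=
  ∀ g : ℝ, HasDerivAt L (redL k Ω α 𝒢 ε (L g) (l g) g) g ∧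
    HasDerivAt l (redEll k Ω α 𝒢 ε (L g) (l g) g) g ∧
    L (g + m * Real.pi) = L g ∧
    l (g + m * Real.pi) = l g - Real.sign Ω * (2 * Real.pi)

/-- `t ↦ (L, G, ℓ, g)` is a solution of Hamilton's equations that is periodic with period `T`
(with `ℓ` and `g` angles modulo `2π`), and the corresponding `t ↦ (x, y)` is a `T`-periodic solution
of the Cartesian equations of motion in the rotating frame whose canonical momenta
`X = x' - Ω y / 2`, `Y = y' + Ω x / 2` have these Delaunay elements. -/
structure IsRotatingPeriodic (k Ω α ε T : ℝ) (L G l g : ℝ → ℝ) : Prop where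
  pos : 0 < T
  delaunay : IsDelaunaySolution k Ω α ε L G l g
  periodic_L : ∀ t, L (t + T) = L t
  periodic_G : ∀ t, G (t + T) = G t
  periodic_ell : ∃ j : ℤ, ∀ t, l (t + T) = l t + 2 * Real.pi * j
  periodic_g : ∃ j : ℤ, ∀ t, g (t + T) = g t + 2 * Real.pi * j
  cartesian : IsRotatingSolution k Ω α ε
    (fun t => posX k (L t) (G t) (l t) (g t)) (fun t => posY k (L t) (G t) (l t) (g t))
  momentum_x : ∀ t, deriv (fun t => posX k (L t) (G t) (l t) (g t)) t
    - Ω / 2 * posY k (L t) (G t) (l t) (g t) = momX k (L t) (G t) (l t) (g t)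
  momentum_y : ∀ t, deriv (fun t => posY k (L t) (G t) (l t) (g t)) t
    + Ω / 2 * posX k (L t) (G t) (l t) (g t) = momY k (L t) (G t) (l t) (g t)
  periodic_x : ∀ t, posX k (L (t + T)) (G (t + T)) (l (t + T)) (g (t + T))
    = posX k (L t) (G t) (l t) (g t)
  periodic_y : ∀ t, posY k (L (t + T)) (G (t + T)) (l (t + T)) (g (t + T))
    = posY k (L t) (G t) (l t) (g t)

/-- The unperturbed resonant orbit through `(L, ℓ) = (L₀, ℓ₀)` at `g = 0` is continuable: there
is a curve of initial values `ε ↦ (Λ ε 0, lam ε 0)` at `g = 0`, continuous and through `(L₀, ℓ₀)` at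
`ε = 0`, of periodic solutions of the reduced system, and each of them, with `G` given by `𝒢` and
`g` a function `γ` of the time that winds `m` times (against `Ω`) per period, is a periodic
solution in the rotating frame. -/
def IsContinuable (k Ω α : ℝ) (m : ℕ) (L₀ δ : ℝ) (𝒢 : ℝ → ℝ → ℝ → ℝ → ℝ) (ℓ₀ : ℝ) : Prop :=
  ∃ ε₀ > 0, ε₀ ≤ δ ∧ ∃ Λ lam : ℝ → ℝ → ℝ,
    Λ 0 0 = L₀ ∧ lam 0 0 = ℓ₀ ∧
    ContinuousOn (fun ε => (Λ ε 0, lam ε 0)) (Ioo (-ε₀) ε₀) ∧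
    ∀ ε ∈ Ioo (-ε₀) ε₀,
      (∀ g, |Λ ε g - L₀| < δ) ∧
      IsReducedPeriodic k Ω α m 𝒢 ε (Λ ε) (lam ε) ∧
      ∃ T > 0, ∃ γ : ℝ → ℝ, γ 0 = 0 ∧
        (∀ t, γ (t + T) = γ t - Real.sign Ω * (2 * Real.pi * m)) ∧
        IsRotatingPeriodic k Ω α ε T (fun t => Λ ε (γ t))
          (fun t => 𝒢 (Λ ε (γ t)) (lam ε (γ t)) (γ t) ε) (fun t => lam ε (γ t)) γ

end GravWave

end

/-! Up to the factor `-Ω/2` the energy equation reads `G = G₀ + f(L) + ε α Ω C`. For small `ε` its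
right side is a contraction in `G` near `G₀`, so the equation has a single root `𝒢` there, analytic
and periodic in the angles by uniqueness. On the energy level `dg/dt` stays close to `-Ω/2`, so `g`
can replace the time. The reduced system is a slow equation `dL/dg = ε R` coupled to a twist `dℓ/dg
= -(2/Ω) k²/L³ + O(ε)`.

After the resonant drift is subtracted from `ℓ`, this is an `mπ`-periodic system `x' = ε R`, `y' =
N` (`IsTwistSystem`). Closed solutions are zeros of an operator on continuous functions on `[0,
mπ]`. The closing condition for `x` is imposed as `∫ R = 0`, that is, after division by `ε`. The
linearization at `ε = 0` is then triangular: the twist determines the constant part of `x`, and the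
derivative of the averaged `R` determines that of `y`. Both are nonzero, so the inverse function
theorem gives a continuous family of periodic solutions (`exists_boundary_solution`,
`exists_periodic_family`).

The averaged `R` is the integral of `∂C/∂ℓ` along the resonant Kepler orbit. With the eccentric
anomaly as variable it splits into Fourier integrals of trigonometric polynomials against `cos (mu -
me sin u)` and `sin (mu - me sin u)`. Integration by parts reduces these to `J_m` and `J_m'`, and
parity removes the `cos mℓ` part (`integral_funCEll_eq_coeff`). The sign of `Ω` enters twice and
cancels, so that one constant serves both orientations.

For almost all `e` the coefficient `A_m + η B_m` is nonzero: up to a factor, `(A_m + B_m)(A_m -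
B_m)` is the restriction of a function analytic on the whole line, which for `e > 1` is a sum of
squares and cannot vanish identically (`exists_coeffProduct_ne_zero`).

The way back to the time solves `dg/dt = ∂H/∂G`, a positive periodic velocity up to sign; the
equation for `G` follows from conservation of energy. The Cartesian equations follow from the
canonical brackets of position and momentum in Delaunay elements, verified as algebraic identities.
-/

namespace GravWave

open Topology Filter

/-! ### Implicit functions given by a unique root -/

/-- If `Y p` is the only root of `F (p, ·)` in a fixed neighbourhood, for all `p` near `p₀`, and the
partial derivative of the analytic function `F` does not vanish, then `Y` is analytic. -/
theorem analyticAt_of_unique_root {E : Type*} [NormedAddCommGroup E] [NormedSpace ℝ E]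
    [CompleteSpace E] {F : E × ℝ → ℝ} {Y : E → ℝ} {p₀ : E} {d : ℝ} {V : Set ℝ}
    (hF : AnalyticAt ℝ F (p₀, Y p₀)) (h0 : F (p₀, Y p₀) = 0) (hd : d ≠ 0)
    (hder : HasDerivAt (fun y => F (p₀, y)) d (Y p₀)) (hV : V ∈ 𝓝 (Y p₀))
    (huniq : ∀ᶠ p in 𝓝 p₀, ∀ y ∈ V, F (p, y) = 0 → y = Y p) : AnalyticAt ℝ Y p₀ := by
  -- In `WithTop ℕ∞` the exponent `⊤` stands for analyticity, so the implicit function below is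
  -- analytic and not merely smooth.
  have cdf : ContDiffAt ℝ ⊤ F (p₀, Y p₀) := hF.contDiffAt
  have hcomp : fderiv ℝ F (p₀, Y p₀) ∘L .inr ℝ E ℝ = ContinuousLinearMap.toSpanSingleton ℝ d := by
    have h1 : HasFDerivAt (fun y => F (p₀, y)) (fderiv ℝ F (p₀, Y p₀) ∘L .inr ℝ E ℝ) (Y p₀) :=
      (hF.differentiableAt.hasFDerivAt).comp (Y p₀) (hasFDerivAt_prodMk_right p₀ (Y p₀))
    exact h1.unique hder.hasFDerivAt
  have inv : (fderiv ℝ F (p₀, Y p₀) ∘L .inr ℝ E ℝ).IsInvertible := by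
    rw [hcomp]
    refine ⟨ContinuousLinearEquiv.unitsEquivAut ℝ (Units.mk0 d hd), ?_⟩
    ext
    simp
  have hn : (⊤ : WithTop ℕ∞) ≠ 0 := by simp
  have han := (cdf.contDiffAt_implicitFunction hn inv)
  have heq := cdf.eventually_apply_implicitFunction hn inv
  have hself := cdf.implicitFunction_apply_self hn inv
  simp only at hself
  have hcont : ContinuousAt (cdf.implicitFunction hn inv) p₀ := han.continuousAt
  have hmem : ∀ᶠ p in 𝓝 p₀, cdf.implicitFunction hn inv p ∈ V :=
    hcont (by rw [hself]; exact hV)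
  -- Continuity of `Y` is not assumed. The implicit function is continuous, hence stays in `V` near
  -- `p₀`, and uniqueness in `V` identifies it with `Y`.
  have : cdf.implicitFunction hn inv =ᶠ[𝓝 p₀] Y := by
    filter_upwards [heq, hmem, huniq] with p h1 h2 h3
    exact h3 _ h2 (h1.trans h0)
  exact (han.analyticAt).congr this

/-! ### Superposition operators -/

section Nemytskii

variable {K E F : Type*} [TopologicalSpace K] [CompactSpace K] [NormedAddCommGroup E]
  [NormedSpace ℝ E] [NormedAddCommGroup F] [NormedSpace ℝ F]

open Classical in
/-- The superposition operator `w ↦ (k ↦ f (w k, k))`, with value `0` if the result is not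
continuous. -/
noncomputable def nemytskii (f : E × K → F) (w : C(K, E)) : C(K, F) :=
  if h : Continuous (fun k => f (w k, k)) then ⟨_, h⟩ else 0

/-- Pointwise application of a continuous family of linear maps. -/
noncomputable def applyFamily (A : C(K, E →L[ℝ] F)) : C(K, E) →L[ℝ] C(K, F) :=
  LinearMap.mkContinuous
    { toFun := fun w => ⟨fun k => A k (w k), A.continuous.clm_apply w.continuous⟩
      map_add' := fun v w => by ext k; simp
      map_smul' := fun c w => by ext k; simp } ‖A‖ (fun w => by
        refine (ContinuousMap.norm_le _ (by positivity)).2 fun k => ?_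
        exact ((A k).le_opNorm _).trans
          (by gcongr; exacts [A.norm_coe_le_norm k, w.norm_coe_le_norm k]))

@[simp] theorem applyFamily_apply (A : C(K, E →L[ℝ] F)) (w : C(K, E)) (k : K) :
    applyFamily A w k = A k (w k) := rfl

omit [CompactSpace K] [NormedSpace ℝ E] [NormedSpace ℝ F] in
theorem nemytskii_apply {f : E × K → F} {D : Set E} (hf : ContinuousOn f (D ×ˢ univ))
    {w : C(K, E)} (hw : ∀ k, w k ∈ D) (k : K) : nemytskii f w k = f (w k, k) := by
  have h : Continuous (fun k => f (w k, k)) :=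
    hf.comp_continuous (by fun_prop) fun k => ⟨hw k, mem_univ _⟩
  rw [nemytskii, dif_pos h]
  rfl

/-- Compactness of `K` makes the pointwise estimates uniform: on a small ball `f' (p, k)` is close
to `A k` for all `k` at once, and the mean value inequality for each fixed `k` then gives an
estimate in the supremum norm. -/
theorem hasStrictFDerivAt_nemytskii {f : E × K → F} {D : Set E} (hD : IsOpen D) (h0 : 0 ∈ D)
    {f' : E × K → E →L[ℝ] F} (hf : ContinuousOn f (D ×ˢ univ))
    (hf' : ContinuousOn f' (D ×ˢ univ))
    (hder : ∀ p ∈ D, ∀ k, HasFDerivAt (fun q => f (q, k)) (f' (p, k)) p)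
    {A : C(K, E →L[ℝ] F)} (hA : ∀ k, A k = f' (0, k)) :
    HasStrictFDerivAt (nemytskii f) (applyFamily A) 0 := by
  refine .of_isLittleO (Asymptotics.isLittleO_iff.2 fun c hc => ?_)
  have hnear : ∀ᶠ p in 𝓝 (0 : E), ∀ k ∈ (univ : Set K), ‖f' (p, k) - A k‖ ≤ c := by
    refine isCompact_univ.eventually_forall_of_forall_eventually fun k _ => ?_
    have h1 : ContinuousAt (fun z : E × K => ‖f' (z.1, z.2) - A z.2‖) (0, k) := by
      have h2 : ContinuousAt f' (0, k) :=
        hf'.continuousAt ((hD.prod isOpen_univ).mem_nhds ⟨h0, mem_univ _⟩)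
      exact (h2.sub (A.continuous.continuousAt.comp continuousAt_snd)).norm
    have h2 : ‖f' ((0 : E), k) - A k‖ < c := by simp [hA, hc]
    exact (h1.eventually (gt_mem_nhds h2)).mono fun z hz => le_of_lt hz
  obtain ⟨r, hr, hball⟩ := Metric.mem_nhds_iff.1 (hnear.and (hD.mem_nhds h0))
  have hmem : ∀ᶠ z in 𝓝 ((0 : C(K, E)), (0 : C(K, E))), z ∈ Metric.ball (0 : C(K, E) × C(K, E)) r :=
    Metric.ball_mem_nhds _ hr
  filter_upwards [hmem] with z hz
  have hb : ∀ w : C(K, E), ‖w‖ < r → ∀ k, w k ∈ Metric.ball (0 : E) r := fun w hw k => by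
    simpa using (w.norm_coe_le_norm k).trans_lt hw
  have hz' : ‖z‖ < r := by simpa using hz
  have h1 := hb z.1 ((norm_fst_le z).trans_lt hz')
  have h2 := hb z.2 ((norm_snd_le z).trans_lt hz')
  refine (ContinuousMap.norm_le _ (by positivity)).2 fun k => ?_
  simp only [ContinuousMap.sub_apply, applyFamily_apply]
  rw [nemytskii_apply hf (fun k => (hball (h1 k)).2), nemytskii_apply hf (fun k => (hball (h2 k)).2)]
  -- Mean value inequality for `q ↦ f (q, k) - A k q`, whose derivative has norm at most `c` on the
  -- ball.
  have := (convex_ball (0 : E) r).norm_image_sub_le_of_norm_hasFDerivWithin_le'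
    (f := fun q => f (q, k)) (f' := fun p => f' (p, k)) (φ := A k) (C := c)
    (fun p hp => (hder p (hball hp).2 k).hasFDerivWithinAt)
    (fun p hp => (hball hp).1 k (mem_univ _)) (h2 k) (h1 k)
  refine this.trans (mul_le_mul_of_nonneg_left ?_ hc.le)
  exact (z.1 - z.2).norm_coe_le_norm k

end Nemytskii

/-! ### Linear algebra of the closing conditions -/

/-- The linear part of the boundary value problem for periodic solutions is bijective. -/
theorem bijective_of_periodic_linearization {Z : Type*} [AddCommGroup Z] [Module ℝ Z]
    {c : ℝ →ₗ[ℝ] Z} {ev m : Z →ₗ[ℝ] ℝ} {S : Z →ₗ[ℝ] Z} {dR dN : ℝ × Z × Z →ₗ[ℝ] Z} {ρ : Z}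
    {Λ : ℝ × Z × Z → ℝ × Z × Z} {κ b : ℝ}
    (hevc : ∀ r, ev (c r) = r) (hevS : ∀ z, ev (S z) = 0) (hρ : ev ρ = 0)
    (hdN : ∀ ξ υ, dN (0, ξ, υ) = κ • ξ) (hκ : κ ≠ 0) (hmc : m (c 1) ≠ 0)
    (hdR : m (dR (0, 0, c 1)) = b) (hb : b ≠ 0)
    (hΛ : ∀ w, Λ w = (w.1, w.2.1 - c (ev w.2.1) - w.1 • ρ + c (m (dR w)),
      w.2.2 - c (ev w.2.2) - S (dN w) + c (m (dN w)))) : Function.Bijective Λ := by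
  have hc : ∀ r, c r = r • c 1 := fun r => by rw [← map_smul]; simp
  have hdR' : ∀ r, m (dR (0, 0, c r)) = r * b := fun r => by
    have : ((0 : ℝ), (0 : Z), c r) = r • ((0 : ℝ), (0 : Z), c 1) := by
      rw [hc r]; simp
    rw [this, map_smul, map_smul, hdR, smul_eq_mul]
  have hadd : ∀ (f : ℝ × Z × Z →ₗ[ℝ] Z) e ξ υ ξ' υ',
      f (e, ξ + ξ', υ + υ') = f (e, ξ, υ) + f (0, ξ', υ') := fun f e ξ υ ξ' υ' => by
    rw [← map_add]; simp
  have hmcr : ∀ r, m (c r) = r * m (c 1) := fun r => by rw [hc r]; simp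
  constructor
  · have hΛlin : ∀ w w', Λ w - Λ w' = Λ (w - w') := fun w w' => by
      simp only [hΛ, Prod.fst_sub, Prod.snd_sub, map_sub, Prod.mk_sub_mk, Prod.mk.injEq, sub_smul]
      exact ⟨trivial, by abel, by abel⟩
    suffices h : ∀ w, Λ w = 0 → w = 0 from fun w w' hww => by
      rw [← sub_eq_zero]; exact h _ (by rw [← hΛlin, hww, sub_self])
    rintro ⟨e, ξ, υ⟩ h
    rw [hΛ] at h
    simp only [Prod.mk_eq_zero] at h
    obtain ⟨he, h1, h2⟩ := h
    subst he
    -- At the initial point only the closing terms `m (dR w)` and `m (dN w)` survive, so both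
    -- vanish. Hence `ξ` is a constant, which the twist `κ` forces to be zero; then `υ` is a
    -- constant, which `b` forces to be zero.
    have h1' := congrArg ev h1
    simp only [map_add, map_sub, hevc, zero_smul, map_zero, sub_self, zero_add] at h1'
    have h2' := congrArg ev h2
    simp only [map_add, map_sub, hevc, hevS, map_zero, sub_self, zero_add] at h2'
    rw [h1', zero_smul, map_zero, sub_zero, add_zero, sub_eq_zero] at h1
    rw [hdN, map_smul, h1, hmcr, smul_eq_mul] at h2'
    have h3 : ev ξ = 0 := by
      simpa [hκ, hmc] using h2'
    have hξ : ξ = 0 := by rw [h1, h3, map_zero]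
    subst hξ
    rw [hdN] at h2
    simp only [smul_zero, map_zero, sub_zero, add_zero, sub_eq_zero] at h2
    rw [h2, hdR'] at h1'
    have h4 : ev υ = 0 := by simpa [hb] using h1'
    rw [h2, h4, map_zero]
    rfl
  · rintro ⟨e, a, β⟩
    -- The free constants are found in triangular order: `dN` does not see `υ`, so `ξ₀` comes from
    -- the second closing equation alone, and `υ₀` then comes from the first.
    obtain ⟨ξ₀, hξ₀⟩ : ∃ r : ℝ,
        m (dN (e, a - c (ev a) + e • ρ, 0)) + κ * (r * m (c 1)) = ev β :=
      ⟨(ev β - m (dN (e, a - c (ev a) + e • ρ, 0))) / (κ * m (c 1)), by field_simp; ring⟩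
    set ξ := a - c (ev a) + e • ρ + c ξ₀ with hξ
    obtain ⟨υ₀, hυ₀⟩ : ∃ r : ℝ, m (dR (e, ξ, β - c (ev β) + S (dN (e, ξ, 0)))) + r * b = ev a :=
      ⟨(ev a - m (dR (e, ξ, β - c (ev β) + S (dN (e, ξ, 0))))) / b, by field_simp; ring⟩
    set υ := β - c (ev β) + S (dN (e, ξ, 0)) + c υ₀ with hυ
    have hN : ∀ υ, dN (e, ξ, υ) = dN (e, ξ, 0) := fun υ => by
      have := hadd dN e ξ 0 0 υ
      simpa [hdN] using this
    have hmN : m (dN (e, ξ, 0)) = ev β := by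
      have := hadd dN e (a - c (ev a) + e • ρ) 0 (c ξ₀) 0
      rw [add_zero, ← hξ, hdN] at this
      rw [this, map_add, map_smul, smul_eq_mul, hmcr, hξ₀]
    have hmR : m (dR (e, ξ, υ)) = ev a := by
      have := hadd dR e ξ (β - c (ev β) + S (dN (e, ξ, 0))) 0 (c υ₀)
      rw [add_zero, ← hυ] at this
      rw [this, map_add, hdR', hυ₀]
    have hevξ : ev ξ = ξ₀ := by simp [hξ, hevc, hρ]
    have hevυ : ev υ = υ₀ := by simp [hυ, hevc, hevS]
    refine ⟨(e, ξ, υ), ?_⟩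
    rw [hΛ]
    simp only [hN υ, hmN, hmR, hevξ, hevυ, Prod.mk.injEq, true_and]
    constructor
    · rw [hξ]; abel
    · rw [hυ]; abel

end GravWave

/-! ### Periodic extension and the operators of the boundary value problem -/

namespace GravWave

open Topology Filter

/-- A solution of an integral equation on `[0, T]` that closes up, for a vector field that is
`T`-periodic in the time, extends to a `T`-periodic solution of the differential equation. -/
theorem exists_periodic_extension {E : Type*} [NormedAddCommGroup E] [NormedSpace ℝ E]
    [CompleteSpace E] {T : ℝ} (hT : 0 < T) {v : E × ℝ → E} {D : Set E}
    (hv : ContinuousOn v (D ×ˢ univ)) (hper : ∀ p ∈ D, ∀ g, v (p, g + T) = v (p, g))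
    {z : C(Icc 0 T, E)} (hz : ∀ k, z k ∈ D)
    (heq : ∀ k, z k = z ⟨0, left_mem_Icc.2 hT.le⟩ +
      ∫ t in (0 : ℝ)..k, v (z (projIcc 0 T hT.le t), t))
    (hclose : z ⟨T, right_mem_Icc.2 hT.le⟩ = z ⟨0, left_mem_Icc.2 hT.le⟩) :
    ∃ Z : ℝ → E, (∀ k : Icc 0 T, Z k = z k) ∧ (∀ g, ∃ k, Z g = z k) ∧
      (∀ g, HasDerivAt Z (v (Z g, g)) g) ∧ ∀ g, Z (g + T) = Z g := by
  have hmem : ∀ g, toIcoMod hT 0 g ∈ Icc 0 T := fun g => by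
    have := toIcoMod_mem_Ico hT 0 g
    rw [zero_add] at this
    exact Ico_subset_Icc_self this
  set Z : ℝ → E := fun g => z ⟨toIcoMod hT 0 g, hmem g⟩ with hZ
  have hZper : ∀ g, Z (g + T) = Z g := fun g => by simp [hZ]
  have hZIcc : ∀ k : Icc 0 T, Z k = z k := by
    rintro ⟨k, hk⟩
    rcases eq_or_lt_of_le hk.2 with h | h
    -- The right end point reduces to `0` modulo the period; the closing condition makes the two
    -- values agree.
    · subst h
      have : Z k = Z 0 := by simpa using hZper 0
      simp only
      rw [this, hclose]
      simp [hZ]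
    · have : toIcoMod hT 0 k = k := (toIcoMod_eq_self hT).2 ⟨hk.1, by rwa [zero_add]⟩
      simp only [hZ]
      congr 1
      exact Subtype.ext this
  have hZD : ∀ g, Z g ∈ D := fun g => hz _
  set w : ℝ → E := fun t => v (Z t, t) with hw
  have hwper : Function.Periodic w T := fun t => by
    simp only [hw]
    rw [hZper, hper _ (hZD t)]
  have hwIcc : ∀ t ∈ Icc 0 T, w t = v (z (projIcc 0 T hT.le t), t) := fun t ht => by
    simp only [hw]
    rw [projIcc_of_mem hT.le ht, ← hZIcc ⟨t, ht⟩]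
  have hcont : Continuous fun t => v (z (projIcc 0 T hT.le t), t) :=
    hv.comp_continuous (by fun_prop) fun t => ⟨hz _, mem_univ _⟩
  have hint0 : IntervalIntegrable w volume 0 T := by
    refine ContinuousOn.intervalIntegrable (hcont.continuousOn.congr fun t ht => ?_)
    rw [uIcc_of_le hT.le] at ht
    exact hwIcc t ht
  have hint : ∀ a b, IntervalIntegrable w volume a b := fun a b =>
    hwper.intervalIntegrable₀ hT.ne' hint0 a b
  -- `Z` is not yet known to be continuous across multiples of `T`. The primitive `Q` is, agrees
  -- with `Z` on `[0, T]`, and is periodic because the closing condition makes the integral over a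
  -- period zero; hence `Q = Z`.
  set Q : ℝ → E := fun g => z ⟨0, left_mem_Icc.2 hT.le⟩ + ∫ t in (0 : ℝ)..g, w t with hQ
  have hQIcc : ∀ g ∈ Icc 0 T, Q g = Z g := fun g hg => by
    rw [hZIcc ⟨g, hg⟩, heq ⟨g, hg⟩]
    simp only [hQ]
    congr 1
    refine intervalIntegral.integral_congr fun t ht => ?_
    rw [uIcc_of_le hg.1] at ht
    exact hwIcc t ⟨ht.1, ht.2.trans hg.2⟩
  have htot : ∫ t in (0 : ℝ)..T, w t = 0 := by
    have h1 := hQIcc T (right_mem_Icc.2 hT.le)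
    rw [hZIcc ⟨T, right_mem_Icc.2 hT.le⟩, hclose] at h1
    simpa [hQ] using h1
  have hQper : Function.Periodic Q T := fun g => by
    simp only [hQ]
    congr 1
    rw [← intervalIntegral.integral_add_adjacent_intervals (hint 0 g) (hint g (g + T)),
      hwper.intervalIntegral_add_eq g 0, zero_add, htot, add_zero]
  have hQZ : Q = Z := by
    funext g
    have h1 : Q (toIcoMod hT 0 g) = Q g := hQper.sub_zsmul_eq _
    have h2 : Z (toIcoMod hT 0 g) = Z g := (show Function.Periodic Z T from hZper).sub_zsmul_eq _
    rw [← h1, ← h2, hQIcc _ (hmem g)]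
  have hZcont : Continuous Z := by
    rw [← hQZ]
    exact continuous_const.add (intervalIntegral.continuous_primitive hint 0)
  have hwcont : Continuous w :=
    hv.comp_continuous (by fun_prop) fun t => ⟨hZD t, mem_univ _⟩
  refine ⟨Z, hZIcc, fun g => ⟨_, rfl⟩, fun g => ?_, hZper⟩
  have h : HasDerivAt Q (w g) g := ((hwcont.integral_hasStrictDerivAt 0 g).hasDerivAt).const_add
    (z ⟨0, left_mem_Icc.2 hT.le⟩)
  rwa [hQZ] at h

section Operators

variable {T : ℝ}

/-- The primitive that vanishes at `0`, as an operator on continuous functions on `[0, T]`. -/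
noncomputable def primitiveOp (hT : 0 ≤ T) : C(Icc 0 T, ℝ) →L[ℝ] C(Icc 0 T, ℝ) :=
  LinearMap.mkContinuous
    { toFun := fun z => ⟨fun k => ∫ t in (0 : ℝ)..k, z (projIcc 0 T hT t), by
        have h : Continuous fun t => z (projIcc 0 T hT t) := by fun_prop
        exact (intervalIntegral.continuous_primitive (fun a b => h.intervalIntegrable a b) 0).comp
          continuous_subtype_val⟩
      map_add' := fun y z => by
        ext k
        have h : ∀ z : C(Icc 0 T, ℝ), Continuous fun t => z (projIcc 0 T hT t) := by
          intro z; fun_prop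
        simpa using intervalIntegral.integral_add ((h y).intervalIntegrable 0 k)
          ((h z).intervalIntegrable 0 k)
      map_smul' := fun c z => by
        ext k
        simp } T (fun z => by
        refine (ContinuousMap.norm_le _ (by positivity)).2 fun k => ?_
        have := intervalIntegral.norm_integral_le_of_norm_le_const (a := 0) (b := (k : ℝ))
          (f := fun t => z (projIcc 0 T hT t)) (C := ‖z‖) fun t _ => z.norm_coe_le_norm _
        refine this.trans ?_
        rw [mul_comm, sub_zero, abs_of_nonneg k.2.1]
        exact mul_le_mul_of_nonneg_right k.2.2 (norm_nonneg _))

@[simp] theorem primitiveOp_apply (hT : 0 ≤ T) (z : C(Icc 0 T, ℝ)) (k : Icc 0 T) :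
    primitiveOp hT z k = ∫ t in (0 : ℝ)..k, z (projIcc 0 T hT t) := rfl

/-- A number and two functions as one function with values in the product. -/
noncomputable def tripleOp (T : ℝ) :
    ℝ × C(Icc 0 T, ℝ) × C(Icc 0 T, ℝ) →L[ℝ] C(Icc 0 T, ℝ × ℝ × ℝ) :=
  LinearMap.mkContinuous
    { toFun := fun w => ⟨fun k => (w.1, w.2.1 k, w.2.2 k), by fun_prop⟩
      map_add' := fun v w => by ext k <;> simp
      map_smul' := fun c w => by ext k <;> simp } 1 (fun w => by
        refine (ContinuousMap.norm_le _ (by positivity)).2 fun k => ?_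
        rw [one_mul]
        refine max_le_max le_rfl (max_le_max ?_ ?_)
        · exact w.2.1.norm_coe_le_norm k
        · exact w.2.2.norm_coe_le_norm k)

@[simp] theorem tripleOp_apply (w : ℝ × C(Icc 0 T, ℝ) × C(Icc 0 T, ℝ)) (k : Icc 0 T) :
    tripleOp T w k = (w.1, w.2.1 k, w.2.2 k) := rfl

end Operators

end GravWave

/-! ### Continuation of periodic solutions in twist systems -/

namespace GravWave

open Topology Filter

/-- The partial derivative along the state variables of a `C¹` function of state and time. -/
theorem hasFDerivAt_slice {E : Type*} [NormedAddCommGroup E] [NormedSpace ℝ E] {D : Set E}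
    (hD : IsOpen D) {f : E × ℝ → ℝ} (hf : ContDiffOn ℝ 1 f (D ×ˢ univ)) {p : E} (hp : p ∈ D)
    (g : ℝ) : HasFDerivAt (fun q => f (q, g)) (fderiv ℝ f (p, g) ∘L .inl ℝ E ℝ) p := by
  have h : DifferentiableAt ℝ f (p, g) :=
    (hf.contDiffAt ((hD.prod isOpen_univ).mem_nhds ⟨hp, mem_univ _⟩)).differentiableAt (by simp)
  exact h.hasFDerivAt.comp p (hasFDerivAt_prodMk_left p g)

/-- The superposition lemma on the compact interval `[0, T]`. The family `A` is returned together
with its pointwise meaning, so that its values can be computed from the twist and from the average.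
-/
theorem exists_nemytskii_deriv {E : Type*} [NormedAddCommGroup E] [NormedSpace ℝ E] {D : Set E}
    (hD : IsOpen D) (h0 : (0 : E) ∈ D) {f : E × ℝ → ℝ} (hf : ContDiffOn ℝ 1 f (D ×ˢ univ))
    (T : ℝ) : ∃ A : C(Icc 0 T, E →L[ℝ] ℝ),
      (∀ k : Icc 0 T, HasFDerivAt (fun q => f (q, (k : ℝ))) (A k) 0) ∧
      HasStrictFDerivAt (nemytskii fun q : E × Icc 0 T => f (q.1, (q.2 : ℝ))) (applyFamily A) 0 := by
  have hc : ContinuousOn (fun q : E × ℝ => fderiv ℝ f q ∘L .inl ℝ E ℝ) (D ×ˢ univ) :=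
    (hf.continuousOn_fderiv_of_isOpen (hD.prod isOpen_univ) le_rfl).clm_comp continuousOn_const
  have hmaps : MapsTo (fun q : E × Icc 0 T => (q.1, (q.2 : ℝ))) (D ×ˢ univ) (D ×ˢ univ) :=
    fun q hq => ⟨hq.1, mem_univ _⟩
  have hpair : Continuous fun q : E × Icc 0 T => (q.1, (q.2 : ℝ)) := by fun_prop
  refine ⟨⟨fun k => fderiv ℝ f (0, (k : ℝ)) ∘L .inl ℝ E ℝ,
    hc.comp_continuous (by fun_prop) fun k => ⟨h0, mem_univ _⟩⟩,
    fun k => hasFDerivAt_slice hD hf h0 k, ?_⟩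
  exact hasStrictFDerivAt_nemytskii hD h0
    (f' := fun q : E × Icc 0 T => fderiv ℝ f (q.1, (q.2 : ℝ)) ∘L .inl ℝ E ℝ)
    (hf.continuousOn.comp hpair.continuousOn hmaps) (hc.comp hpair.continuousOn hmaps)
    (fun p hp k => hasFDerivAt_slice hD hf hp k) fun k => rfl

/-- The data of a weakly coupled periodic planar system `x' = ε R`, `y' = N`, with state `(ε, x, y)`
and time `g`, where `N` reduces to a twist `n x` at `ε = 0`. -/
structure IsTwistSystem (T δ : ℝ) (R N : (ℝ × ℝ × ℝ) × ℝ → ℝ) (n : ℝ → ℝ) (κ b : ℝ) : Prop where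
  period_pos : 0 < T
  radius_pos : 0 < δ
  smoothR : ContDiffOn ℝ 1 R ({p | |p.1| < δ ∧ |p.2.1| < δ} ×ˢ univ)
  smoothN : ContDiffOn ℝ 1 N ({p | |p.1| < δ ∧ |p.2.1| < δ} ×ˢ univ)
  periodicR : ∀ p : ℝ × ℝ × ℝ, |p.1| < δ → |p.2.1| < δ → ∀ g, R (p, g + T) = R (p, g)
  periodicN : ∀ p : ℝ × ℝ × ℝ, |p.1| < δ → |p.2.1| < δ → ∀ g, N (p, g + T) = N (p, g)
  twist : ∀ x y g, |x| < δ → N ((0, x, y), g) = n x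
  twist_zero : n 0 = 0
  twist_deriv : HasDerivAt n κ 0
  twist_ne : κ ≠ 0
  average : ∫ g in (0 : ℝ)..T, R ((0, 0, 0), g) = 0
  average_deriv : HasDerivAt (fun y => ∫ g in (0 : ℝ)..T, R ((0, 0, y), g)) b 0
  average_ne : b ≠ 0

namespace IsTwistSystem

variable {T δ κ b : ℝ} {R N : (ℝ × ℝ × ℝ) × ℝ → ℝ} {n : ℝ → ℝ}

theorem isOpen_domain (δ : ℝ) : IsOpen {p : ℝ × ℝ × ℝ | |p.1| < δ ∧ |p.2.1| < δ} :=
  (isOpen_lt (f := fun p : ℝ × ℝ × ℝ => |p.1|) (by fun_prop) continuous_const).inter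
    (isOpen_lt (f := fun p : ℝ × ℝ × ℝ => |p.2.1|) (by fun_prop) continuous_const)

/-- Existence of a continuous family of closed solutions of the integral equations. -/
theorem exists_boundary_solution (h : IsTwistSystem T δ R N n κ b) :
    ∃ W : ℝ → C(Icc 0 T, ℝ) × C(Icc 0 T, ℝ), W 0 = 0 ∧
      (∀ᶠ ε in 𝓝 (0 : ℝ), ContinuousAt W ε) ∧
      ∀ᶠ ε in 𝓝 (0 : ℝ), (∀ k, |(W ε).1 k| < δ) ∧
        (∀ k, (W ε).1 k = (W ε).1 ⟨0, left_mem_Icc.2 h.period_pos.le⟩ +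
          ∫ t in (0 : ℝ)..k, ε * R ((ε, (W ε).1 (projIcc 0 T h.period_pos.le t),
            (W ε).2 (projIcc 0 T h.period_pos.le t)), t)) ∧
        (∀ k, (W ε).2 k = (W ε).2 ⟨0, left_mem_Icc.2 h.period_pos.le⟩ +
          ∫ t in (0 : ℝ)..k, N ((ε, (W ε).1 (projIcc 0 T h.period_pos.le t),
            (W ε).2 (projIcc 0 T h.period_pos.le t)), t)) ∧
        (W ε).1 ⟨T, right_mem_Icc.2 h.period_pos.le⟩ =
          (W ε).1 ⟨0, left_mem_Icc.2 h.period_pos.le⟩ ∧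
        (W ε).2 ⟨T, right_mem_Icc.2 h.period_pos.le⟩ =
          (W ε).2 ⟨0, left_mem_Icc.2 h.period_pos.le⟩ := by
  have hT := h.period_pos
  set D : Set (ℝ × ℝ × ℝ) := {p | |p.1| < δ ∧ |p.2.1| < δ} with hDdef
  have hD : IsOpen D := isOpen_domain δ
  have h0D : (0 : ℝ × ℝ × ℝ) ∈ D := by simp [hDdef, h.radius_pos]
  obtain ⟨AR, hAR, hNR⟩ := exists_nemytskii_deriv hD h0D h.smoothR T
  obtain ⟨AN, hAN, hNN⟩ := exists_nemytskii_deriv hD h0D h.smoothN T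
  set nR : C(Icc 0 T, ℝ × ℝ × ℝ) → C(Icc 0 T, ℝ) :=
    nemytskii fun q : (ℝ × ℝ × ℝ) × Icc 0 T => R (q.1, (q.2 : ℝ)) with hnR
  set nN : C(Icc 0 T, ℝ × ℝ × ℝ) → C(Icc 0 T, ℝ) :=
    nemytskii fun q : (ℝ × ℝ × ℝ) × Icc 0 T => N (q.1, (q.2 : ℝ)) with hnN
  set S := primitiveOp hT.le with hS
  set a₀ : Icc 0 T := ⟨0, left_mem_Icc.2 hT.le⟩ with ha₀
  set a₁ : Icc 0 T := ⟨T, right_mem_Icc.2 hT.le⟩ with ha₁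
  set ev : C(Icc 0 T, ℝ) →L[ℝ] ℝ := ContinuousMap.evalCLM ℝ a₀ with hev
  set m : C(Icc 0 T, ℝ) →L[ℝ] ℝ := ContinuousMap.evalCLM ℝ a₁ ∘L S with hm
  set c : ℝ →L[ℝ] C(Icc 0 T, ℝ) := ContinuousLinearMap.toSpanSingleton ℝ (1 : C(Icc 0 T, ℝ)) with hc
  set ι := tripleOp T with hι
  have hcapp : ∀ r k, c r k = r := fun r k => by simp [hc]
  have hevS : ∀ z, ev (S z) = 0 := fun z => by simp [hev, hS, ha₀]
  have hmapp : ∀ z, m z = ∫ t in (0 : ℝ)..T, z (projIcc 0 T hT.le t) := fun z => by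
    simp [hm, hS, ha₁]
  have hnRapp : ∀ w : C(Icc 0 T, ℝ × ℝ × ℝ), (∀ k, w k ∈ D) → ∀ k, nR w k = R (w k, k) := by
    intro w hw k
    refine nemytskii_apply (D := D) ?_ hw k
    exact h.smoothR.continuousOn.comp (by fun_prop) fun q hq => ⟨hq.1, mem_univ _⟩
  have hnNapp : ∀ w : C(Icc 0 T, ℝ × ℝ × ℝ), (∀ k, w k ∈ D) → ∀ k, nN w k = N (w k, k) := by
    intro w hw k
    refine nemytskii_apply (D := D) ?_ hw k
    exact h.smoothN.continuousOn.comp (by fun_prop) fun q hq => ⟨hq.1, mem_univ _⟩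
  have hmR : ∀ w : C(Icc 0 T, ℝ × ℝ × ℝ), (∀ k, w k ∈ D) →
      m (nR w) = ∫ t in (0 : ℝ)..T, R (w (projIcc 0 T hT.le t), t) := by
    intro w hw
    rw [hmapp]
    refine intervalIntegral.integral_congr fun t ht => ?_
    rw [uIcc_of_le hT.le] at ht
    simp only [hnRapp w hw, projIcc_of_mem hT.le ht]
  -- the linearizations
  have hι0 : ι 0 = 0 := map_zero _
  have hdR : HasStrictFDerivAt (fun w => nR (ι w)) (applyFamily AR ∘L ι) 0 := by
    refine HasStrictFDerivAt.comp (f := ι) (0 : ℝ × C(Icc 0 T, ℝ) × C(Icc 0 T, ℝ)) ?_ ι.hasStrictFDerivAt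
    rw [hι0]; exact hNR
  have hdN : HasStrictFDerivAt (fun w => nN (ι w)) (applyFamily AN ∘L ι) 0 := by
    refine HasStrictFDerivAt.comp (f := ι) (0 : ℝ × C(Icc 0 T, ℝ) × C(Icc 0 T, ℝ)) ?_ ι.hasStrictFDerivAt
    rw [hι0]; exact hNN
  -- At `ε = 0` the function `N` depends only on `x`, so its derivative along `(0, ξ, υ)` is read
  -- off from `n`.
  have hANκ : ∀ k ξ υ, AN k (0, ξ, υ) = κ * ξ := by
    intro k ξ υ
    have hl : HasDerivAt (fun s : ℝ => s • ((0 : ℝ), ξ, υ)) ((0 : ℝ), ξ, υ) 0 := by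
      simpa using (hasDerivAt_id (0 : ℝ)).smul_const ((0 : ℝ), ξ, υ)
    have h1 : HasDerivAt (fun s : ℝ => N (s • ((0 : ℝ), ξ, υ), (k : ℝ))) (AN k (0, ξ, υ)) 0 := by
      refine HasFDerivAt.comp_hasDerivAt (l := fun q => N (q, (k : ℝ))) (0 : ℝ) ?_ hl
      rw [zero_smul]; exact hAN k
    have h2 : HasDerivAt (fun s : ℝ => n (s * ξ)) (κ * ξ) 0 := by
      refine HasDerivAt.comp (h₂ := n) (0 : ℝ) ?_ (by simpa using (hasDerivAt_id (0 : ℝ)).mul_const ξ)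
      rw [zero_mul]; exact h.twist_deriv
    refine h1.unique (h2.congr_of_eventuallyEq ?_)
    have hcont : ContinuousAt (fun s : ℝ => |s * ξ|) 0 := by fun_prop
    filter_upwards [hcont.eventually (gt_mem_nhds (by simpa using h.radius_pos))] with s hs
    have := h.twist (s * ξ) (s * υ) k hs
    simpa using this
  -- Along the constant functions `y` the integral of `R` is the function in `average_deriv`;
  -- uniqueness of derivatives identifies the entry with `b`.
  have hmdR : m (applyFamily AR (ι (0, 0, c 1))) = b := by
    have hl : HasDerivAt (fun y : ℝ => ((0 : ℝ), (0 : C(Icc 0 T, ℝ)), c y)) ((0 : ℝ), (0 : C(Icc 0 T, ℝ)), c 1) 0 := by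
      refine (hasDerivAt_const _ _).prodMk ((hasDerivAt_const _ _).prodMk ?_)
      exact c.hasDerivAt
    have h1 : HasDerivAt (fun y : ℝ => m (nR (ι ((0 : ℝ), (0 : C(Icc 0 T, ℝ)), c y))))
        (m (applyFamily AR (ι (0, 0, c 1)))) 0 := by
      refine m.hasFDerivAt.comp_hasDerivAt (0 : ℝ) ?_
      have hd0 : HasFDerivAt (fun w => nR (ι w)) (applyFamily AR ∘L ι)
          ((0 : ℝ), (0 : C(Icc 0 T, ℝ)), c 0) := by
        rw [map_zero]; exact hdR.hasFDerivAt
      exact hd0.comp_hasDerivAt (0 : ℝ) hl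
    refine h1.unique (h.average_deriv.congr_of_eventuallyEq (Eventually.of_forall fun y => ?_))
    simp only
    rw [hmR]
    · simp [hι, hcapp]
    · intro k
      simp [hι, hDdef, h.radius_pos]
  -- the boundary value problem
  set Φ : ℝ × C(Icc 0 T, ℝ) × C(Icc 0 T, ℝ) → ℝ × C(Icc 0 T, ℝ) × C(Icc 0 T, ℝ) := fun w => (w.1,
    w.2.1 - c (ev w.2.1) - w.1 • S (nR (ι w)) + c (m (nR (ι w))),
    w.2.2 - c (ev w.2.2) - S (nN (ι w)) + c (m (nN (ι w)))) with hΦ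
  have hnN0 : nN (ι 0) = 0 := by
    ext k
    rw [hnNapp _ (fun k => by simpa [hι] using h0D)]
    have := h.twist 0 0 k (by simpa using h.radius_pos)
    rw [h.twist_zero] at this
    exact this
  have hmR0 : m (nR (ι 0)) = 0 := by
    rw [hmR _ (fun k => by simpa [hι] using h0D)]
    exact h.average
  -- A solution of `Φ w = (ε, 0, 0)` encodes both integral equations and both closing conditions.
  -- The term `m (nR (ι w))` carries no factor `ε`; with such a factor the linearization at `0`
  -- would be singular.
  have hΦ0 : Φ 0 = 0 := by
    simp only [hΦ, hnN0, hmR0]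
    simp
  set Λ : ℝ × C(Icc 0 T, ℝ) × C(Icc 0 T, ℝ) →L[ℝ] ℝ × C(Icc 0 T, ℝ) × C(Icc 0 T, ℝ) :=
    (ContinuousLinearMap.fst ℝ ℝ (C(Icc 0 T, ℝ) × C(Icc 0 T, ℝ))).prod
      (((ContinuousLinearMap.fst ℝ C(Icc 0 T, ℝ) C(Icc 0 T, ℝ) ∘L .snd ℝ ℝ (C(Icc 0 T, ℝ) × C(Icc 0 T, ℝ))) -
        c ∘L ev ∘L (ContinuousLinearMap.fst ℝ C(Icc 0 T, ℝ) C(Icc 0 T, ℝ) ∘L .snd ℝ ℝ (C(Icc 0 T, ℝ) × C(Icc 0 T, ℝ))) -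
        (ContinuousLinearMap.fst ℝ ℝ (C(Icc 0 T, ℝ) × C(Icc 0 T, ℝ))).smulRight (S (nR (ι 0))) +
        c ∘L m ∘L (applyFamily AR ∘L ι)).prod
      ((ContinuousLinearMap.snd ℝ C(Icc 0 T, ℝ) C(Icc 0 T, ℝ) ∘L .snd ℝ ℝ (C(Icc 0 T, ℝ) × C(Icc 0 T, ℝ))) -
        c ∘L ev ∘L (ContinuousLinearMap.snd ℝ C(Icc 0 T, ℝ) C(Icc 0 T, ℝ) ∘L .snd ℝ ℝ (C(Icc 0 T, ℝ) × C(Icc 0 T, ℝ))) -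
        S ∘L (applyFamily AN ∘L ι) + c ∘L m ∘L (applyFamily AN ∘L ι))) with hΛ
  have hΦ' : HasStrictFDerivAt Φ Λ 0 := by
    have hfst := (ContinuousLinearMap.fst ℝ ℝ (C(Icc 0 T, ℝ) × C(Icc 0 T, ℝ))).hasStrictFDerivAt (x := 0)
    have hx := (ContinuousLinearMap.fst ℝ C(Icc 0 T, ℝ) C(Icc 0 T, ℝ) ∘L .snd ℝ ℝ (C(Icc 0 T, ℝ) × C(Icc 0 T, ℝ))).hasStrictFDerivAt (x := 0)
    have hy := (ContinuousLinearMap.snd ℝ C(Icc 0 T, ℝ) C(Icc 0 T, ℝ) ∘L .snd ℝ ℝ (C(Icc 0 T, ℝ) × C(Icc 0 T, ℝ))).hasStrictFDerivAt (x := 0)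
    have hSR := (S.hasStrictFDerivAt (x := nR (ι 0))).comp (0 : ℝ × C(Icc 0 T, ℝ) × C(Icc 0 T, ℝ)) hdR
    -- The factor `w.1` vanishes at `0`, so only one term of the product rule remains and no
    -- derivative of `R` enters.
    have hprod : HasStrictFDerivAt (fun w : ℝ × C(Icc 0 T, ℝ) × C(Icc 0 T, ℝ) => w.1 • S (nR (ι w)))
        ((ContinuousLinearMap.fst ℝ ℝ (C(Icc 0 T, ℝ) × C(Icc 0 T, ℝ))).smulRight (S (nR (ι 0)))) 0 := by
      refine (hfst.smul hSR).congr_fderiv ?_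
      ext w k <;> simp
    have hcm : ∀ {f : ℝ × C(Icc 0 T, ℝ) × C(Icc 0 T, ℝ) → C(Icc 0 T, ℝ)} {f'}, HasStrictFDerivAt f f' (0 : ℝ × C(Icc 0 T, ℝ) × C(Icc 0 T, ℝ)) →
        HasStrictFDerivAt (fun w => c (m (f w))) (c ∘L m ∘L f') 0 := fun {f f'} hf =>
      (c.hasStrictFDerivAt (x := m (f 0))).comp (0 : ℝ × C(Icc 0 T, ℝ) × C(Icc 0 T, ℝ))
        ((m.hasStrictFDerivAt (x := f 0)).comp (0 : ℝ × C(Icc 0 T, ℝ) × C(Icc 0 T, ℝ)) hf)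
    have hcev : ∀ {f : ℝ × C(Icc 0 T, ℝ) × C(Icc 0 T, ℝ) → C(Icc 0 T, ℝ)} {f'}, HasStrictFDerivAt f f' (0 : ℝ × C(Icc 0 T, ℝ) × C(Icc 0 T, ℝ)) →
        HasStrictFDerivAt (fun w => c (ev (f w))) (c ∘L ev ∘L f') 0 := fun {f f'} hf =>
      (c.hasStrictFDerivAt (x := ev (f 0))).comp (0 : ℝ × C(Icc 0 T, ℝ) × C(Icc 0 T, ℝ))
        ((ev.hasStrictFDerivAt (x := f 0)).comp (0 : ℝ × C(Icc 0 T, ℝ) × C(Icc 0 T, ℝ)) hf)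
    have hSN := (S.hasStrictFDerivAt (x := nN (ι 0))).comp (0 : ℝ × C(Icc 0 T, ℝ) × C(Icc 0 T, ℝ)) hdN
    exact hfst.prodMk ((((hx.sub (hcev hx)).sub hprod).add (hcm hdR)).prodMk
      (((hy.sub (hcev hy)).sub hSN).add (hcm hdN)))
  have hbij : Function.Bijective Λ := by
    refine bijective_of_periodic_linearization (c := c.toLinearMap) (ev := ev.toLinearMap)
      (m := m.toLinearMap) (S := S.toLinearMap) (dR := (applyFamily AR ∘L ι).toLinearMap)
      (dN := (applyFamily AN ∘L ι).toLinearMap) (ρ := S (nR (ι 0))) (κ := κ) (b := b)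
      (fun r => hcapp r a₀) hevS (hevS _) ?_ h.twist_ne ?_ hmdR h.average_ne fun w => rfl
    · intro ξ υ
      ext k
      simp [hι, hANκ]
    · have : m (c 1) = T := by rw [hmapp]; simp [hcapp]
      exact this.trans_ne hT.ne'
  set Λe : (ℝ × C(Icc 0 T, ℝ) × C(Icc 0 T, ℝ)) ≃L[ℝ] (ℝ × C(Icc 0 T, ℝ) × C(Icc 0 T, ℝ)) := ContinuousLinearEquiv.ofBijective Λ
    (LinearMap.ker_eq_bot.2 hbij.1) (LinearMap.range_eq_top.2 hbij.2) with hΛe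
  have hΦe : HasStrictFDerivAt Φ (Λe : ℝ × C(Icc 0 T, ℝ) × C(Icc 0 T, ℝ) →L[ℝ] ℝ × C(Icc 0 T, ℝ) × C(Icc 0 T, ℝ)) 0 := by
    rw [hΛe, ContinuousLinearEquiv.coe_ofBijective]; exact hΦ'
  set P := hΦe.toOpenPartialHomeomorph Φ with hP
  have hPcoe : ∀ w, P w = Φ w := fun w => rfl
  have h0s : (0 : ℝ × C(Icc 0 T, ℝ) × C(Icc 0 T, ℝ)) ∈ P.source := hΦe.mem_toOpenPartialHomeomorph_source
  have h0t : (0 : ℝ × C(Icc 0 T, ℝ) × C(Icc 0 T, ℝ)) ∈ P.target := by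
    have := P.map_source h0s
    rwa [hPcoe, hΦ0] at this
  have hP0 : P.symm 0 = 0 := by
    have := P.left_inv h0s
    rwa [hPcoe, hΦ0] at this
  have hj : Continuous fun ε : ℝ => (ε, (0 : C(Icc 0 T, ℝ)), (0 : C(Icc 0 T, ℝ))) := by fun_prop
  have hjt : ∀ᶠ ε : ℝ in 𝓝 0, (ε, (0 : C(Icc 0 T, ℝ)), (0 : C(Icc 0 T, ℝ))) ∈ P.target :=
    hj.continuousAt (P.open_target.mem_nhds h0t)
  have hcontP : ∀ᶠ ε : ℝ in 𝓝 0, ContinuousAt (fun ε : ℝ => P.symm (ε, (0 : C(Icc 0 T, ℝ)), (0 : C(Icc 0 T, ℝ)))) ε := by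
    filter_upwards [hjt] with ε hε
    exact ContinuousAt.comp (f := fun ε : ℝ => (ε, (0 : C(Icc 0 T, ℝ)), (0 : C(Icc 0 T, ℝ))))
      (P.continuousAt_symm hε) hj.continuousAt
  refine ⟨fun ε => (P.symm (ε, 0, 0)).2, ?_, ?_, ?_⟩
  · simp only
    exact congrArg Prod.snd hP0
  · filter_upwards [hcontP] with ε hε
    exact continuousAt_snd.comp hε
  · have hlim : Tendsto (fun ε : ℝ => P.symm (ε, (0 : C(Icc 0 T, ℝ)), (0 : C(Icc 0 T, ℝ)))) (𝓝 0) (𝓝 0) := by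
      have := hcontP.self_of_nhds.tendsto
      rwa [show ((0 : ℝ), (0 : C(Icc 0 T, ℝ)), (0 : C(Icc 0 T, ℝ))) = 0 from rfl, hP0] at this
    filter_upwards [hjt, hlim (Metric.ball_mem_nhds 0 h.radius_pos)] with ε hε hball
    set w := P.symm (ε, (0 : C(Icc 0 T, ℝ)), (0 : C(Icc 0 T, ℝ))) with hw
    have hΦw : Φ w = (ε, 0, 0) := P.right_inv hε
    have hnorm : ‖w‖ < δ := by simpa using hball
    have hbound1 : |w.1| < δ := (norm_fst_le w).trans_lt hnorm
    have hbound2 : ∀ k, |w.2.1 k| < δ := fun k =>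
      ((w.2.1.norm_coe_le_norm k).trans ((norm_fst_le w.2).trans (norm_snd_le w))).trans_lt hnorm
    simp only [hΦ, Prod.mk.injEq] at hΦw
    obtain ⟨hw1, hx, hy⟩ := hΦw
    have hmemD : ∀ k, ι w k ∈ D := fun k => ⟨hbound1, hbound2 k⟩
    -- Evaluation at time `0` isolates the closing conditions; with them removed, the rest of each
    -- equation is the integral equation.
    have hx0 := congrArg ev hx
    have hy0 := congrArg ev hy
    have hevc : ∀ r, ev (c r) = r := fun r => hcapp r a₀
    simp only [map_add, map_sub, hevc, map_smul, hevS, smul_zero, sub_self, zero_add,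
      map_zero] at hx0 hy0
    rw [hx0, map_zero, add_zero, sub_eq_zero] at hx
    rw [hy0, map_zero, add_zero, sub_eq_zero] at hy
    have hxk : ∀ k, w.2.1 k = w.2.1 a₀ + ε * S (nR (ι w)) k := fun k => by
      have := congrArg (fun z : C(Icc 0 T, ℝ) => z k) hx
      simp only [ContinuousMap.sub_apply, ContinuousMap.smul_apply, hcapp, hw1, smul_eq_mul] at this
      have hev' : ev w.2.1 = w.2.1 a₀ := rfl
      rw [← this, hev']; ring
    have hyk : ∀ k, w.2.2 k = w.2.2 a₀ + S (nN (ι w)) k := fun k => by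
      have := congrArg (fun z : C(Icc 0 T, ℝ) => z k) hy
      simp only [ContinuousMap.sub_apply, hcapp] at this
      have hev' : ev w.2.2 = w.2.2 a₀ := rfl
      rw [← this, hev']; ring
    have hSR : ∀ k : Icc 0 T, S (nR (ι w)) k = ∫ t in (0 : ℝ)..k,
        R ((ε, w.2.1 (projIcc 0 T hT.le t), w.2.2 (projIcc 0 T hT.le t)), t) := fun k => by
      rw [hS, primitiveOp_apply]
      refine intervalIntegral.integral_congr fun t ht => ?_
      rw [uIcc_of_le k.2.1] at ht
      have ht' : t ∈ Icc 0 T := ⟨ht.1, ht.2.trans k.2.2⟩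
      simp only [projIcc_of_mem hT.le ht']
      rw [hnRapp _ hmemD, hι, tripleOp_apply, hw1]
    have hSN : ∀ k : Icc 0 T, S (nN (ι w)) k = ∫ t in (0 : ℝ)..k,
        N ((ε, w.2.1 (projIcc 0 T hT.le t), w.2.2 (projIcc 0 T hT.le t)), t) := fun k => by
      rw [hS, primitiveOp_apply]
      refine intervalIntegral.integral_congr fun t ht => ?_
      rw [uIcc_of_le k.2.1] at ht
      have ht' : t ∈ Icc 0 T := ⟨ht.1, ht.2.trans k.2.2⟩
      simp only [projIcc_of_mem hT.le ht']
      rw [hnNapp _ hmemD, hι, tripleOp_apply, hw1]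
    refine ⟨hbound2, fun k => ?_, fun k => ?_, ?_, ?_⟩
    · rw [hxk k, hSR k, intervalIntegral.integral_const_mul]
    · rw [hyk k, hSN k]
    · have : S (nR (ι w)) a₁ = 0 := hx0
      rw [hxk a₁, this, mul_zero, add_zero]
    · have : S (nN (ι w)) a₁ = 0 := hy0
      rw [hyk a₁, this, add_zero]

/-- **Continuation of periodic solutions** from a simple zero of the averaged perturbation. -/
theorem exists_periodic_family (h : IsTwistSystem T δ R N n κ b) :
    ∃ ε₀ > 0, ε₀ ≤ δ ∧ ∃ X Y : ℝ → ℝ → ℝ, X 0 0 = 0 ∧ Y 0 0 = 0 ∧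
      ContinuousOn (fun ε => (X ε 0, Y ε 0)) (Ioo (-ε₀) ε₀) ∧
      ∀ ε ∈ Ioo (-ε₀) ε₀, ∀ g, |X ε g| < δ ∧
        HasDerivAt (X ε) (ε * R ((ε, X ε g, Y ε g), g)) g ∧
        HasDerivAt (Y ε) (N ((ε, X ε g, Y ε g), g)) g ∧
        X ε (g + T) = X ε g ∧ Y ε (g + T) = Y ε g := by
  have hT := h.period_pos
  obtain ⟨W, hW0, hWcont, hW⟩ := h.exists_boundary_solution
  obtain ⟨r, hr, hball⟩ := Metric.mem_nhds_iff.1 (hWcont.and hW)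
  have hball' : ∀ ε ∈ Ioo (-(min r δ)) (min r δ), ε ∈ Metric.ball (0 : ℝ) r ∧ |ε| < δ :=
    fun ε hε => by
      have := abs_lt.2 hε
      exact ⟨by simpa using this.trans_le (min_le_left _ _), this.trans_le (min_le_right _ _)⟩
  set D : Set (ℝ × ℝ × ℝ) := {p | |p.1| < δ ∧ |p.2.1| < δ} with hDdef
  have key : ∀ ε ∈ Ioo (-(min r δ)) (min r δ), ∃ Q : ℝ → ℝ × ℝ,
      Q 0 = ((W ε).1 ⟨0, left_mem_Icc.2 hT.le⟩, (W ε).2 ⟨0, left_mem_Icc.2 hT.le⟩) ∧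
      ∀ g, |(Q g).1| < δ ∧
        HasDerivAt Q (ε * R ((ε, Q g), g), N ((ε, Q g), g)) g ∧ Q (g + T) = Q g := by
    intro ε hε
    obtain ⟨hεb, hεδ⟩ := hball' ε hε
    obtain ⟨-, hb, hx, hy, hx1, hy1⟩ := hball hεb
    set z : C(Icc 0 T, ℝ × ℝ) := ⟨fun k => ((W ε).1 k, (W ε).2 k), by fun_prop⟩ with hz
    have hmaps : MapsTo (fun q : (ℝ × ℝ) × ℝ => (((ε, q.1) : ℝ × ℝ × ℝ), q.2))
        ({p : ℝ × ℝ | |p.1| < δ} ×ˢ univ) (D ×ˢ univ) := fun q hq => ⟨⟨hεδ, hq.1⟩, mem_univ _⟩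
    have hcR := h.smoothR.continuousOn.comp (f := fun q : (ℝ × ℝ) × ℝ => ((ε, q.1), q.2))
      (by fun_prop) hmaps
    have hcN := h.smoothN.continuousOn.comp (f := fun q : (ℝ × ℝ) × ℝ => ((ε, q.1), q.2))
      (by fun_prop) hmaps
    obtain ⟨Q, hQ, hQr, hQd, hQp⟩ := exists_periodic_extension hT
      (v := fun q : (ℝ × ℝ) × ℝ => (ε * R ((ε, q.1), q.2), N ((ε, q.1), q.2)))
      (D := {p : ℝ × ℝ | |p.1| < δ}) ((continuousOn_const.mul hcR).prodMk hcN)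
      (fun p hp g => by
        simp only [h.periodicR (ε, p) hεδ hp, h.periodicN (ε, p) hεδ hp])
      (z := z) hb (fun k => by
        have hp : Continuous fun t : ℝ => (z (projIcc 0 T hT.le t), t) := by fun_prop
        have c1 : Continuous fun t => ε * R ((ε, z (projIcc 0 T hT.le t)), t) :=
          continuous_const.mul (hcR.comp_continuous hp fun t => ⟨hb _, mem_univ _⟩)
        have c2 : Continuous fun t => N ((ε, z (projIcc 0 T hT.le t)), t) :=
          hcN.comp_continuous hp fun t => ⟨hb _, mem_univ _⟩
        simp only [intervalIntegral.integral_of_le k.2.1]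
        rw [integral_pair (c1.integrableOn_Ioc) (c2.integrableOn_Ioc),
          ← intervalIntegral.integral_of_le k.2.1, ← intervalIntegral.integral_of_le k.2.1]
        exact Prod.ext (hx k) (hy k))
      (Prod.ext hx1 hy1)
    refine ⟨Q, hQ ⟨0, left_mem_Icc.2 hT.le⟩, fun g => ⟨?_, hQd g, hQp g⟩⟩
    obtain ⟨k, hk⟩ := hQr g
    rw [hk]
    exact hb k
  choose! Q hQ0 hQ using key
  refine ⟨min r δ, lt_min hr h.radius_pos, min_le_right _ _, fun ε g => (Q ε g).1,
    fun ε g => (Q ε g).2, ?_, ?_, ?_, ?_⟩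
  · have h0 : (0 : ℝ) ∈ Ioo (-(min r δ)) (min r δ) := by simp [hr, h.radius_pos]
    simp [hQ0 0 h0, hW0]
  · have h0 : (0 : ℝ) ∈ Ioo (-(min r δ)) (min r δ) := by simp [hr, h.radius_pos]
    simp [hQ0 0 h0, hW0]
  · have hc : ContinuousOn (fun ε => ((W ε).1 ⟨0, left_mem_Icc.2 hT.le⟩,
        (W ε).2 ⟨0, left_mem_Icc.2 hT.le⟩)) (Ioo (-(min r δ)) (min r δ)) := by
      intro ε hε
      have := (hball (hball' ε hε).1).1
      have he : Continuous fun w : C(Icc 0 T, ℝ) × C(Icc 0 T, ℝ) =>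
        (w.1 ⟨0, left_mem_Icc.2 hT.le⟩, w.2 ⟨0, left_mem_Icc.2 hT.le⟩) := by fun_prop
      exact (he.continuousAt.comp this).continuousWithinAt
    exact hc.congr fun ε hε => hQ0 ε hε
  · intro ε hε g
    obtain ⟨h1, h2, h3⟩ := hQ ε hε g
    exact ⟨h1, h2.fst, h2.snd, congrArg Prod.fst h3, congrArg Prod.snd h3⟩

end IsTwistSystem

end GravWave

namespace GravWave

open Topology Filter

/-! ### The eccentric anomaly -/

theorem one_sub_mul_cos_pos {e : ℝ} (he : |e| < 1) (u : ℝ) : 0 < 1 - e * Real.cos u := by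
  have h : |e * Real.cos u| ≤ |e| := by
    rw [abs_mul]; exact mul_le_of_le_one_right (abs_nonneg e) (Real.abs_cos_le_one u)
  linarith [le_abs_self (e * Real.cos u)]

theorem hasDerivAt_kepler (e u : ℝ) :
    HasDerivAt (fun u : ℝ => u - e * Real.sin u) (1 - e * Real.cos u) u :=
  (hasDerivAt_id u).sub ((Real.hasDerivAt_sin u).const_mul e)

theorem strictMono_kepler {e : ℝ} (he : |e| < 1) : StrictMono (fun u : ℝ => u - e * Real.sin u) :=
  strictMono_of_deriv_pos fun u => by
    rw [(hasDerivAt_kepler e u).deriv]; exact one_sub_mul_cos_pos he u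

theorem eq_eccAnomaly {e : ℝ} (he : |e| < 1) {u l : ℝ} (h : u - e * Real.sin u = l) :
    u = eccAnomaly e l :=
  (strictMono_kepler he).injective (h.trans (eccAnomaly_spec e l).symm)

theorem eccAnomaly_add_two_pi {e : ℝ} (he : |e| < 1) (l : ℝ) :
    eccAnomaly e (l + 2 * Real.pi) = eccAnomaly e l + 2 * Real.pi := by
  refine (eq_eccAnomaly he ?_).symm
  rw [Real.sin_add_two_pi]
  linarith [eccAnomaly_spec e l]

theorem eccAnomaly_kepler {e : ℝ} (he : |e| < 1) (u : ℝ) :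
    eccAnomaly e (u - e * Real.sin u) = u :=
  (eq_eccAnomaly he rfl).symm

/-- For `|e| < 1` the left side of Kepler's equation is strictly increasing in `u` with positive
derivative, so its root is globally unique and `analyticAt_of_unique_root` applies with `V = univ`.
-/
theorem analyticAt_eccAnomaly {p : ℝ × ℝ} (hp : |p.1| < 1) :
    AnalyticAt ℝ (fun p : ℝ × ℝ => eccAnomaly p.1 p.2) p := by
  refine analyticAt_of_unique_root (F := fun q : (ℝ × ℝ) × ℝ => q.2 - q.1.1 * Real.sin q.2 - q.1.2)
    (d := 1 - p.1 * Real.cos (eccAnomaly p.1 p.2)) (V := univ) ?_ ?_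
    (one_sub_mul_cos_pos hp _).ne' ?_ univ_mem ?_
  · have h2 : AnalyticAt ℝ (fun q : (ℝ × ℝ) × ℝ => q.2) (p, eccAnomaly p.1 p.2) := analyticAt_snd
    have h1 : AnalyticAt ℝ (fun q : (ℝ × ℝ) × ℝ => q.1) (p, eccAnomaly p.1 p.2) := analyticAt_fst
    exact (h2.sub ((analyticAt_fst.comp h1).mul (Real.analyticAt_sin.comp h2))).sub
      (analyticAt_snd.comp h1)
  · simp only
    linarith [eccAnomaly_spec p.1 p.2]
  · exact (hasDerivAt_kepler p.1 (eccAnomaly p.1 p.2)).sub_const p.2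
  · have : ∀ᶠ q : ℝ × ℝ in 𝓝 p, |q.1| < 1 :=
      (continuous_fst.abs.continuousAt).eventually (gt_mem_nhds hp)
    filter_upwards [this] with q hq y _ hy
    exact eq_eccAnomaly hq (by linarith [hy])

/-- Differentiability comes from analyticity; the value comes from differentiating Kepler's equation
along the curve and solving for the derivative. -/
theorem hasDerivAt_eccAnomaly {e l : ℝ → ℝ} {e' l' t : ℝ} (he : HasDerivAt e e' t)
    (hl : HasDerivAt l l' t) (het : |e t| < 1) :
    HasDerivAt (fun t => eccAnomaly (e t) (l t)) ((l' + e' * Real.sin (eccAnomaly (e t) (l t))) /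
      (1 - e t * Real.cos (eccAnomaly (e t) (l t)))) t := by
  have hd : DifferentiableAt ℝ (fun t => eccAnomaly (e t) (l t)) t :=
    DifferentiableAt.comp t (g := fun p : ℝ × ℝ => eccAnomaly p.1 p.2) (f := fun t => (e t, l t))
      (analyticAt_eccAnomaly (p := (e t, l t)) het).differentiableAt
      (he.differentiableAt.prodMk hl.differentiableAt)
  obtain ⟨d, hd⟩ : ∃ d, HasDerivAt (fun t => eccAnomaly (e t) (l t)) d t := ⟨_, hd.hasDerivAt⟩
  have h1 := hd.sub (he.mul hd.sin)
  have h2 : HasDerivAt l (d - (e' * Real.sin (eccAnomaly (e t) (l t)) +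
      e t * (Real.cos (eccAnomaly (e t) (l t)) * d))) t :=
    h1.congr_of_eventuallyEq (Eventually.of_forall fun s => (eccAnomaly_spec (e s) (l s)).symm)
  have h3 := h2.unique hl
  have hpos := one_sub_mul_cos_pos het (eccAnomaly (e t) (l t))
  convert! hd using 1
  rw [div_eq_iff hpos.ne']
  linarith

/-! ### The eccentricity -/

section Ecc

variable {L G : ℝ}

theorem sq_sub_sq_pos (hG : |G| < L) : 0 < L ^ 2 - G ^ 2 := by
  have h0 : 0 ≤ |G| := abs_nonneg G
  nlinarith [sq_abs G]

theorem ecc_pos (hG : |G| < L) : 0 < ecc L G :=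
  div_pos (Real.sqrt_pos.2 (sq_sub_sq_pos hG)) ((abs_nonneg G).trans_lt hG)

theorem ecc_sq (hG : |G| < L) : L ^ 2 * ecc L G ^ 2 = L ^ 2 - G ^ 2 := by
  have hL : 0 < L := (abs_nonneg G).trans_lt hG
  rw [ecc, div_pow, Real.sq_sqrt (sq_sub_sq_pos hG).le]
  field_simp

theorem abs_ecc_lt_one (hG0 : 0 < |G|) (hG : |G| < L) : |ecc L G| < 1 := by
  have hL : 0 < L := (abs_nonneg G).trans_lt hG
  rw [abs_of_pos (ecc_pos hG)]
  have h1 := ecc_sq hG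
  have h2 : 0 < G ^ 2 := by rw [← sq_abs]; positivity
  have h3 := ecc_pos hG
  by_contra! h
  have : L ^ 2 * 1 ≤ L ^ 2 * ecc L G ^ 2 := by gcongr; nlinarith
  linarith

/-- The strict inequality `|G| < L` keeps the argument of the square root positive; circular orbits
are where this fails. -/
theorem analyticAt_ecc {p : ℝ × ℝ} (hG : |p.2| < p.1) :
    AnalyticAt ℝ (fun p : ℝ × ℝ => ecc p.1 p.2) p := by
  have hL : 0 < p.1 := (abs_nonneg _).trans_lt hG
  have h : ContDiffAt ℝ ⊤ (fun p : ℝ × ℝ => ecc p.1 p.2) p := by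
    unfold ecc
    exact ((contDiffAt_fst.pow 2).sub (contDiffAt_snd.pow 2)).sqrt (sq_sub_sq_pos hG).ne' |>.div
      contDiffAt_fst hL.ne'
  exact h.analyticAt

/-- Partial derivative of the eccentricity in `L`. -/
noncomputable def eccL (L G : ℝ) : ℝ := G ^ 2 / (ecc L G * L ^ 3)

/-- Partial derivative of the eccentricity in `G`. -/
noncomputable def eccG (L G : ℝ) : ℝ := -(G / (ecc L G * L ^ 2))

end Ecc

theorem hasDerivAt_ecc {L G : ℝ → ℝ} {L' G' t : ℝ} (hL : HasDerivAt L L' t)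
    (hG : HasDerivAt G G' t) (hlt : |G t| < L t) :
    HasDerivAt (fun t => ecc (L t) (G t)) (eccL (L t) (G t) * L' + eccG (L t) (G t) * G') t := by
  have hL0 : 0 < L t := (abs_nonneg _).trans_lt hlt
  have h := (((hL.pow 2).sub (hG.pow 2)).sqrt (sq_sub_sq_pos hlt).ne').div hL hL0.ne'
  refine h.congr_deriv ?_
  have he := ecc_pos hlt
  have he2 := ecc_sq hlt
  have hs : Real.sqrt (L t ^ 2 - G t ^ 2) = ecc (L t) (G t) * L t := by
    rw [ecc]; field_simp
  simp only [Pi.sub_apply, Pi.pow_apply, hs, eccL, eccG]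
  field_simp
  push_cast
  linear_combination (-2 * L') * he2

end GravWave

namespace GravWave

open Topology Filter

/-! ### Partial derivatives of the elliptical motion in Delaunay elements -/

/-- The eccentric anomaly in terms of `L, G, ℓ`. -/
noncomputable abbrev anom (L G l : ℝ) : ℝ := eccAnomaly (ecc L G) l

/-- The quotient `r / a = 1 - e cos u`. -/
noncomputable def radial (L G l : ℝ) : ℝ := 1 - ecc L G * Real.cos (anom L G l)

section Partials

variable (k L G l : ℝ)

/-- The suffixes `L`, `G`, `l` mark partial derivatives of the orbital coordinates and momenta. They
follow from `∂u/∂ℓ = 1/(1 - e cos u)` and `∂u/∂e = sin u/(1 - e cos u)`, and are kept rational in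
`sin u`, `cos u`, `e` and `radial`, so that the brackets below become algebraic identities. -/
noncomputable def orbXL : ℝ := 2 * L / k * (Real.cos (anom L G l) - ecc L G) -
  semiAxis k L * (Real.sin (anom L G l) ^ 2 / radial L G l + 1) * eccL L G
noncomputable def orbXG : ℝ :=
  -(semiAxis k L * (Real.sin (anom L G l) ^ 2 / radial L G l + 1) * eccG L G)
noncomputable def orbXl : ℝ := -(semiAxis k L * Real.sin (anom L G l) / radial L G l)

noncomputable def orbYL : ℝ := G / k * Real.sin (anom L G l) + L * G / k *
  Real.cos (anom L G l) * Real.sin (anom L G l) / radial L G l * eccL L G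
noncomputable def orbYG : ℝ := L / k * Real.sin (anom L G l) + L * G / k *
  Real.cos (anom L G l) * Real.sin (anom L G l) / radial L G l * eccG L G
noncomputable def orbYl : ℝ := L * G / k * Real.cos (anom L G l) / radial L G l

noncomputable def orbPXL : ℝ := k / L ^ 2 * Real.sin (anom L G l) / radial L G l -
  k / L * eccL L G * Real.sin (anom L G l) * ((Real.cos (anom L G l) - ecc L G) / radial L G l +
    Real.cos (anom L G l)) / radial L G l ^ 2
noncomputable def orbPXG : ℝ :=
  -(k / L * eccG L G * Real.sin (anom L G l) * ((Real.cos (anom L G l) - ecc L G) / radial L G l +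
    Real.cos (anom L G l)) / radial L G l ^ 2)
noncomputable def orbPXl : ℝ :=
  -(k / L * (Real.cos (anom L G l) - ecc L G) / radial L G l ^ 3)

noncomputable def orbPYL : ℝ := -(2 * k * G / L ^ 3 * Real.cos (anom L G l) / radial L G l) +
  k * G / L ^ 2 * eccL L G * (Real.cos (anom L G l) ^ 2 - Real.sin (anom L G l) ^ 2 / radial L G l) /
    radial L G l ^ 2
noncomputable def orbPYG : ℝ := k / L ^ 2 * Real.cos (anom L G l) / radial L G l +
  k * G / L ^ 2 * eccG L G * (Real.cos (anom L G l) ^ 2 - Real.sin (anom L G l) ^ 2 / radial L G l) /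
    radial L G l ^ 2
noncomputable def orbPYl : ℝ := -(k * G / L ^ 2 * Real.sin (anom L G l) / radial L G l ^ 3)

end Partials

section Curve

variable {k : ℝ} {L G l : ℝ → ℝ} {L' G' l' t : ℝ}

theorem radial_pos {L G : ℝ} (h0 : 0 < |G|) (hlt : |G| < L) (l : ℝ) : 0 < radial L G l :=
  one_sub_mul_cos_pos (abs_ecc_lt_one h0 hlt) _

theorem hasDerivAt_anom (hL : HasDerivAt L L' t) (hG : HasDerivAt G G' t)
    (hl : HasDerivAt l l' t) (h0 : 0 < |G t|) (hlt : |G t| < L t) :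
    HasDerivAt (fun t => anom (L t) (G t) (l t))
      ((l' + (eccL (L t) (G t) * L' + eccG (L t) (G t) * G') * Real.sin (anom (L t) (G t) (l t))) /
        radial (L t) (G t) (l t)) t :=
  hasDerivAt_eccAnomaly (hasDerivAt_ecc hL hG hlt) hl (abs_ecc_lt_one h0 hlt)

/-- Differentiation along arbitrary curves serves twice: constant curves give the partial
derivatives of the Hamiltonian, and solution curves give the equations of motion. -/
theorem hasDerivAt_orbX (hk : k ≠ 0) (hL : HasDerivAt L L' t) (hG : HasDerivAt G G' t)
    (hl : HasDerivAt l l' t) (h0 : 0 < |G t|) (hlt : |G t| < L t) :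
    HasDerivAt (fun t => orbX k (L t) (G t) (l t)) (orbXL k (L t) (G t) (l t) * L' +
      orbXG k (L t) (G t) (l t) * G' + orbXl k (L t) (G t) (l t) * l') t := by
  have hu := hasDerivAt_anom hL hG hl h0 hlt
  have he := hasDerivAt_ecc hL hG hlt
  have h : HasDerivAt (fun t => orbX k (L t) (G t) (l t)) _ t :=
    ((hL.pow 2).div_const k).mul (hu.cos.sub he)
  refine h.congr_deriv ?_
  have hr := (radial_pos h0 hlt (l t)).ne'
  simp only [orbXL, orbXG, orbXl, semiAxis, Pi.pow_apply]
  field_simp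
  push_cast
  ring

theorem hasDerivAt_orbY (hk : k ≠ 0) (hL : HasDerivAt L L' t) (hG : HasDerivAt G G' t)
    (hl : HasDerivAt l l' t) (h0 : 0 < |G t|) (hlt : |G t| < L t) :
    HasDerivAt (fun t => orbY k (L t) (G t) (l t)) (orbYL k (L t) (G t) (l t) * L' +
      orbYG k (L t) (G t) (l t) * G' + orbYl k (L t) (G t) (l t) * l') t := by
  have hL0 : 0 < L t := (abs_nonneg _).trans_lt hlt
  have hu := hasDerivAt_anom hL hG hl h0 hlt
  have h : HasDerivAt (fun t => orbY k (L t) (G t) (l t)) _ t :=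
    (((hL.pow 2).div_const k).mul (hG.div hL hL0.ne')).mul hu.sin
  refine h.congr_deriv ?_
  have hr := (radial_pos h0 hlt (l t)).ne'
  simp only [orbYL, orbYG, orbYl, Pi.pow_apply, Pi.mul_apply, Pi.div_apply]
  field_simp
  push_cast
  ring

theorem hasDerivAt_radial (hL : HasDerivAt L L' t) (hG : HasDerivAt G G' t)
    (hl : HasDerivAt l l' t) (h0 : 0 < |G t|) (hlt : |G t| < L t) :
    HasDerivAt (fun t => radial (L t) (G t) (l t))
      (-((eccL (L t) (G t) * L' + eccG (L t) (G t) * G') * Real.cos (anom (L t) (G t) (l t)) +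
        ecc (L t) (G t) * (-Real.sin (anom (L t) (G t) (l t)) *
      ((l' + (eccL (L t) (G t) * L' + eccG (L t) (G t) * G') * Real.sin (anom (L t) (G t) (l t))) /
        radial (L t) (G t) (l t))))) t :=
  ((hasDerivAt_ecc hL hG hlt).mul (hasDerivAt_anom hL hG hl h0 hlt).cos).const_sub 1

theorem hasDerivAt_orbPX (hL : HasDerivAt L L' t) (hG : HasDerivAt G G' t)
    (hl : HasDerivAt l l' t) (h0 : 0 < |G t|) (hlt : |G t| < L t) :
    HasDerivAt (fun t => orbPX k (L t) (G t) (l t)) (orbPXL k (L t) (G t) (l t) * L' +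
      orbPXG k (L t) (G t) (l t) * G' + orbPXl k (L t) (G t) (l t) * l') t := by
  have hL0 : 0 < L t := (abs_nonneg _).trans_lt hlt
  have hu := hasDerivAt_anom hL hG hl h0 hlt
  have hr := (radial_pos h0 hlt (l t)).ne'
  have hD := hasDerivAt_radial hL hG hl h0 hlt
  have h : HasDerivAt (fun t => orbPX k (L t) (G t) (l t)) _ t :=
    ((((hasDerivAt_const t k).div hL hL0.ne').neg).mul hu.sin).div hD hr
  refine h.congr_deriv ?_
  have hsc := Real.sin_sq_add_cos_sq (anom (L t) (G t) (l t))
  have hDdef : radial (L t) (G t) (l t) = 1 - ecc (L t) (G t) * Real.cos (anom (L t) (G t) (l t)) :=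
    rfl
  simp only [orbPXL, orbPXG, orbPXl, Pi.neg_apply, Pi.mul_apply, Pi.div_apply]
  rw [← hDdef]
  -- With sine, cosine, eccentricity and `radial` as independent letters, the claim is a rational
  -- identity modulo `S² + C² = 1` and `D = 1 - e C`.
  generalize Real.sin (anom (L t) (G t) (l t)) = S at *
  generalize Real.cos (anom (L t) (G t) (l t)) = C at *
  generalize ecc (L t) (G t) = e at *
  generalize radial (L t) (G t) (l t) = D at *
  field_simp
  grind

theorem hasDerivAt_orbPY (hL : HasDerivAt L L' t) (hG : HasDerivAt G G' t)
    (hl : HasDerivAt l l' t) (h0 : 0 < |G t|) (hlt : |G t| < L t) :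
    HasDerivAt (fun t => orbPY k (L t) (G t) (l t)) (orbPYL k (L t) (G t) (l t) * L' +
      orbPYG k (L t) (G t) (l t) * G' + orbPYl k (L t) (G t) (l t) * l') t := by
  have hL0 : 0 < L t := (abs_nonneg _).trans_lt hlt
  have hu := hasDerivAt_anom hL hG hl h0 hlt
  have hr := (radial_pos h0 hlt (l t)).ne'
  have hD := hasDerivAt_radial hL hG hl h0 hlt
  have h : HasDerivAt (fun t => orbPY k (L t) (G t) (l t)) _ t :=
    (((hG.const_mul k).div (hL.pow 2) (pow_ne_zero 2 hL0.ne')).mul hu.cos).div hD hr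
  refine h.congr_deriv ?_
  have hDdef : radial (L t) (G t) (l t) = 1 - ecc (L t) (G t) * Real.cos (anom (L t) (G t) (l t)) :=
    rfl
  simp only [orbPYL, orbPYG, orbPYl, Pi.mul_apply, Pi.div_apply, Pi.pow_apply]
  generalize Real.sin (anom (L t) (G t) (l t)) = S at *
  generalize Real.cos (anom (L t) (G t) (l t)) = C at *
  generalize ecc (L t) (G t) = e at *
  generalize radial (L t) (G t) (l t) = D at *
  field_simp
  push_cast
  grind

end Curve

/-! ### Canonical brackets in the orbital frame -/

section Brackets

variable {k L G : ℝ}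

/-- This is `{x, y} = 0` in the canonical pairs `(ℓ, L)`, `(g, G)`. Since `∂/∂g` is an infinitesimal
rotation, the `(g, G)` part of the bracket at `g = 0` is the right side with opposite sign. -/
theorem bracket_orbX_orbY (hk : k ≠ 0) (h0 : 0 < |G|) (hlt : |G| < L) (l : ℝ) :
    orbXl k L G l * orbYL k L G l - orbXL k L G l * orbYl k L G l =
      orbX k L G l * orbXG k L G l + orbY k L G l * orbYG k L G l := by
  have hL0 : 0 < L := (abs_nonneg _).trans_lt hlt
  have hr := (radial_pos h0 hlt l).ne'
  have he := (ecc_pos hlt).ne'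
  have he2 := ecc_sq hlt
  have hsc := Real.sin_sq_add_cos_sq (anom L G l)
  have hDdef : radial L G l = 1 - ecc L G * Real.cos (anom L G l) := rfl
  simp only [orbXL, orbXG, orbXl, orbYL, orbYG, orbYl, orbX, orbY, semiAxis, eccL, eccG]
  -- After clearing denominators, a polynomial identity modulo `L² e² = L² - G²`, `S² + C² = 1` and
  -- `D = 1 - e C`.
  generalize Real.sin (anom L G l) = S at *
  generalize Real.cos (anom L G l) = C at *
  generalize ecc L G = e at *
  generalize radial L G l = D at *
  field_simp
  grind

/-- Together with the next three, these are the brackets `{X, x} = {Y, y} = -1` and `{X, y} = {Y, x}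
= 0` at `g = 0`. The bracket of the two momenta is not needed, because the perturbation depends on
the position alone. -/
theorem bracket_orbPX_orbX (hk : k ≠ 0) (h0 : 0 < |G|) (hlt : |G| < L) (l : ℝ) :
    orbPXl k L G l * orbXL k L G l - orbPXL k L G l * orbXl k L G l =
      -1 + orbPY k L G l * orbXG k L G l - orbPXG k L G l * orbY k L G l := by
  have hL0 : 0 < L := (abs_nonneg _).trans_lt hlt
  have hr := (radial_pos h0 hlt l).ne'
  have he := (ecc_pos hlt).ne'
  have he2 := ecc_sq hlt
  have hsc := Real.sin_sq_add_cos_sq (anom L G l)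
  have hDdef : radial L G l = 1 - ecc L G * Real.cos (anom L G l) := rfl
  simp only [orbXL, orbXG, orbXl, orbPXl, orbPXL, orbPXG, orbPY, orbY, semiAxis, eccL, eccG]
  rw [← hDdef]
  generalize Real.sin (anom L G l) = S at *
  generalize Real.cos (anom L G l) = C at *
  generalize ecc L G = e at *
  generalize radial L G l = D at *
  field_simp
  grind

theorem bracket_orbPY_orbY (hk : k ≠ 0) (h0 : 0 < |G|) (hlt : |G| < L) (l : ℝ) :
    orbPYl k L G l * orbYL k L G l - orbPYL k L G l * orbYl k L G l =
      -1 - orbPX k L G l * orbYG k L G l + orbPYG k L G l * orbX k L G l := by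
  have hL0 : 0 < L := (abs_nonneg _).trans_lt hlt
  have hr := (radial_pos h0 hlt l).ne'
  have he := (ecc_pos hlt).ne'
  have he2 := ecc_sq hlt
  have hsc := Real.sin_sq_add_cos_sq (anom L G l)
  have hDdef : radial L G l = 1 - ecc L G * Real.cos (anom L G l) := rfl
  simp only [orbYL, orbYG, orbYl, orbPYl, orbPYL, orbPYG, orbPX, orbX, semiAxis, eccL, eccG]
  rw [← hDdef]
  generalize Real.sin (anom L G l) = S at *
  generalize Real.cos (anom L G l) = C at *
  generalize ecc L G = e at *
  generalize radial L G l = D at *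
  field_simp
  grind

theorem bracket_orbPX_orbY (hk : k ≠ 0) (h0 : 0 < |G|) (hlt : |G| < L) (l : ℝ) :
    orbPXl k L G l * orbYL k L G l - orbPXL k L G l * orbYl k L G l =
      orbPY k L G l * orbYG k L G l + orbPXG k L G l * orbX k L G l := by
  have hL0 : 0 < L := (abs_nonneg _).trans_lt hlt
  have hr := (radial_pos h0 hlt l).ne'
  have he := (ecc_pos hlt).ne'
  have he2 := ecc_sq hlt
  have hsc := Real.sin_sq_add_cos_sq (anom L G l)
  have hDdef : radial L G l = 1 - ecc L G * Real.cos (anom L G l) := rfl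
  simp only [orbYL, orbYG, orbYl, orbPXl, orbPXL, orbPXG, orbPY, orbX, semiAxis, eccL, eccG]
  rw [← hDdef]
  generalize Real.sin (anom L G l) = S at *
  generalize Real.cos (anom L G l) = C at *
  generalize ecc L G = e at *
  generalize radial L G l = D at *
  field_simp
  grind

theorem bracket_orbPY_orbX (hk : k ≠ 0) (h0 : 0 < |G|) (hlt : |G| < L) (l : ℝ) :
    orbPYl k L G l * orbXL k L G l - orbPYL k L G l * orbXl k L G l =
      -(orbPX k L G l * orbXG k L G l) - orbPYG k L G l * orbY k L G l := by
  have hL0 : 0 < L := (abs_nonneg _).trans_lt hlt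
  have hr := (radial_pos h0 hlt l).ne'
  have he := (ecc_pos hlt).ne'
  have he2 := ecc_sq hlt
  have hsc := Real.sin_sq_add_cos_sq (anom L G l)
  have hDdef : radial L G l = 1 - ecc L G * Real.cos (anom L G l) := rfl
  simp only [orbXL, orbXG, orbXl, orbPYl, orbPYL, orbPYG, orbPX, orbY, semiAxis, eccL, eccG]
  rw [← hDdef]
  generalize Real.sin (anom L G l) = S at *
  generalize Real.cos (anom L G l) = C at *
  generalize ecc L G = e at *
  generalize radial L G l = D at *
  field_simp
  grind

end Brackets

end GravWave

namespace GravWave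

open Topology Filter

/-! ### Derivatives along curves in Delaunay elements -/

section Curve

variable {k : ℝ} {L G l g : ℝ → ℝ} {L' G' l' g' t : ℝ}

/-- Derivative of the position `x` along a curve. -/
theorem hasDerivAt_posX (hk : k ≠ 0) (hL : HasDerivAt L L' t) (hG : HasDerivAt G G' t)
    (hl : HasDerivAt l l' t) (hg : HasDerivAt g g' t) (h0 : 0 < |G t|) (hlt : |G t| < L t) :
    HasDerivAt (fun t => posX k (L t) (G t) (l t) (g t))
      ((orbXL k (L t) (G t) (l t) * Real.cos (g t) - orbYL k (L t) (G t) (l t) * Real.sin (g t)) * L' +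
      (orbXG k (L t) (G t) (l t) * Real.cos (g t) - orbYG k (L t) (G t) (l t) * Real.sin (g t)) * G' +
      (orbXl k (L t) (G t) (l t) * Real.cos (g t) - orbYl k (L t) (G t) (l t) * Real.sin (g t)) * l' -
      posY k (L t) (G t) (l t) (g t) * g') t := by
  refine (((hasDerivAt_orbX hk hL hG hl h0 hlt).mul hg.cos).sub
    ((hasDerivAt_orbY hk hL hG hl h0 hlt).mul hg.sin)).congr_deriv ?_
  rw [posY]; ring

theorem hasDerivAt_posY (hk : k ≠ 0) (hL : HasDerivAt L L' t) (hG : HasDerivAt G G' t)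
    (hl : HasDerivAt l l' t) (hg : HasDerivAt g g' t) (h0 : 0 < |G t|) (hlt : |G t| < L t) :
    HasDerivAt (fun t => posY k (L t) (G t) (l t) (g t))
      ((orbXL k (L t) (G t) (l t) * Real.sin (g t) + orbYL k (L t) (G t) (l t) * Real.cos (g t)) * L' +
      (orbXG k (L t) (G t) (l t) * Real.sin (g t) + orbYG k (L t) (G t) (l t) * Real.cos (g t)) * G' +
      (orbXl k (L t) (G t) (l t) * Real.sin (g t) + orbYl k (L t) (G t) (l t) * Real.cos (g t)) * l' +
      posX k (L t) (G t) (l t) (g t) * g') t := by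
  refine (((hasDerivAt_orbX hk hL hG hl h0 hlt).mul hg.sin).add
    ((hasDerivAt_orbY hk hL hG hl h0 hlt).mul hg.cos)).congr_deriv ?_
  rw [posX]; ring

theorem hasDerivAt_momX (hL : HasDerivAt L L' t) (hG : HasDerivAt G G' t)
    (hl : HasDerivAt l l' t) (hg : HasDerivAt g g' t) (h0 : 0 < |G t|) (hlt : |G t| < L t) :
    HasDerivAt (fun t => momX k (L t) (G t) (l t) (g t))
      ((orbPXL k (L t) (G t) (l t) * Real.cos (g t) - orbPYL k (L t) (G t) (l t) * Real.sin (g t)) * L' +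
      (orbPXG k (L t) (G t) (l t) * Real.cos (g t) - orbPYG k (L t) (G t) (l t) * Real.sin (g t)) * G' +
      (orbPXl k (L t) (G t) (l t) * Real.cos (g t) - orbPYl k (L t) (G t) (l t) * Real.sin (g t)) * l' -
      momY k (L t) (G t) (l t) (g t) * g') t := by
  refine (((hasDerivAt_orbPX hL hG hl h0 hlt).mul hg.cos).sub
    ((hasDerivAt_orbPY hL hG hl h0 hlt).mul hg.sin)).congr_deriv ?_
  rw [momY]; ring

theorem hasDerivAt_momY (hL : HasDerivAt L L' t) (hG : HasDerivAt G G' t)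
    (hl : HasDerivAt l l' t) (hg : HasDerivAt g g' t) (h0 : 0 < |G t|) (hlt : |G t| < L t) :
    HasDerivAt (fun t => momY k (L t) (G t) (l t) (g t))
      ((orbPXL k (L t) (G t) (l t) * Real.sin (g t) + orbPYL k (L t) (G t) (l t) * Real.cos (g t)) * L' +
      (orbPXG k (L t) (G t) (l t) * Real.sin (g t) + orbPYG k (L t) (G t) (l t) * Real.cos (g t)) * G' +
      (orbPXl k (L t) (G t) (l t) * Real.sin (g t) + orbPYl k (L t) (G t) (l t) * Real.cos (g t)) * l' +
      momX k (L t) (G t) (l t) (g t) * g') t := by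
  refine (((hasDerivAt_orbPX hL hG hl h0 hlt).mul hg.sin).add
    ((hasDerivAt_orbPY hL hG hl h0 hlt).mul hg.cos)).congr_deriv ?_
  rw [momX]; ring

end Curve

section FunC

variable (k L G l g : ℝ)

/-- Partial derivatives of `r² cos 2θ` in Delaunay elements. -/
noncomputable def funCL : ℝ :=
  2 * (posX k L G l g * (orbXL k L G l * Real.cos g - orbYL k L G l * Real.sin g) -
    posY k L G l g * (orbXL k L G l * Real.sin g + orbYL k L G l * Real.cos g))
noncomputable def funCG : ℝ :=
  2 * (posX k L G l g * (orbXG k L G l * Real.cos g - orbYG k L G l * Real.sin g) -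
    posY k L G l g * (orbXG k L G l * Real.sin g + orbYG k L G l * Real.cos g))
noncomputable def funCEll : ℝ :=
  2 * (posX k L G l g * (orbXl k L G l * Real.cos g - orbYl k L G l * Real.sin g) -
    posY k L G l g * (orbXl k L G l * Real.sin g + orbYl k L G l * Real.cos g))
noncomputable def funCg : ℝ := -(4 * posX k L G l g * posY k L G l g)

end FunC

theorem hasDerivAt_funC {k : ℝ} {L G l g : ℝ → ℝ} {L' G' l' g' t : ℝ} (hk : k ≠ 0)
    (hL : HasDerivAt L L' t) (hG : HasDerivAt G G' t)
    (hl : HasDerivAt l l' t) (hg : HasDerivAt g g' t) (h0 : 0 < |G t|) (hlt : |G t| < L t) :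
    HasDerivAt (fun t => funC k (L t) (G t) (l t) (g t))
      (funCL k (L t) (G t) (l t) (g t) * L' + funCG k (L t) (G t) (l t) (g t) * G' +
        funCEll k (L t) (G t) (l t) (g t) * l' + funCg k (L t) (G t) (l t) (g t) * g') t := by
  refine (((hasDerivAt_posX hk hL hG hl hg h0 hlt).pow 2).sub
    ((hasDerivAt_posY hk hL hG hl hg h0 hlt).pow 2)).congr_deriv ?_
  simp only [funCL, funCG, funCEll, funCg]
  push_cast
  ring

section Ham

variable {k Ω α ε : ℝ}

/-- Derivative of the Hamiltonian along a curve. -/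
theorem hasDerivAt_ham {L G l g : ℝ → ℝ} {L' G' l' g' t : ℝ} (hk : k ≠ 0)
    (hL : HasDerivAt L L' t) (hG : HasDerivAt G G' t)
    (hl : HasDerivAt l l' t) (hg : HasDerivAt g g' t) (h0 : 0 < |G t|) (hlt : |G t| < L t) :
    HasDerivAt (fun t => ham k Ω α ε (L t) (G t) (l t) (g t))
      ((k ^ 2 / L t ^ 3 + ε / 2 * α * Ω ^ 2 * funCL k (L t) (G t) (l t) (g t)) * L' +
        (-(Ω / 2) + ε / 2 * α * Ω ^ 2 * funCG k (L t) (G t) (l t) (g t)) * G' +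
        ε / 2 * α * Ω ^ 2 * funCEll k (L t) (G t) (l t) (g t) * l' +
        ε / 2 * α * Ω ^ 2 * funCg k (L t) (G t) (l t) (g t) * g') t := by
  have hL0 : 0 < L t := (abs_nonneg _).trans_lt hlt
  have h1 : HasDerivAt (fun t => -(k ^ 2 / (2 * L t ^ 2))) (k ^ 2 / L t ^ 3 * L') t := by
    refine ((hasDerivAt_const t (k ^ 2)).div ((hL.pow 2).const_mul 2) ?_).neg.congr_deriv ?_
    · simp only [Pi.pow_apply]; positivity
    · simp only [Pi.pow_apply]
      field_simp
      push_cast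
      ring
  refine ((h1.sub (hG.const_mul (Ω / 2))).add
    ((hasDerivAt_funC hk hL hG hl hg h0 hlt).const_mul (ε / 2 * α * Ω ^ 2))).congr_deriv ?_
  ring

variable {L G : ℝ} (l g : ℝ)

theorem hamL_eq (hk : k ≠ 0) (h0 : 0 < |G|) (hlt : |G| < L) :
    hamL k Ω α ε L G l g = k ^ 2 / L ^ 3 + ε / 2 * α * Ω ^ 2 * funCL k L G l g := by
  have := (hasDerivAt_ham (Ω := Ω) (α := α) (ε := ε) hk (hasDerivAt_id L) (hasDerivAt_const L G)
    (hasDerivAt_const L l) (hasDerivAt_const L g) h0 hlt).deriv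
  simpa [hamL] using this

theorem hamG_eq (hk : k ≠ 0) (h0 : 0 < |G|) (hlt : |G| < L) :
    hamG k Ω α ε L G l g = -(Ω / 2) + ε / 2 * α * Ω ^ 2 * funCG k L G l g := by
  have := (hasDerivAt_ham (Ω := Ω) (α := α) (ε := ε) hk (hasDerivAt_const G L) (hasDerivAt_id G)
    (hasDerivAt_const G l) (hasDerivAt_const G g) h0 hlt).deriv
  simpa [hamG] using this

theorem hamEll_eq (hk : k ≠ 0) (h0 : 0 < |G|) (hlt : |G| < L) :
    hamEll k Ω α ε L G l g = ε / 2 * α * Ω ^ 2 * funCEll k L G l g := by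
  have := (hasDerivAt_ham (Ω := Ω) (α := α) (ε := ε) hk (hasDerivAt_const l L)
    (hasDerivAt_const l G) (hasDerivAt_id l) (hasDerivAt_const l g) h0 hlt).deriv
  simpa [hamEll] using this

theorem hamg_eq (hk : k ≠ 0) (h0 : 0 < |G|) (hlt : |G| < L) :
    hamg k Ω α ε L G l g = ε / 2 * α * Ω ^ 2 * funCg k L G l g := by
  have := (hasDerivAt_ham (Ω := Ω) (α := α) (ε := ε) hk (hasDerivAt_const g L)
    (hasDerivAt_const g G) (hasDerivAt_const g l) (hasDerivAt_id g) h0 hlt).deriv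
  simpa [hamg] using this

end Ham

/-! ### The Kepler motion -/

section Kepler

variable {k L G : ℝ}

/-- The operator `ω ∂/∂ℓ` is the time derivative along the Kepler motion. This lemma and the next
identify the velocity with the momentum; `kepler_orbPX` and `kepler_orbPY` are the inverse square
law. -/
theorem kepler_orbX (hk : k ≠ 0) (h0 : 0 < |G|) (hlt : |G| < L) (l : ℝ) :
    k ^ 2 / L ^ 3 * orbXl k L G l = orbPX k L G l := by
  have hL0 : 0 < L := (abs_nonneg _).trans_lt hlt
  have hr := (radial_pos h0 hlt l).ne'
  simp only [radial] at hr
  simp only [orbXl, orbPX, semiAxis, radial]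
  field_simp

theorem kepler_orbY (hk : k ≠ 0) (h0 : 0 < |G|) (hlt : |G| < L) (l : ℝ) :
    k ^ 2 / L ^ 3 * orbYl k L G l = orbPY k L G l := by
  have hL0 : 0 < L := (abs_nonneg _).trans_lt hlt
  have hr := (radial_pos h0 hlt l).ne'
  simp only [radial] at hr
  simp only [orbYl, orbPY, radial]
  field_simp

/-- Rotation by `g` preserves the norm, and `G² = L² (1 - e²)` turns `(C - e)² + (1 - e²) S²` into
`(1 - e C)²`. -/
theorem pos_sq_eq (hlt : |G| < L) (l g : ℝ) :
    posX k L G l g ^ 2 + posY k L G l g ^ 2 = (semiAxis k L * radial L G l) ^ 2 := by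
  have hL0 : 0 < L := (abs_nonneg _).trans_lt hlt
  have h1 : posX k L G l g ^ 2 + posY k L G l g ^ 2 = orbX k L G l ^ 2 + orbY k L G l ^ 2 := by
    simp only [posX, posY]
    linear_combination (orbX k L G l ^ 2 + orbY k L G l ^ 2) * Real.sin_sq_add_cos_sq g
  rw [h1]
  have he2 := ecc_sq hlt
  have hsc := Real.sin_sq_add_cos_sq (anom L G l)
  simp only [orbX, orbY, radial]
  generalize Real.sin (anom L G l) = S at *
  generalize Real.cos (anom L G l) = C at *
  generalize ecc L G = e at *
  field_simp
  grind

theorem sqrt_pos_sq (hk : 0 < k) (h0 : 0 < |G|) (hlt : |G| < L) (l g : ℝ) :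
    Real.sqrt (posX k L G l g ^ 2 + posY k L G l g ^ 2) = semiAxis k L * radial L G l := by
  have hL0 : 0 < L := (abs_nonneg _).trans_lt hlt
  rw [pos_sq_eq hlt, Real.sqrt_sq]
  have := radial_pos h0 hlt l
  unfold semiAxis
  positivity

theorem kepler_orbPX (hk : k ≠ 0) (h0 : 0 < |G|) (hlt : |G| < L) (l : ℝ) :
    k ^ 2 / L ^ 3 * orbPXl k L G l = -(k * orbX k L G l / (semiAxis k L * radial L G l) ^ 3) := by
  have hL0 : 0 < L := (abs_nonneg _).trans_lt hlt
  have hr := (radial_pos h0 hlt l).ne'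
  simp only [orbPXl, orbX, semiAxis]
  field_simp

theorem kepler_orbPY (hk : k ≠ 0) (h0 : 0 < |G|) (hlt : |G| < L) (l : ℝ) :
    k ^ 2 / L ^ 3 * orbPYl k L G l = -(k * orbY k L G l / (semiAxis k L * radial L G l) ^ 3) := by
  have hL0 : 0 < L := (abs_nonneg _).trans_lt hlt
  have hr := (radial_pos h0 hlt l).ne'
  simp only [orbPYl, orbY, semiAxis]
  field_simp

end Kepler

/-! ### From Delaunay elements to Cartesian coordinates -/

section Cartesian

variable {k Ω α ε : ℝ} {L G l g : ℝ → ℝ}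

/-- The Kepler part contributes the momentum and the term `-(Ω/2) G` the rotation of the frame. The
perturbation contributes `{x, x² - y²}`, a multiple of `{x, y} = 0`. -/
theorem IsDelaunaySolution.hasDerivAt_posX (hk : 0 < k) (h : IsDelaunaySolution k Ω α ε L G l g)
    (t : ℝ) : HasDerivAt (fun t => posX k (L t) (G t) (l t) (g t))
      (momX k (L t) (G t) (l t) (g t) + Ω / 2 * posY k (L t) (G t) (l t) (g t)) t := by
  obtain ⟨h0, hlt, hL, hG, hl, hg⟩ := h t
  rw [hamEll_eq _ _ hk.ne' h0 hlt] at hL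
  rw [hamg_eq _ _ hk.ne' h0 hlt] at hG
  rw [hamL_eq _ _ hk.ne' h0 hlt] at hl
  rw [hamG_eq _ _ hk.ne' h0 hlt] at hg
  refine (GravWave.hasDerivAt_posX hk.ne' hL hG hl hg h0 hlt).congr_deriv ?_
  have K1 := kepler_orbX hk.ne' h0 hlt (l t)
  have K2 := kepler_orbY hk.ne' h0 hlt (l t)
  have I1 := bracket_orbX_orbY hk.ne' h0 hlt (l t)
  simp only [funCL, funCG, funCEll, funCg, momX, posX, posY]
  generalize Real.cos (g t) = c at *
  generalize Real.sin (g t) = s at *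
  linear_combination c * K1 - s * K2 - ε * α * Ω ^ 2 * (c ^ 2 + s ^ 2) *
    (orbX k (L t) (G t) (l t) * s + orbY k (L t) (G t) (l t) * c) * I1

theorem IsDelaunaySolution.hasDerivAt_posY (hk : 0 < k) (h : IsDelaunaySolution k Ω α ε L G l g)
    (t : ℝ) : HasDerivAt (fun t => posY k (L t) (G t) (l t) (g t))
      (momY k (L t) (G t) (l t) (g t) - Ω / 2 * posX k (L t) (G t) (l t) (g t)) t := by
  obtain ⟨h0, hlt, hL, hG, hl, hg⟩ := h t
  rw [hamEll_eq _ _ hk.ne' h0 hlt] at hL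
  rw [hamg_eq _ _ hk.ne' h0 hlt] at hG
  rw [hamL_eq _ _ hk.ne' h0 hlt] at hl
  rw [hamG_eq _ _ hk.ne' h0 hlt] at hg
  refine (GravWave.hasDerivAt_posY hk.ne' hL hG hl hg h0 hlt).congr_deriv ?_
  have K1 := kepler_orbX hk.ne' h0 hlt (l t)
  have K2 := kepler_orbY hk.ne' h0 hlt (l t)
  have I1 := bracket_orbX_orbY hk.ne' h0 hlt (l t)
  simp only [funCL, funCG, funCEll, funCg, momY, posX, posY]
  generalize Real.cos (g t) = c at *
  generalize Real.sin (g t) = s at *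
  linear_combination s * K1 + c * K2 - ε * α * Ω ^ 2 * (c ^ 2 + s ^ 2) *
    (orbX k (L t) (G t) (l t) * c - orbY k (L t) (G t) (l t) * s) * I1

/-- Here the perturbation contributes through `{X, x² - y²} = -2x`, which uses all four
position-momentum brackets, rotated by `g`. -/
theorem IsDelaunaySolution.hasDerivAt_momX (hk : 0 < k) (h : IsDelaunaySolution k Ω α ε L G l g)
    (t : ℝ) : HasDerivAt (fun t => momX k (L t) (G t) (l t) (g t))
      (-(k * posX k (L t) (G t) (l t) (g t) / (semiAxis k (L t) * radial (L t) (G t) (l t)) ^ 3) +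
        Ω / 2 * momY k (L t) (G t) (l t) (g t) - ε * α * Ω ^ 2 * posX k (L t) (G t) (l t) (g t)) t := by
  obtain ⟨h0, hlt, hL, hG, hl, hg⟩ := h t
  rw [hamEll_eq _ _ hk.ne' h0 hlt] at hL
  rw [hamg_eq _ _ hk.ne' h0 hlt] at hG
  rw [hamL_eq _ _ hk.ne' h0 hlt] at hl
  rw [hamG_eq _ _ hk.ne' h0 hlt] at hg
  refine (GravWave.hasDerivAt_momX hL hG hl hg h0 hlt).congr_deriv ?_
  have K1 := kepler_orbPX hk.ne' h0 hlt (l t)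
  have K2 := kepler_orbPY hk.ne' h0 hlt (l t)
  have I2 := bracket_orbPX_orbX hk.ne' h0 hlt (l t)
  have I3 := bracket_orbPY_orbY hk.ne' h0 hlt (l t)
  have I4 := bracket_orbPX_orbY hk.ne' h0 hlt (l t)
  have I5 := bracket_orbPY_orbX hk.ne' h0 hlt (l t)
  have hsc := Real.sin_sq_add_cos_sq (g t)
  simp only [funCL, funCG, funCEll, funCg, momY, posX, posY]
  generalize Real.cos (g t) = c at *
  generalize Real.sin (g t) = s at *
  -- The coefficients conjugate the brackets by the rotation through `g`; `hsc` turns the resulting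
  -- `-(c² + s²)` into `-1`.
  linear_combination c * K1 - s * K2 + ε * α * Ω ^ 2 *
    ((orbX k (L t) (G t) (l t) * c - orbY k (L t) (G t) (l t) * s) *
      (c ^ 2 * I2 + s ^ 2 * I3 - c * s * (I4 + I5) - hsc) -
    (orbX k (L t) (G t) (l t) * s + orbY k (L t) (G t) (l t) * c) *
      (c * s * (I2 - I3) + c ^ 2 * I4 - s ^ 2 * I5))

theorem IsDelaunaySolution.hasDerivAt_momY (hk : 0 < k) (h : IsDelaunaySolution k Ω α ε L G l g)
    (t : ℝ) : HasDerivAt (fun t => momY k (L t) (G t) (l t) (g t))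
      (-(k * posY k (L t) (G t) (l t) (g t) / (semiAxis k (L t) * radial (L t) (G t) (l t)) ^ 3) -
        Ω / 2 * momX k (L t) (G t) (l t) (g t) + ε * α * Ω ^ 2 * posY k (L t) (G t) (l t) (g t)) t := by
  obtain ⟨h0, hlt, hL, hG, hl, hg⟩ := h t
  rw [hamEll_eq _ _ hk.ne' h0 hlt] at hL
  rw [hamg_eq _ _ hk.ne' h0 hlt] at hG
  rw [hamL_eq _ _ hk.ne' h0 hlt] at hl
  rw [hamG_eq _ _ hk.ne' h0 hlt] at hg
  refine (GravWave.hasDerivAt_momY hL hG hl hg h0 hlt).congr_deriv ?_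
  have K1 := kepler_orbPX hk.ne' h0 hlt (l t)
  have K2 := kepler_orbPY hk.ne' h0 hlt (l t)
  have I2 := bracket_orbPX_orbX hk.ne' h0 hlt (l t)
  have I3 := bracket_orbPY_orbY hk.ne' h0 hlt (l t)
  have I4 := bracket_orbPX_orbY hk.ne' h0 hlt (l t)
  have I5 := bracket_orbPY_orbX hk.ne' h0 hlt (l t)
  have hsc := Real.sin_sq_add_cos_sq (g t)
  simp only [funCL, funCG, funCEll, funCg, momX, posX, posY]
  generalize Real.cos (g t) = c at *
  generalize Real.sin (g t) = s at *
  linear_combination s * K1 + c * K2 + ε * α * Ω ^ 2 *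
    ((orbX k (L t) (G t) (l t) * c - orbY k (L t) (G t) (l t) * s) *
      (c * s * (I2 - I3) - s ^ 2 * I4 + c ^ 2 * I5) -
    (orbX k (L t) (G t) (l t) * s + orbY k (L t) (G t) (l t) * c) *
      (s ^ 2 * I2 + c ^ 2 * I3 + c * s * (I4 + I5) - hsc))

/-- A solution of Hamilton's equations in Delaunay elements is a solution of the Cartesian
equations of motion. -/
theorem IsDelaunaySolution.isRotatingSolution (hk : 0 < k)
    (h : IsDelaunaySolution k Ω α ε L G l g) :
    IsRotatingSolution k Ω α ε (fun t => posX k (L t) (G t) (l t) (g t))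
      (fun t => posY k (L t) (G t) (l t) (g t)) := by
  have hx := h.hasDerivAt_posX hk
  have hy := h.hasDerivAt_posY hk
  have hdx : deriv (fun t => posX k (L t) (G t) (l t) (g t)) = fun t =>
      momX k (L t) (G t) (l t) (g t) + Ω / 2 * posY k (L t) (G t) (l t) (g t) :=
    funext fun t => (hx t).deriv
  have hdy : deriv (fun t => posY k (L t) (G t) (l t) (g t)) = fun t =>
      momY k (L t) (G t) (l t) (g t) - Ω / 2 * posX k (L t) (G t) (l t) (g t) :=
    funext fun t => (hy t).deriv
  intro t
  obtain ⟨h0, hlt, -⟩ := h t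
  have hL0 : 0 < L t := (abs_nonneg _).trans_lt hlt
  refine ⟨?_, (hx t).differentiableAt.hasDerivAt, (hy t).differentiableAt.hasDerivAt, ?_, ?_⟩
  · rw [pos_sq_eq hlt]
    have := radial_pos h0 hlt (l t)
    unfold semiAxis
    positivity
  · rw [sqrt_pos_sq hk h0 hlt, hdx, hdy]
    refine ((h.hasDerivAt_momX hk t).add ((hy t).const_mul (Ω / 2))).congr_deriv ?_
    ring
  · rw [sqrt_pos_sq hk h0 hlt, hdx, hdy]
    refine ((h.hasDerivAt_momY hk t).sub ((hx t).const_mul (Ω / 2))).congr_deriv ?_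
    ring

end Cartesian

end GravWave

namespace GravWave

open Topology Filter

/-! ### Bessel functions -/

/-- Differentiation under the integral sign on a compact interval, for a jointly continuous
derivative. -/
theorem hasDerivAt_intervalIntegral {𝕜 : Type*} [RCLike 𝕜] {F F' : 𝕜 → ℝ → 𝕜} {a b : ℝ}
    (hF : ∀ x, Continuous (F x)) (hF' : Continuous fun q : 𝕜 × ℝ => F' q.1 q.2)
    (h : ∀ x t, HasDerivAt (fun x => F x t) (F' x t) x) (x₀ : 𝕜) :
    HasDerivAt (fun x => ∫ t in a..b, F x t) (∫ t in a..b, F' x₀ t) x₀ := by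
  obtain ⟨C, hC⟩ := ((isCompact_closedBall x₀ 1).prod (isCompact_uIcc (a := a) (b := b)))
    |>.exists_bound_of_continuousOn hF'.continuousOn
  refine (intervalIntegral.hasDerivAt_integral_of_dominated_loc_of_deriv_le
    (Metric.closedBall_mem_nhds x₀ one_pos) (.of_forall fun x => (hF x).aestronglyMeasurable)
    ((hF x₀).intervalIntegrable a b) ?_ (bound := fun _ => C) ?_ (by simp) ?_).2
  · exact (hF'.comp (Continuous.prodMk continuous_const continuous_id)).aestronglyMeasurable
  · exact .of_forall fun t ht x hx => hC (x, t) ⟨hx, uIoc_subset_uIcc ht⟩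
  · exact .of_forall fun t _ x _ => h x t

theorem hasDerivAt_besselJ (m : ℕ) (x : ℝ) : HasDerivAt (besselJ m)
    (1 / (2 * Real.pi) * ∫ t in (0 : ℝ)..(2 * Real.pi),
      Real.sin t * Real.sin (m * t - x * Real.sin t)) x := by
  refine HasDerivAt.const_mul _ (hasDerivAt_intervalIntegral
    (F := fun x t => Real.cos (m * t - x * Real.sin t))
    (F' := fun x t => Real.sin t * Real.sin (m * t - x * Real.sin t))
    (fun x => by fun_prop) (by fun_prop) (fun x t => ?_) x)
  have h : HasDerivAt (fun x : ℝ => m * t - x * Real.sin t) (-(1 * Real.sin t)) x :=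
    ((hasDerivAt_id x).mul_const (Real.sin t)).const_sub (m * t)
  refine h.cos.congr_deriv ?_
  ring

/-- The same integral with a complex argument is complex differentiable everywhere, hence entire; on
the real axis its real part gives `besselJ`. -/
theorem analyticOnNhd_besselJ (m : ℕ) : AnalyticOnNhd ℝ (besselJ m) univ := by
  set Jc : ℂ → ℂ := fun z => ∫ t in (0 : ℝ)..(2 * Real.pi),
    Complex.cos ((m * t : ℝ) - z * (Real.sin t : ℝ)) with hJc
  have hd : Differentiable ℂ Jc := fun z =>
    (hasDerivAt_intervalIntegral
      (F := fun (z : ℂ) (t : ℝ) => Complex.cos ((m * t : ℝ) - z * (Real.sin t : ℝ)))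
      (F' := fun (z : ℂ) (t : ℝ) => -Complex.sin ((m * t : ℝ) - z * (Real.sin t : ℝ)) *
        (-(1 * ((Real.sin t : ℝ) : ℂ))))
      (fun x => by fun_prop) (by fun_prop) (fun x t =>
        (((hasDerivAt_id x).mul_const ((Real.sin t : ℝ) : ℂ)).const_sub
          ((m * t : ℝ) : ℂ)).ccos) z).differentiableAt
  have hre : besselJ m = fun x : ℝ => 1 / (2 * Real.pi) * (Jc x).re := by
    funext x
    have : Jc x = ((∫ t in (0 : ℝ)..(2 * Real.pi), Real.cos (m * t - x * Real.sin t) : ℝ) : ℂ) := by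
      rw [hJc, ← intervalIntegral.integral_ofReal]
      simp
    rw [this, Complex.ofReal_re, besselJ]
  rw [hre]
  exact fun x _ => analyticAt_const.mul (hd.analyticAt (x : ℂ)).re_ofReal

section Identities

variable (m : ℕ) (x : ℝ)

/-- Source of the integral identities below. Exact derivatives of `sin φ`, `sin t cos φ` and `cos t
sin φ`, with `φ = m t - x sin t`, integrate to zero over a period and express the needed integrals
through `J_m` and `J_m'`. -/
theorem integral_two_pi_of_periodic_primitive {f f' : ℝ → ℝ} (h : ∀ t, HasDerivAt f (f' t) t)
    (hc : Continuous f') (hp : f (2 * Real.pi) = f 0) :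
    ∫ t in (0 : ℝ)..(2 * Real.pi), f' t = 0 := by
  rw [intervalIntegral.integral_eq_sub_of_hasDerivAt (fun t _ => h t) (hc.intervalIntegrable _ _),
    hp, sub_self]

theorem hasDerivAt_phase (t : ℝ) :
    HasDerivAt (fun t => m * t - x * Real.sin t) (m - x * Real.cos t) t := by
  refine (((hasDerivAt_id t).const_mul (m : ℝ)).sub
    ((Real.hasDerivAt_sin t).const_mul x)).congr_deriv ?_
  rw [mul_one]

theorem sin_phase_two_pi :
    Real.sin (m * (2 * Real.pi) - x * Real.sin (2 * Real.pi)) = 0 := by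
  rw [Real.sin_two_pi, mul_zero, sub_zero, ← mul_assoc,
    show (m : ℝ) * 2 * Real.pi = ((2 * m : ℕ) : ℝ) * Real.pi by push_cast; ring]
  exact Real.sin_nat_mul_pi _

theorem integral_cos_phase :
    ∫ t in (0 : ℝ)..(2 * Real.pi), Real.cos (m * t - x * Real.sin t) =
      2 * Real.pi * besselJ m x := by
  rw [besselJ]
  have := Real.pi_pos
  field_simp

theorem integral_sin_mul_sin_phase :
    ∫ t in (0 : ℝ)..(2 * Real.pi), Real.sin t * Real.sin (m * t - x * Real.sin t) =
      2 * Real.pi * deriv (besselJ m) x := by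
  rw [(hasDerivAt_besselJ m x).deriv, ← mul_assoc, mul_one_div_cancel (by positivity), one_mul]

theorem integral_cos_mul_cos_phase :
    x * ∫ t in (0 : ℝ)..(2 * Real.pi), Real.cos t * Real.cos (m * t - x * Real.sin t) =
      2 * Real.pi * (m * besselJ m x) := by
  have h := integral_two_pi_of_periodic_primitive (fun t => (hasDerivAt_phase m x t).sin)
    (by fun_prop) (by rw [sin_phase_two_pi]; simp)
  have h2 : ∀ t : ℝ, Real.cos (m * t - x * Real.sin t) * (m - x * Real.cos t) =
      m * Real.cos (m * t - x * Real.sin t) -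
        x * (Real.cos t * Real.cos (m * t - x * Real.sin t)) := fun t => by ring
  simp only [h2] at h
  rw [intervalIntegral.integral_sub (Continuous.intervalIntegrable (by fun_prop) _ _)
    (Continuous.intervalIntegrable (by fun_prop) _ _), intervalIntegral.integral_const_mul,
    intervalIntegral.integral_const_mul, integral_cos_phase] at h
  linarith

theorem integral_sin_cos_mul_sin_phase :
    x * ∫ t in (0 : ℝ)..(2 * Real.pi), Real.sin t * Real.cos t * Real.sin (m * t - x * Real.sin t) =
      2 * Real.pi * (m * deriv (besselJ m) x) -
      ∫ t in (0 : ℝ)..(2 * Real.pi), Real.cos t * Real.cos (m * t - x * Real.sin t) := by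
  have h := integral_two_pi_of_periodic_primitive
    (fun t => (Real.hasDerivAt_sin t).mul (hasDerivAt_phase m x t).cos)
    (by fun_prop) (by simp)
  have h2 : ∀ t : ℝ, Real.cos t * Real.cos (m * t - x * Real.sin t) +
      Real.sin t * (-Real.sin (m * t - x * Real.sin t) * (m - x * Real.cos t)) =
      Real.cos t * Real.cos (m * t - x * Real.sin t) -
      m * (Real.sin t * Real.sin (m * t - x * Real.sin t)) +
        x * (Real.sin t * Real.cos t * Real.sin (m * t - x * Real.sin t)) := fun t => by ring
  simp only [h2] at h
  rw [intervalIntegral.integral_add (Continuous.intervalIntegrable (by fun_prop) _ _)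
    (Continuous.intervalIntegrable (by fun_prop) _ _),
    intervalIntegral.integral_sub (Continuous.intervalIntegrable (by fun_prop) _ _)
    (Continuous.intervalIntegrable (by fun_prop) _ _), intervalIntegral.integral_const_mul,
    intervalIntegral.integral_const_mul, integral_sin_mul_sin_phase] at h
  linarith

theorem integral_cos_sq_mul_cos_phase :
    x * ∫ t in (0 : ℝ)..(2 * Real.pi), Real.cos t ^ 2 * Real.cos (m * t - x * Real.sin t) =
      m * (∫ t in (0 : ℝ)..(2 * Real.pi), Real.cos t * Real.cos (m * t - x * Real.sin t)) -
      2 * Real.pi * deriv (besselJ m) x := by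
  have h := integral_two_pi_of_periodic_primitive
    (fun t => (Real.hasDerivAt_cos t).mul (hasDerivAt_phase m x t).sin)
    (by fun_prop) (by simp only [Pi.mul_apply]; rw [sin_phase_two_pi]; simp)
  have h2 : ∀ t : ℝ, -Real.sin t * Real.sin (m * t - x * Real.sin t) +
      Real.cos t * (Real.cos (m * t - x * Real.sin t) * (m - x * Real.cos t)) =
      m * (Real.cos t * Real.cos (m * t - x * Real.sin t)) -
      Real.sin t * Real.sin (m * t - x * Real.sin t) -
        x * (Real.cos t ^ 2 * Real.cos (m * t - x * Real.sin t)) := fun t => by ring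
  simp only [h2] at h
  rw [intervalIntegral.integral_sub (Continuous.intervalIntegrable (by fun_prop) _ _)
    (Continuous.intervalIntegrable (by fun_prop) _ _),
    intervalIntegral.integral_sub (Continuous.intervalIntegrable (by fun_prop) _ _)
    (Continuous.intervalIntegrable (by fun_prop) _ _), intervalIntegral.integral_const_mul,
    intervalIntegral.integral_const_mul, integral_sin_mul_sin_phase] at h
  linarith

end Identities

/-- The recurrence relation that lowers the order. -/
theorem besselJ_lower (m : ℕ) (x : ℝ) :
    x * besselJ m x = (m + 1) * besselJ (m + 1) x + x * deriv (besselJ (m + 1)) x := by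
  -- Addition theorem: the phase of order `m` is that of order `m + 1` minus `t`.
  have h2 : ∀ t : ℝ, Real.cos (m * t - x * Real.sin t) =
      Real.cos t * Real.cos ((m + 1 : ℕ) * t - x * Real.sin t) +
        Real.sin t * Real.sin ((m + 1 : ℕ) * t - x * Real.sin t) := fun t => by
    rw [← Real.cos_sub, ← Real.cos_neg]
    congr 1
    push_cast
    ring
  have h := integral_cos_phase m x
  simp only [h2] at h
  rw [intervalIntegral.integral_add (Continuous.intervalIntegrable (by fun_prop) _ _)
    (Continuous.intervalIntegrable (by fun_prop) _ _), integral_sin_mul_sin_phase] at h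
  have h3 := integral_cos_mul_cos_phase (m + 1) x
  have h4 := congrArg (fun r => x * r) h
  simp only [mul_add, h3] at h4
  have := Real.pi_pos
  have h5 : 2 * Real.pi * (x * besselJ m x) =
      2 * Real.pi * ((m + 1) * besselJ (m + 1) x + x * deriv (besselJ (m + 1)) x) := by
    push_cast at h4
    linarith
  exact mul_left_cancel₀ (by positivity) h5

/-- Induction on the order. If `J_{m+1}` vanished identically, the recurrence would give `x J_m(x) =
0` for all `x`, hence `J_m = 0` by continuity; and `J_0(0) = 1`. -/
theorem exists_besselJ_ne_zero (m : ℕ) : ∃ x, besselJ m x ≠ 0 := by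
  induction m with
  | zero =>
    refine ⟨0, ?_⟩
    have := Real.pi_pos
    simp [besselJ]
  | succ m ih =>
    by_contra! h
    obtain ⟨x, hx⟩ := ih
    have h0 : besselJ (m + 1) = fun _ => 0 := funext h
    have h1 : ∀ y, y ≠ 0 → besselJ m y = 0 := fun y hy => by
      have := besselJ_lower m y
      rw [h0] at this
      simpa [hy] using this
    have hc : Continuous (besselJ m) :=
      continuous_iff_continuousAt.2 fun y => (hasDerivAt_besselJ m y).continuousAt
    have h2 : besselJ m = fun _ => 0 := by
      refine Continuous.ext_on (s := {0}ᶜ) (dense_compl_singleton 0) hc continuous_const ?_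
      exact fun y hy => h1 y hy
    exact hx (by rw [h2])

end GravWave

namespace GravWave

open Topology Filter

/-! ### The coefficients `A` and `B` -/

/-- The first factor of the integrand is, up to `a²`, the coefficient of `cos 2g` in `∂C/∂ℓ ·
dℓ/du`. The phase integrals at `x = m e` evaluate its Fourier coefficient. -/
theorem coeffA_eq_integral {m : ℕ} (hm : 1 ≤ m) {e : ℝ} (he : e ≠ 0) :
    ∫ u in (0 : ℝ)..(2 * Real.pi), (2 * e * Real.sin u - (2 - e ^ 2) * (2 * Real.sin u * Real.cos u)) *
      Real.sin (m * u - m * e * Real.sin u) = -(Real.pi * m * coeffA m e) := by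
  have hm0 : (m : ℝ) ≠ 0 := by positivity
  have h1 := integral_sin_mul_sin_phase m (m * e)
  have h2 := integral_cos_mul_cos_phase m (m * e)
  have h3 := integral_sin_cos_mul_sin_phase m (m * e)
  have h4 : ∀ u : ℝ, (2 * e * Real.sin u - (2 - e ^ 2) * (2 * Real.sin u * Real.cos u)) *
      Real.sin (m * u - m * e * Real.sin u) =
      2 * e * (Real.sin u * Real.sin (m * u - m * e * Real.sin u)) -
      2 * (2 - e ^ 2) * (Real.sin u * Real.cos u * Real.sin (m * u - m * e * Real.sin u)) :=
    fun u => by ring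
  simp only [h4]
  rw [intervalIntegral.integral_sub (Continuous.intervalIntegrable (by fun_prop) _ _)
    (Continuous.intervalIntegrable (by fun_prop) _ _), intervalIntegral.integral_const_mul,
    intervalIntegral.integral_const_mul, h1, coeffA]
  generalize (∫ u in (0 : ℝ)..(2 * Real.pi), Real.sin u * Real.cos u *
    Real.sin (m * u - m * e * Real.sin u)) = I3 at *
  generalize (∫ u in (0 : ℝ)..(2 * Real.pi), Real.cos u *
    Real.cos (m * u - m * e * Real.sin u)) = I2 at *
  have hI2 : I2 = 2 * Real.pi * besselJ m (m * e) / e := by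
    field_simp
    have : (m : ℝ) * (e * I2) = m * (2 * Real.pi * besselJ m (m * e)) := by linarith
    linarith [mul_left_cancel₀ hm0 this]
  have hI3 : I3 = (2 * Real.pi * (m * deriv (besselJ m) (m * e)) - I2) / (m * e) := by
    field_simp
    linarith
  rw [hI3, hI2]
  field_simp
  ring

/-- The counterpart for the coefficient of `sin 2g`. The prefactor `√(1 - e²)` is `|G|/L`. -/
theorem coeffB_eq_integral {m : ℕ} (hm : 1 ≤ m) {e : ℝ} (he : e ≠ 0) :
    Real.sqrt (1 - e ^ 2) * ∫ u in (0 : ℝ)..(2 * Real.pi),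
      2 * (2 * Real.cos u ^ 2 - 1 - e * Real.cos u) * Real.cos (m * u - m * e * Real.sin u) =
      Real.pi * m * coeffB m e := by
  have hm0 : (m : ℝ) ≠ 0 := by positivity
  have h1 := integral_cos_phase m (m * e)
  have h2 := integral_cos_mul_cos_phase m (m * e)
  have h3 := integral_cos_sq_mul_cos_phase m (m * e)
  have h4 : ∀ u : ℝ, 2 * (2 * Real.cos u ^ 2 - 1 - e * Real.cos u) *
      Real.cos (m * u - m * e * Real.sin u) =
      4 * (Real.cos u ^ 2 * Real.cos (m * u - m * e * Real.sin u)) -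
      2 * Real.cos (m * u - m * e * Real.sin u) -
      2 * e * (Real.cos u * Real.cos (m * u - m * e * Real.sin u)) :=
    fun u => by ring
  simp only [h4]
  rw [intervalIntegral.integral_sub (Continuous.intervalIntegrable (by fun_prop) _ _)
    (Continuous.intervalIntegrable (by fun_prop) _ _),
    intervalIntegral.integral_sub (Continuous.intervalIntegrable (by fun_prop) _ _)
    (Continuous.intervalIntegrable (by fun_prop) _ _), intervalIntegral.integral_const_mul,
    intervalIntegral.integral_const_mul, intervalIntegral.integral_const_mul, h1, coeffB]
  generalize (∫ u in (0 : ℝ)..(2 * Real.pi), Real.cos u ^ 2 *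
    Real.cos (m * u - m * e * Real.sin u)) = I3 at *
  generalize (∫ u in (0 : ℝ)..(2 * Real.pi), Real.cos u *
    Real.cos (m * u - m * e * Real.sin u)) = I2 at *
  have hI2 : I2 = 2 * Real.pi * besselJ m (m * e) / e := by
    field_simp
    have : (m : ℝ) * (e * I2) = m * (2 * Real.pi * besselJ m (m * e)) := by linarith
    linarith [mul_left_cancel₀ hm0 this]
  have hI3 : I3 = (m * I2 - 2 * Real.pi * deriv (besselJ m) (m * e)) / (m * e) := by
    field_simp
    linarith
  rw [hI3, hI2]
  field_simp
  ring

/-- The product of `A + B` and `A - B`, up to a nonzero factor; it is analytic in `e`. -/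
noncomputable def coeffProduct (m : ℕ) (e : ℝ) : ℝ :=
  (2 * m * e * (1 - e ^ 2) * deriv (besselJ m) (m * e) - (2 - e ^ 2) * besselJ m (m * e)) ^ 2 -
    4 * (1 - e ^ 2) * (e * deriv (besselJ m) (m * e) - m * (1 - e ^ 2) * besselJ m (m * e)) ^ 2

theorem analyticOnNhd_coeffProduct (m : ℕ) : AnalyticOnNhd ℝ (coeffProduct m) univ := by
  intro e _
  have hlin : AnalyticAt ℝ (fun e : ℝ => m * e) e := analyticAt_const.mul analyticAt_id
  have hJ : AnalyticAt ℝ (fun e : ℝ => besselJ m (m * e)) e :=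
    (analyticOnNhd_besselJ m (m * e) (mem_univ _)).comp hlin
  have hJ' : AnalyticAt ℝ (fun e : ℝ => deriv (besselJ m) (m * e)) e :=
    ((analyticOnNhd_besselJ m).deriv (m * e) (mem_univ _)).comp hlin
  have hid : AnalyticAt ℝ (fun e : ℝ => e) e := analyticAt_id
  unfold coeffProduct
  fun_prop

/-- For `e > 1`, outside the physical range, the product is `P² + 4 (e² - 1) Q²`. If it vanished
identically, then `P = Q = 0` there, and eliminating `J_m'` would make `J_m` vanish on a half-line,
hence everywhere. -/
theorem exists_coeffProduct_ne_zero {m : ℕ} (hm : 1 ≤ m) : ∃ e, coeffProduct m e ≠ 0 := by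
  by_contra! h
  have hm0 : (0 : ℝ) < m := by positivity
  have hJ : ∀ e : ℝ, 2 < e → besselJ m (m * e) = 0 := fun e he => by
    have he2 : 4 < e ^ 2 := by nlinarith
    have h1 := h e
    simp only [coeffProduct] at h1
    set P := 2 * m * e * (1 - e ^ 2) * deriv (besselJ m) (m * e) - (2 - e ^ 2) * besselJ m (m * e)
      with hP
    set Q := e * deriv (besselJ m) (m * e) - m * (1 - e ^ 2) * besselJ m (m * e) with hQ
    have hQ2 : 0 ≤ (e ^ 2 - 1) * Q ^ 2 := mul_nonneg (by linarith) (sq_nonneg _)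
    have hP0 : P = 0 := by
      have : P ^ 2 ≤ 0 := by nlinarith
      exact pow_eq_zero_iff two_ne_zero |>.1 (le_antisymm this (sq_nonneg _))
    have hQ0 : Q = 0 := by
      rw [hP0] at h1
      have h3 : (e ^ 2 - 1) * Q ^ 2 = 0 := by linarith
      rcases mul_eq_zero.1 h3 with h4 | h4
      · linarith
      · exact pow_eq_zero_iff two_ne_zero |>.1 h4
    -- The combination `P - 2m(1 - e²) Q` cancels the derivative; for `e > 2` the remaining factor
    -- is positive.
    have h5 : (e ^ 2 - 2 + 2 * m ^ 2 * (1 - e ^ 2) ^ 2) * besselJ m (m * e) = 0 := by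
      have : P - 2 * m * (1 - e ^ 2) * Q = 0 := by rw [hP0, hQ0]; ring
      rw [← this, hP, hQ]; ring
    rcases mul_eq_zero.1 h5 with h6 | h6
    · have : 0 ≤ 2 * (m : ℝ) ^ 2 * (1 - e ^ 2) ^ 2 := by positivity
      linarith
    · exact h6
  obtain ⟨x, hx⟩ := exists_besselJ_ne_zero m
  refine hx ?_
  have hev : besselJ m =ᶠ[𝓝 (3 * m : ℝ)] 0 := by
    have hlt : (2 * m : ℝ) < 3 * m := by linarith
    filter_upwards [lt_mem_nhds hlt] with y hy
    have := hJ (y / m) (by rwa [lt_div_iff₀ hm0])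
    rwa [mul_div_cancel₀ _ hm0.ne'] at this
  exact (analyticOnNhd_besselJ m).eqOn_zero_of_preconnected_of_eventuallyEq_zero
    isPreconnected_univ (mem_univ _) hev (mem_univ x)

/-- `A_m + η B_m` is a nonzero multiple of `P - 2 η √(1 - e²) Q`. Multiplying the two signs removes
the square root, which is why the product is used for analyticity. -/
theorem coeff_ne_zero_of_coeffProduct_ne_zero {m : ℕ} (hm : 1 ≤ m) {e : ℝ} (he : e ∈ Ioo (0 : ℝ) 1)
    {η : ℝ} (hη : η = 1 ∨ η = -1) (h : coeffProduct m e ≠ 0) : coeffA m e + η * coeffB m e ≠ 0 := by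
  intro h0
  refine h ?_
  have hm0 : (m : ℝ) ≠ 0 := by positivity
  have he0 : e ≠ 0 := he.1.ne'
  have hs : Real.sqrt (1 - e ^ 2) ^ 2 = 1 - e ^ 2 := Real.sq_sqrt (by nlinarith [he.1, he.2])
  have hη2 : η ^ 2 = 1 := by rcases hη with h | h <;> rw [h] <;> norm_num
  simp only [coeffA, coeffB] at h0
  simp only [coeffProduct]
  generalize Real.sqrt (1 - e ^ 2) = β at *
  set P := 2 * m * e * (1 - e ^ 2) * deriv (besselJ m) (m * e) - (2 - e ^ 2) * besselJ m (m * e)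
  set Q := e * deriv (besselJ m) (m * e) - m * (1 - e ^ 2) * besselJ m (m * e)
  have hP : P = 2 * η * β * Q := by
    field_simp at h0
    linarith
  rw [hP, ← hs]
  linear_combination 4 * β ^ 2 * Q ^ 2 * hη2

/-- The zeros of an analytic function that is not identically zero on the line are isolated, hence a
null set. -/
theorem ae_coeff_ne_zero {m : ℕ} (hm : 1 ≤ m) {η : ℝ} (hη : η = 1 ∨ η = -1) :
    ∀ᵐ e ∂(volume.restrict (Ioo (0 : ℝ) 1)), coeffA m e + η * coeffB m e ≠ 0 := by
  obtain ⟨e₀, he₀⟩ := exists_coeffProduct_ne_zero hm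
  have h1 := (analyticOnNhd_coeffProduct m).preimage_zero_mem_codiscrete he₀
  have h2 : ∀ᵐ e ∂(volume : Measure ℝ), coeffProduct m e ≠ 0 := by
    have := ae_restrict_le_codiscreteWithin (μ := (volume : Measure ℝ)) MeasurableSet.univ h1
    rwa [Measure.restrict_univ] at this
  filter_upwards [ae_restrict_of_ae h2, ae_restrict_mem measurableSet_Ioo] with e h he
  exact coeff_ne_zero_of_coeffProduct_ne_zero hm he hη h

theorem isSimpleZero_mul_sin {m : ℕ} (hm : 1 ≤ m) {c : ℝ} (hc : c ≠ 0) {l : ℝ}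
    (h : c * Real.sin (m * l) = 0) : IsSimpleZero (fun l => c * Real.sin (m * l)) l := by
  refine ⟨h, ?_⟩
  have hm0 : (m : ℝ) ≠ 0 := by positivity
  have hd : HasDerivAt (fun l : ℝ => c * Real.sin (m * l)) (c * (Real.cos (m * l) * (m * 1))) l :=
    (((hasDerivAt_id l).const_mul (m : ℝ)).sin).const_mul c
  rw [hd.deriv]
  have hs : Real.sin (m * l) = 0 := (mul_eq_zero.1 h).resolve_left hc
  have hcos : Real.cos (m * l) ≠ 0 := fun h0 => by
    have := Real.sin_sq_add_cos_sq (m * l)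
    rw [hs, h0] at this
    norm_num at this
  rw [mul_one]
  exact mul_ne_zero hc (mul_ne_zero hcos hm0)

theorem ae_simple_zeros {m : ℕ} (hm : 1 ≤ m) {η : ℝ} (hη : η = 1 ∨ η = -1) :
    ∀ᵐ e ∂(volume.restrict (Ioo (0 : ℝ) 1)),
      (∃ l, IsSimpleZero (fun l => (coeffA m e + η * coeffB m e) * Real.sin (m * l)) l) ∧
      ∀ l, (coeffA m e + η * coeffB m e) * Real.sin (m * l) = 0 →
        IsSimpleZero (fun l => (coeffA m e + η * coeffB m e) * Real.sin (m * l)) l := by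
  filter_upwards [ae_coeff_ne_zero hm hη] with e he
  exact ⟨⟨0, isSimpleZero_mul_sin hm he (by simp)⟩, fun l hl => isSimpleZero_mul_sin hm he hl⟩

end GravWave

namespace GravWave

open Topology Filter

/-! ### Analyticity and periodicity in Delaunay elements -/

/-- The domain `0 < |G| < L` of the Delaunay elements `(L, G, ℓ, g)`. -/
def delaunayDomain : Set (ℝ × ℝ × ℝ × ℝ) := {p | 0 < |p.2.1| ∧ |p.2.1| < p.1}

theorem isOpen_delaunayDomain : IsOpen delaunayDomain :=
  (isOpen_lt (f := fun _ : ℝ × ℝ × ℝ × ℝ => (0 : ℝ)) (by fun_prop) (by fun_prop)).inter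
    (isOpen_lt (f := fun p : ℝ × ℝ × ℝ × ℝ => |p.2.1|) (by fun_prop) (by fun_prop))

theorem analyticAt_anom {p : ℝ × ℝ × ℝ × ℝ} (hp : p ∈ delaunayDomain) :
    AnalyticAt ℝ (fun p : ℝ × ℝ × ℝ × ℝ => anom p.1 p.2.1 p.2.2.1) p := by
  have h1 : AnalyticAt ℝ (fun p : ℝ × ℝ × ℝ × ℝ => ecc p.1 p.2.1) p :=
    (analyticAt_ecc (p := (p.1, p.2.1)) hp.2).comp
      (f := fun p : ℝ × ℝ × ℝ × ℝ => (p.1, p.2.1)) (ContDiffAt.analyticAt (by fun_prop))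
  exact (analyticAt_eccAnomaly (p := (ecc p.1 p.2.1, p.2.2.1)) (abs_ecc_lt_one hp.1 hp.2)).comp
    (f := fun p : ℝ × ℝ × ℝ × ℝ => (ecc p.1 p.2.1, p.2.2.1)) 
      (h1.prod (ContDiffAt.analyticAt (by fun_prop)))

/-- The function `r² cos 2θ` of the vector of Delaunay elements. -/
noncomputable def funCVec (k : ℝ) (p : ℝ × ℝ × ℝ × ℝ) : ℝ := funC k p.1 p.2.1 p.2.2.1 p.2.2.2

theorem analyticOnNhd_funCVec (k : ℝ) : AnalyticOnNhd ℝ (funCVec k) delaunayDomain := by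
  intro p hp
  have hL0 : p.1 ≠ 0 := ((abs_nonneg _).trans_lt hp.2).ne'
  have hu := analyticAt_anom hp
  have he : AnalyticAt ℝ (fun p : ℝ × ℝ × ℝ × ℝ => ecc p.1 p.2.1) p :=
    (analyticAt_ecc (p := (p.1, p.2.1)) hp.2).comp
      (f := fun p : ℝ × ℝ × ℝ × ℝ => (p.1, p.2.1)) (ContDiffAt.analyticAt (by fun_prop))
  have hc : AnalyticAt ℝ (fun p : ℝ × ℝ × ℝ × ℝ => Real.cos (anom p.1 p.2.1 p.2.2.1)) p :=
    Real.analyticAt_cos.comp hu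
  have hs : AnalyticAt ℝ (fun p : ℝ × ℝ × ℝ × ℝ => Real.sin (anom p.1 p.2.1 p.2.2.1)) p :=
    Real.analyticAt_sin.comp hu
  have hg : AnalyticAt ℝ (fun p : ℝ × ℝ × ℝ × ℝ => p.2.2.2) p :=
    ContDiffAt.analyticAt (by fun_prop)
  have hcg : AnalyticAt ℝ (fun p : ℝ × ℝ × ℝ × ℝ => Real.cos p.2.2.2) p :=
    Real.analyticAt_cos.comp hg
  have hsg : AnalyticAt ℝ (fun p : ℝ × ℝ × ℝ × ℝ => Real.sin p.2.2.2) p :=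
    Real.analyticAt_sin.comp hg
  have ha : AnalyticAt ℝ (fun p : ℝ × ℝ × ℝ × ℝ => p.1 ^ 2 / k) p :=
    (analyticAt_fst.pow 2).div_const
  have hGL : AnalyticAt ℝ (fun p : ℝ × ℝ × ℝ × ℝ => p.2.1 / p.1) p :=
    AnalyticAt.div (ContDiffAt.analyticAt (by fun_prop)) analyticAt_fst hL0
  have hX := ha.mul (hc.sub he)
  have hY := (ha.mul hGL).mul hs
  exact (((hX.mul hcg).sub (hY.mul hsg)).pow 2).sub (((hX.mul hsg).add (hY.mul hcg)).pow 2)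

theorem fderiv_funCVec {k : ℝ} (hk : k ≠ 0) {p : ℝ × ℝ × ℝ × ℝ} (hp : p ∈ delaunayDomain)
    (v : ℝ × ℝ × ℝ × ℝ) : fderiv ℝ (funCVec k) p v =
      funCL k p.1 p.2.1 p.2.2.1 p.2.2.2 * v.1 + funCG k p.1 p.2.1 p.2.2.1 p.2.2.2 * v.2.1 +
      funCEll k p.1 p.2.1 p.2.2.1 p.2.2.2 * v.2.2.1 +
      funCg k p.1 p.2.1 p.2.2.1 p.2.2.2 * v.2.2.2 := by
  have hline : ∀ a b : ℝ, HasDerivAt (fun t : ℝ => a + t * b) b 0 := fun a b => by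
    simpa using ((hasDerivAt_id (0 : ℝ)).mul_const b).const_add a
  have h1 := hasDerivAt_funC hk (hline p.1 v.1) (hline p.2.1 v.2.1) (hline p.2.2.1 v.2.2.1)
    (hline p.2.2.2 v.2.2.2) (by simpa using hp.1) (by simpa using hp.2)
  have h2 : HasDerivAt (fun t : ℝ => (p.1 + t * v.1, p.2.1 + t * v.2.1, p.2.2.1 + t * v.2.2.1,
      p.2.2.2 + t * v.2.2.2)) v 0 :=
    (hline _ _).prodMk ((hline _ _).prodMk ((hline _ _).prodMk (hline _ _)))
  have h3 : HasFDerivAt (funCVec k) (fderiv ℝ (funCVec k) p) (p.1 + 0 * v.1, p.2.1 + 0 * v.2.1,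
      p.2.2.1 + 0 * v.2.2.1, p.2.2.2 + 0 * v.2.2.2) := by
    simp only [zero_mul, add_zero]
    exact (analyticOnNhd_funCVec k p hp).differentiableAt.hasFDerivAt
  have h4 : HasDerivAt (fun t : ℝ => funC k (p.1 + t * v.1) (p.2.1 + t * v.2.1)
      (p.2.2.1 + t * v.2.2.1) (p.2.2.2 + t * v.2.2.2)) (fderiv ℝ (funCVec k) p v) 0 := by
    have h5 := h3.comp_hasDerivAt (0 : ℝ) h2
    exact h5
  have h4 := h4.unique h1
  simpa only [zero_mul, add_zero] using h4

/-- Derivatives of analytic functions are analytic, so the partial derivatives of `C` need no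
inspection of their formulas. -/
theorem analyticAt_of_eq_fderiv {k : ℝ} {f : ℝ × ℝ × ℝ × ℝ → ℝ} {v : ℝ × ℝ × ℝ × ℝ}
    (h : ∀ p ∈ delaunayDomain, fderiv ℝ (funCVec k) p v = f p) :
    AnalyticOnNhd ℝ f delaunayDomain := by
  intro p hp
  have h1 : AnalyticAt ℝ (fun q => fderiv ℝ (funCVec k) q v) p :=
    ((ContinuousLinearMap.apply ℝ ℝ v).analyticAt _).comp ((analyticOnNhd_funCVec k).fderiv p hp)
  exact h1.congr (by filter_upwards [isOpen_delaunayDomain.mem_nhds hp] with q hq using h q hq)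

theorem analyticOnNhd_funCL {k : ℝ} (hk : k ≠ 0) : AnalyticOnNhd ℝ
    (fun p : ℝ × ℝ × ℝ × ℝ => funCL k p.1 p.2.1 p.2.2.1 p.2.2.2) delaunayDomain :=
  analyticAt_of_eq_fderiv (v := (1, 0, 0, 0)) fun p hp => by
    rw [fderiv_funCVec hk hp]; simp

theorem analyticOnNhd_funCG {k : ℝ} (hk : k ≠ 0) : AnalyticOnNhd ℝ
    (fun p : ℝ × ℝ × ℝ × ℝ => funCG k p.1 p.2.1 p.2.2.1 p.2.2.2) delaunayDomain :=
  analyticAt_of_eq_fderiv (v := (0, 1, 0, 0)) fun p hp => by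
    rw [fderiv_funCVec hk hp]; simp

theorem analyticOnNhd_funCEll {k : ℝ} (hk : k ≠ 0) : AnalyticOnNhd ℝ
    (fun p : ℝ × ℝ × ℝ × ℝ => funCEll k p.1 p.2.1 p.2.2.1 p.2.2.2) delaunayDomain :=
  analyticAt_of_eq_fderiv (v := (0, 0, 1, 0)) fun p hp => by
    rw [fderiv_funCVec hk hp]; simp

section Periodicity

variable {k L G : ℝ}

theorem anom_add_two_pi (h0 : 0 < |G|) (hlt : |G| < L) (l : ℝ) :
    anom L G (l + 2 * Real.pi) = anom L G l + 2 * Real.pi :=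
  eccAnomaly_add_two_pi (abs_ecc_lt_one h0 hlt) l

theorem funCVec_periodic_ell (h0 : 0 < |G|) (hlt : |G| < L) (l g : ℝ) :
    funC k L G (l + 2 * Real.pi) g = funC k L G l g ∧
    funCL k L G (l + 2 * Real.pi) g = funCL k L G l g ∧
    funCG k L G (l + 2 * Real.pi) g = funCG k L G l g ∧
    funCEll k L G (l + 2 * Real.pi) g = funCEll k L G l g := by
  have h := anom_add_two_pi h0 hlt l
  simp only [anom] at h
  simp [funC, funCL, funCG, funCEll, posX, posY, orbX, orbY, orbXL, orbXG, orbXl, orbYL, orbYG,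
    orbYl, radial, anom, h]

/-- Adding `π` to `g` reflects the position in the origin, and `C` is quadratic in the position;
hence the period `π` rather than `2π`. -/
theorem funCVec_periodic_g (l g : ℝ) :
    funC k L G l (g + Real.pi) = funC k L G l g ∧
    funCL k L G l (g + Real.pi) = funCL k L G l g ∧
    funCG k L G l (g + Real.pi) = funCG k L G l g ∧
    funCEll k L G l (g + Real.pi) = funCEll k L G l g := by
  simp only [funC, funCL, funCG, funCEll, posX, posY, Real.cos_add_pi, Real.sin_add_pi]
  exact ⟨by ring, by ring, by ring, by ring⟩

theorem posX_periodic_ell (h0 : 0 < |G|) (hlt : |G| < L) (l g : ℝ) :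
    posX k L G (l + 2 * Real.pi) g = posX k L G l g ∧
    posY k L G (l + 2 * Real.pi) g = posY k L G l g := by
  have h := anom_add_two_pi h0 hlt l
  simp only [anom] at h
  simp [posX, posY, orbX, orbY, h]

end Periodicity

/-! ### The isoenergetic reduction -/

/-- Uniform bounds on a box, for all angles. -/
theorem exists_bound_funC {k : ℝ} (hk : k ≠ 0) {L₀ G₀ ρ : ℝ}
    (hbox : ∀ L G, |L - L₀| ≤ ρ → |G - G₀| ≤ ρ → 0 < |G| ∧ |G| < L) :
    ∃ M > 0, ∀ L G l g, |L - L₀| ≤ ρ → |G - G₀| ≤ ρ →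
      |funC k L G l g| ≤ M ∧ |funCG k L G l g| ≤ M := by
  set K : Set (ℝ × ℝ × ℝ × ℝ) := Metric.closedBall L₀ ρ ×ˢ Metric.closedBall G₀ ρ ×ˢ
    Icc 0 (2 * Real.pi) ×ˢ Icc 0 Real.pi with hK
  have hKc : IsCompact K := (isCompact_closedBall _ _).prod ((isCompact_closedBall _ _).prod
    (isCompact_Icc.prod isCompact_Icc))
  have hKU : K ⊆ delaunayDomain := fun p hp => hbox _ _ hp.1 hp.2.1
  obtain ⟨M₁, h1⟩ := hKc.exists_bound_of_continuousOn
    ((analyticOnNhd_funCVec k).continuousOn.mono hKU)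
  obtain ⟨M₂, h2⟩ := hKc.exists_bound_of_continuousOn
    ((analyticOnNhd_funCG hk).continuousOn.mono hKU)
  refine ⟨max 1 (max M₁ M₂), by positivity, fun L G l g hL hG => ?_⟩
  obtain ⟨h0, hlt⟩ := hbox L G hL hG
  -- Periodicity moves both angles into a compact rectangle. The two functions are moved as a pair,
  -- so that the same representative serves both.
  obtain ⟨l', hl', hl⟩ := (show Function.Periodic (fun l => (funC k L G l g, funCG k L G l g))
    (2 * Real.pi) from fun l => Prod.ext (funCVec_periodic_ell h0 hlt l g).1
      (funCVec_periodic_ell h0 hlt l g).2.2.1).exists_mem_Ico₀ Real.two_pi_pos l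
  obtain ⟨g', hg', hg⟩ := (show Function.Periodic (fun g => (funC k L G l' g, funCG k L G l' g))
    Real.pi from fun g => Prod.ext (funCVec_periodic_g l' g).1
      (funCVec_periodic_g l' g).2.2.1).exists_mem_Ico₀ Real.pi_pos g
  simp only [Prod.mk.injEq] at hl hg
  have hmem : ((L, G, l', g') : ℝ × ℝ × ℝ × ℝ) ∈ K :=
    ⟨hL, hG, Ico_subset_Icc_self hl', Ico_subset_Icc_self hg'⟩
  rw [hl.1, hl.2, hg.1, hg.2]
  exact ⟨(h1 _ hmem).trans ((le_max_left _ _).trans (le_max_right _ _)),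
    (h2 _ hmem).trans ((le_max_right _ _).trans (le_max_right _ _))⟩

end GravWave

namespace GravWave

open Topology Filter

/-- The energy equation, solved for the linear term in `G`. -/
noncomputable def energyEq (k Ω α L₀ G₀ : ℝ) (q : (ℝ × ℝ × ℝ × ℝ) × ℝ) : ℝ :=
  q.2 - G₀ - (k ^ 2 / L₀ ^ 2 - k ^ 2 / q.1.1 ^ 2) / Ω -
    q.1.2.2.2 * α * Ω * funC k q.1.1 q.2 q.1.2.1 q.1.2.2.1

section Energy

variable {k Ω α L₀ G₀ : ℝ}

theorem ham_eq_iff_energyEq (hΩ : Ω ≠ 0) {L l g ε G : ℝ} (hL₀ : L₀ ≠ 0) (hL : L ≠ 0) :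
    ham k Ω α ε L G l g = -(k ^ 2 / (2 * L₀ ^ 2)) - Ω / 2 * G₀ ↔
      energyEq k Ω α L₀ G₀ ((L, l, g, ε), G) = 0 := by
  have h : ham k Ω α ε L G l g - (-(k ^ 2 / (2 * L₀ ^ 2)) - Ω / 2 * G₀) =
      -(Ω / 2) * energyEq k Ω α L₀ G₀ ((L, l, g, ε), G) := by
    simp only [ham, energyEq]
    field_simp
    ring
  rw [← sub_eq_zero, h, mul_eq_zero]
  constructor
  · rintro (h | h)
    · exact absurd h (by simpa using hΩ)
    · exact h
  · exact Or.inr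

theorem hasDerivAt_energyEq (hk : k ≠ 0) {L l g ε G : ℝ} (h0 : 0 < |G|) (hlt : |G| < L) :
    HasDerivAt (fun G => energyEq k Ω α L₀ G₀ ((L, l, g, ε), G))
      (1 - ε * α * Ω * funCG k L G l g) G := by
  have h1 := hasDerivAt_funC hk (hasDerivAt_const G L) (hasDerivAt_id G) (hasDerivAt_const G l)
    (hasDerivAt_const G g) h0 hlt
  refine HasDerivAt.congr_deriv (f' := 1 - ε * α * Ω * _)
    ((((hasDerivAt_id G).sub_const G₀).sub_const ((k ^ 2 / L₀ ^ 2 - k ^ 2 / L ^ 2) / Ω)).sub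
      (h1.const_mul (ε * α * Ω))) ?_
  simp

theorem analyticAt_energyEq {q : (ℝ × ℝ × ℝ × ℝ) × ℝ} (h0 : 0 < |q.2|) (hlt : |q.2| < q.1.1) :
    AnalyticAt ℝ (energyEq k Ω α L₀ G₀) q := by
  have hL : q.1.1 ≠ 0 := ((abs_nonneg _).trans_lt hlt).ne'
  have h1 : AnalyticAt ℝ (fun q : (ℝ × ℝ × ℝ × ℝ) × ℝ => funC k q.1.1 q.2 q.1.2.1 q.1.2.2.1) q :=
    (analyticOnNhd_funCVec k (q.1.1, q.2, q.1.2.1, q.1.2.2.1) ⟨h0, hlt⟩).comp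
      (f := fun q : (ℝ × ℝ × ℝ × ℝ) × ℝ => (q.1.1, q.2, q.1.2.1, q.1.2.2.1))
      (ContDiffAt.analyticAt (by fun_prop))
  have hL1 : AnalyticAt ℝ (fun q : (ℝ × ℝ × ℝ × ℝ) × ℝ => q.1.1) q :=
    ContDiffAt.analyticAt (by fun_prop)
  have hε : AnalyticAt ℝ (fun q : (ℝ × ℝ × ℝ × ℝ) × ℝ => q.1.2.2.2 * α * Ω) q :=
    ContDiffAt.analyticAt (by fun_prop)
  have hG : AnalyticAt ℝ (fun q : (ℝ × ℝ × ℝ × ℝ) × ℝ => q.2 - G₀) q :=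
    ContDiffAt.analyticAt (by fun_prop)
  exact (hG.sub ((analyticAt_const.sub (analyticAt_const.div (hL1.pow 2)
    (pow_ne_zero 2 hL))).div_const)).sub (hε.mul h1)

/-- Existence of the solution `𝒢` of the energy equation near an unperturbed orbit. -/
theorem exists_isIsoenergetic (hk : k ≠ 0) (hΩ : Ω ≠ 0) (h0 : 0 < |G₀|) (hlt : |G₀| < L₀) :
    ∃ δ > 0, ∃ 𝒢 : ℝ → ℝ → ℝ → ℝ → ℝ, IsIsoenergetic k Ω α L₀ G₀ δ 𝒢 ∧
      ∀ L l g ε, |L - L₀| < δ → |ε| < δ →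
        1 / 2 ≤ 1 - ε * α * Ω * funCG k L (𝒢 L l g ε) l g := by
  have hL₀ : 0 < L₀ := (abs_nonneg _).trans_lt hlt
  -- A quarter of the distance to the boundary: with `L` and `G` both moved by at most `ρ`, the
  -- conditions `0 < |G| < L` persist.
  set ρ : ℝ := min (|G₀|) (L₀ - |G₀|) / 4 with hρ
  have hρ0 : 0 < ρ := by have := lt_min h0 (sub_pos.2 hlt); positivity
  have hbox : ∀ L G, |L - L₀| ≤ ρ → |G - G₀| ≤ ρ → 0 < |G| ∧ |G| < L := fun L G hL hG => by
    have h1 : min (|G₀|) (L₀ - |G₀|) = 4 * ρ := by rw [hρ]; ring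
    have h2 := min_le_left (|G₀|) (L₀ - |G₀|)
    have h3 := min_le_right (|G₀|) (L₀ - |G₀|)
    have h4 := abs_abs_sub_abs_le_abs_sub G G₀
    have h5 := abs_le.1 (h4.trans hG)
    have h6 := abs_le.1 hL
    constructor <;> linarith
  obtain ⟨M, hM0, hM⟩ := exists_bound_funC hk hbox
  have hcont : ContinuousAt (fun L => |(k ^ 2 / L₀ ^ 2 - k ^ 2 / L ^ 2) / Ω|) L₀ := by
    have : L₀ ^ 2 ≠ 0 := by positivity
    fun_prop (disch := assumption)
  obtain ⟨δ₁, hδ₁, hδ₁'⟩ := Metric.eventually_nhds_iff_ball.1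
    (hcont.eventually (gt_mem_nhds (show |(k ^ 2 / L₀ ^ 2 - k ^ 2 / L₀ ^ 2) / Ω| < ρ / 4 by
      rw [sub_self, zero_div, abs_zero]; positivity)))
  -- `μ` dominates `|α Ω| M`, and the summand `1` keeps it positive. Then `δ` makes `ε α Ω C` at
  -- most `ρ/4` and `ε α Ω ∂C/∂G` at most `1/2` in absolute value.
  set μ : ℝ := |α * Ω| * M + 1 with hμ
  have hμ0 : 0 < μ := by positivity
  set δ : ℝ := min (min ρ δ₁) (min (ρ / (4 * μ)) (1 / (2 * μ))) with hδ
  have hδ0 : 0 < δ := by positivity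
  have hsmall : ∀ ε c : ℝ, |ε| < δ → |c| ≤ M → |ε * α * Ω * c| ≤ ρ / 4 ∧ |ε * α * Ω * c| ≤ 1 / 2 := by
    intro ε c hε hc
    have h1 : |ε * α * Ω * c| ≤ |ε| * μ := by
      rw [show ε * α * Ω * c = ε * ((α * Ω) * c) by ring, abs_mul, abs_mul]
      gcongr
      have := mul_le_mul_of_nonneg_left hc (abs_nonneg (α * Ω))
      linarith
    have h2 : |ε| ≤ ρ / (4 * μ) := hε.le.trans ((min_le_right _ _).trans (min_le_left _ _))
    have h3 : |ε| ≤ 1 / (2 * μ) := hε.le.trans ((min_le_right _ _).trans (min_le_right _ _))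
    rw [le_div_iff₀ (by positivity)] at h2 h3
    constructor <;> linarith
  have hLρ : ∀ L, |L - L₀| < δ → |L - L₀| ≤ ρ := fun L hL =>
    hL.le.trans ((min_le_left _ _).trans (min_le_left _ _))
  have hderpos : ∀ L l g ε G, |L - L₀| < δ → |ε| < δ → |G - G₀| ≤ ρ →
      1 / 2 ≤ 1 - ε * α * Ω * funCG k L G l g := fun L l g ε G hL hε hG => by
    have := abs_le.1 (hsmall ε _ hε (hM L G l g (hLρ L hL) hG).2).2
    linarith
  have hIcc : ∀ G, G ∈ Icc (G₀ - ρ) (G₀ + ρ) ↔ |G - G₀| ≤ ρ := fun G => by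
    rw [abs_le]; constructor <;> intro h <;> constructor <;> linarith [h.1, h.2]
  -- On `[G₀ - ρ, G₀ + ρ]` the equation has slope at least `1/2`. At the ends the term `∓ρ`
  -- outweighs the two corrections of size at most `ρ/4`, so there is exactly one root.
  have key : ∀ L l g ε, |L - L₀| < δ → |ε| < δ → ∃ G, |G - G₀| < ρ ∧
      energyEq k Ω α L₀ G₀ ((L, l, g, ε), G) = 0 ∧
      ∀ G', |G' - G₀| ≤ ρ → energyEq k Ω α L₀ G₀ ((L, l, g, ε), G') = 0 → G' = G := by
    intro L l g ε hL hε
    have hd : ∀ G ∈ Icc (G₀ - ρ) (G₀ + ρ),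
        HasDerivAt (fun G => energyEq k Ω α L₀ G₀ ((L, l, g, ε), G))
          (1 - ε * α * Ω * funCG k L G l g) G := fun G hG => by
      obtain ⟨h1, h2⟩ := hbox L G (hLρ L hL) ((hIcc G).1 hG)
      exact hasDerivAt_energyEq hk h1 h2
    have hcont : ContinuousOn (fun G => energyEq k Ω α L₀ G₀ ((L, l, g, ε), G))
        (Icc (G₀ - ρ) (G₀ + ρ)) := fun G hG => (hd G hG).continuousAt.continuousWithinAt
    have hmono : StrictMonoOn (fun G => energyEq k Ω α L₀ G₀ ((L, l, g, ε), G))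
        (Icc (G₀ - ρ) (G₀ + ρ)) := by
      refine strictMonoOn_of_deriv_pos (convex_Icc _ _) hcont fun G hG => ?_
      have hG' := interior_subset hG
      rw [(hd G hG').deriv]
      linarith [hderpos L l g ε G hL hε ((hIcc G).1 hG')]
    have hLb := abs_lt.1 (hδ₁' L (by
      rw [Metric.mem_ball, Real.dist_eq]
      exact hL.trans_le ((min_le_left _ _).trans (min_le_right _ _))))
    have hend : ∀ G, |G - G₀| ≤ ρ → |ε * α * Ω * funC k L G l g| ≤ ρ / 4 := fun G hG =>
      (hsmall ε _ hε (hM L G l g (hLρ L hL) hG).1).1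
    have hlow : energyEq k Ω α L₀ G₀ ((L, l, g, ε), G₀ - ρ) < 0 := by
      have h1 := abs_le.1 (hend (G₀ - ρ) (by rw [sub_sub_cancel_left, abs_neg, abs_of_pos hρ0]))
      simp only [energyEq]
      linarith [hLb.1, h1.1]
    have hhigh : 0 < energyEq k Ω α L₀ G₀ ((L, l, g, ε), G₀ + ρ) := by
      have h1 := abs_le.1 (hend (G₀ + ρ) (by rw [add_sub_cancel_left, abs_of_pos hρ0]))
      simp only [energyEq]
      linarith [hLb.2, h1.2]
    obtain ⟨G, hG, hG0⟩ := intermediate_value_Ioo (by linarith) hcont ⟨hlow, hhigh⟩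
    refine ⟨G, abs_lt.2 ⟨by linarith [hG.1], by linarith [hG.2]⟩, hG0, fun G' hG' h => ?_⟩
    exact hmono.injOn ((hIcc G').2 hG') (Ioo_subset_Icc_self hG) (h.trans hG0.symm)
  -- For `L` or `ε` out of range the value of `𝒢` is arbitrary; no later statement uses it.
  choose! 𝒢 h𝒢ρ h𝒢0 h𝒢u using key
  have hrange : ∀ L l g ε, |L - L₀| < δ → |ε| < δ → 0 < |𝒢 L l g ε| ∧ |𝒢 L l g ε| < L :=
    fun L l g ε hL hε => hbox L _ (hLρ L hL) (h𝒢ρ L l g ε hL hε).le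
  refine ⟨δ, hδ0, 𝒢, ⟨?_, hrange, ?_, ?_, ?_⟩, fun L l g ε hL hε =>
    hderpos L l g ε _ hL hε (h𝒢ρ L l g ε hL hε).le⟩
  · rintro p ⟨hpL, hpε⟩
    obtain ⟨h1, h2⟩ := hrange p.1 p.2.1 p.2.2.1 p.2.2.2 hpL hpε
    refine analyticAt_of_unique_root (F := energyEq k Ω α L₀ G₀)
      (V := {G | |G - G₀| < ρ}) (analyticAt_energyEq h1 h2) (h𝒢0 _ _ _ _ hpL hpε) ?_
      (hasDerivAt_energyEq hk h1 h2) ?_ ?_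
    · have := hderpos p.1 p.2.1 p.2.2.1 p.2.2.2 _ hpL hpε
        (h𝒢ρ p.1 p.2.1 p.2.2.1 p.2.2.2 hpL hpε).le
      exact (lt_of_lt_of_le (by norm_num) this).ne'
    · exact (isOpen_lt (f := fun G => |G - G₀|) (by fun_prop) continuous_const).mem_nhds
        (h𝒢ρ _ _ _ _ hpL hpε)
    · have ho : IsOpen {p : ℝ × ℝ × ℝ × ℝ | |p.1 - L₀| < δ ∧ |p.2.2.2| < δ} :=
        (isOpen_lt (f := fun p : ℝ × ℝ × ℝ × ℝ => |p.1 - L₀|) (by fun_prop) continuous_const).inter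
          (isOpen_lt (f := fun p : ℝ × ℝ × ℝ × ℝ => |p.2.2.2|) (by fun_prop) continuous_const)
      filter_upwards [ho.mem_nhds ⟨hpL, hpε⟩] with q hq G hG hGq
      exact h𝒢u _ _ _ _ hq.1 hq.2 G (le_of_lt hG) hGq
  · intro L l g ε hL hε
    have hL0 : 0 < L := (abs_nonneg _).trans_lt (hrange L l g ε hL hε).2
    exact (ham_eq_iff_energyEq hΩ hL₀.ne' hL0.ne').2 (h𝒢0 L l g ε hL hε)
  · intro L l g ε hL hε
    obtain ⟨h1, h2⟩ := hrange L (l + 2 * Real.pi) g ε hL hε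
    -- The value at the shifted angle solves the same equation in the same interval, so uniqueness
    -- gives periodicity.
    refine h𝒢u L l g ε hL hε _ (h𝒢ρ _ _ _ _ hL hε).le ?_
    have := h𝒢0 L (l + 2 * Real.pi) g ε hL hε
    simpa only [energyEq, (funCVec_periodic_ell h1 h2 l g).1] using this
  · intro L l g ε hL hε
    refine h𝒢u L l g ε hL hε _ (h𝒢ρ _ _ _ _ hL hε).le ?_
    have := h𝒢0 L l (g + Real.pi) ε hL hε
    simpa only [energyEq, (funCVec_periodic_g l g).1] using this

end Energy

end GravWave

namespace GravWave

open Topology Filter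

/-! ### The reduced system -/

section Reduced

variable {k Ω α L₀ G₀ δ : ℝ} {𝒢 : ℝ → ℝ → ℝ → ℝ → ℝ}

/-- The factor `1 - ε α Ω ∂C/∂G` by which `dg/dt` differs from `-Ω/2`. -/
noncomputable def clockFactor (k Ω α : ℝ) (𝒢 : ℝ → ℝ → ℝ → ℝ → ℝ) (ε L l g : ℝ) : ℝ :=
  1 - ε * α * Ω * funCG k L (𝒢 L l g ε) l g

/-- The quotient of `dL/dg` by `ε`. -/
noncomputable def slopeL (k Ω α : ℝ) (𝒢 : ℝ → ℝ → ℝ → ℝ → ℝ) (ε L l g : ℝ) : ℝ :=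
  α * Ω * funCEll k L (𝒢 L l g ε) l g / clockFactor k Ω α 𝒢 ε L l g

/-- An explicit expression for `dℓ/dg`. -/
noncomputable def slopeEll (k Ω α : ℝ) (𝒢 : ℝ → ℝ → ℝ → ℝ → ℝ) (ε L l g : ℝ) : ℝ :=
  -(2 / Ω * (k ^ 2 / L ^ 3 + ε / 2 * α * Ω ^ 2 * funCL k L (𝒢 L l g ε) l g) /
    clockFactor k Ω α 𝒢 ε L l g)

namespace IsIsoenergetic

variable (h : IsIsoenergetic k Ω α L₀ G₀ δ 𝒢)

include h in
theorem hamG_eq (hk : k ≠ 0) {L ε : ℝ} (hL : |L - L₀| < δ) (hε : |ε| < δ) (l g : ℝ) :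
    hamG k Ω α ε L (𝒢 L l g ε) l g = -(Ω / 2) * clockFactor k Ω α 𝒢 ε L l g := by
  obtain ⟨h0, hlt⟩ := h.range L l g ε hL hε
  rw [GravWave.hamG_eq l g hk h0 hlt, clockFactor]
  ring

include h in
theorem redL_eq (hk : k ≠ 0) (hΩ : Ω ≠ 0) {L ε : ℝ} (hL : |L - L₀| < δ) (hε : |ε| < δ) (l g : ℝ) :
    redL k Ω α 𝒢 ε L l g = ε * slopeL k Ω α 𝒢 ε L l g := by
  obtain ⟨h0, hlt⟩ := h.range L l g ε hL hε
  rw [redL, h.hamG_eq hk hL hε, hamEll_eq l g hk h0 hlt, slopeL]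
  field_simp

include h in
theorem redEll_eq (hk : k ≠ 0) (hΩ : Ω ≠ 0) {L ε : ℝ} (hL : |L - L₀| < δ) (hε : |ε| < δ)
    (l g : ℝ) : redEll k Ω α 𝒢 ε L l g = slopeEll k Ω α 𝒢 ε L l g := by
  obtain ⟨h0, hlt⟩ := h.range L l g ε hL hε
  rw [redEll, h.hamG_eq hk hL hε, hamL_eq l g hk h0 hlt, slopeEll]
  field_simp

theorem clockFactor_zero (L l g : ℝ) : clockFactor k Ω α 𝒢 0 L l g = 1 := by
  simp [clockFactor]

theorem slopeEll_zero (L l g : ℝ) : slopeEll k Ω α 𝒢 0 L l g = -(2 / Ω * (k ^ 2 / L ^ 3)) := by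
  simp [slopeEll, clockFactor_zero]

include h in
theorem apply_zero (hΩ : Ω ≠ 0) (hδ : 0 < δ) (l g : ℝ) : 𝒢 L₀ l g 0 = G₀ := by
  have := h.energy L₀ l g 0 (by simpa using hδ) (by simpa using hδ)
  simp only [ham, zero_div, zero_mul, add_zero] at this
  have h2 : Ω / 2 * (𝒢 L₀ l g 0 - G₀) = 0 := by linarith
  have h3 : Ω / 2 ≠ 0 := by simpa using hΩ
  linarith [(mul_eq_zero.1 h2).resolve_left h3]

include h in
theorem slopeL_zero (hΩ : Ω ≠ 0) (hδ : 0 < δ) (l g : ℝ) :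
    slopeL k Ω α 𝒢 0 L₀ l g = α * Ω * funCEll k L₀ G₀ l g := by
  rw [slopeL, clockFactor_zero, div_one, h.apply_zero hΩ hδ]

include h in
theorem analyticAt_vector {p : ℝ × ℝ × ℝ × ℝ} (hp : |p.1 - L₀| < δ ∧ |p.2.2.2| < δ) :
    AnalyticAt ℝ (fun p : ℝ × ℝ × ℝ × ℝ =>
      (p.1, 𝒢 p.1 p.2.1 p.2.2.1 p.2.2.2, p.2.1, p.2.2.1)) p :=
  analyticAt_fst.prod ((h.analytic p hp).prod (ContDiffAt.analyticAt (by fun_prop)))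

include h in
theorem analyticAt_clockFactor (hk : k ≠ 0) {p : ℝ × ℝ × ℝ × ℝ}
    (hp : |p.1 - L₀| < δ ∧ |p.2.2.2| < δ) : AnalyticAt ℝ
    (fun p : ℝ × ℝ × ℝ × ℝ => clockFactor k Ω α 𝒢 p.2.2.2 p.1 p.2.1 p.2.2.1) p := by
  have h1 := (analyticOnNhd_funCG hk _ (h.range _ p.2.1 p.2.2.1 _ hp.1 hp.2)).comp
    (f := fun p : ℝ × ℝ × ℝ × ℝ => (p.1, 𝒢 p.1 p.2.1 p.2.2.1 p.2.2.2, p.2.1, p.2.2.1))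
    (h.analyticAt_vector hp)
  have hε : AnalyticAt ℝ (fun p : ℝ × ℝ × ℝ × ℝ => p.2.2.2 * α * Ω) p :=
    ContDiffAt.analyticAt (by fun_prop)
  exact analyticAt_const.sub (hε.mul h1)

include h in
theorem analyticAt_slopeL (hk : k ≠ 0) {p : ℝ × ℝ × ℝ × ℝ}
    (hp : |p.1 - L₀| < δ ∧ |p.2.2.2| < δ)
    (hc : clockFactor k Ω α 𝒢 p.2.2.2 p.1 p.2.1 p.2.2.1 ≠ 0) : AnalyticAt ℝ
    (fun p : ℝ × ℝ × ℝ × ℝ => slopeL k Ω α 𝒢 p.2.2.2 p.1 p.2.1 p.2.2.1) p := by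
  have h1 := (analyticOnNhd_funCEll hk _ (h.range _ p.2.1 p.2.2.1 _ hp.1 hp.2)).comp
    (f := fun p : ℝ × ℝ × ℝ × ℝ => (p.1, 𝒢 p.1 p.2.1 p.2.2.1 p.2.2.2, p.2.1, p.2.2.1))
    (h.analyticAt_vector hp)
  exact (analyticAt_const.mul h1).div (h.analyticAt_clockFactor hk hp) hc

include h in
theorem analyticAt_slopeEll (hk : k ≠ 0) {p : ℝ × ℝ × ℝ × ℝ}
    (hp : |p.1 - L₀| < δ ∧ |p.2.2.2| < δ)
    (hc : clockFactor k Ω α 𝒢 p.2.2.2 p.1 p.2.1 p.2.2.1 ≠ 0) : AnalyticAt ℝ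
    (fun p : ℝ × ℝ × ℝ × ℝ => slopeEll k Ω α 𝒢 p.2.2.2 p.1 p.2.1 p.2.2.1) p := by
  have hL0 : p.1 ≠ 0 := ((abs_nonneg _).trans_lt (h.range _ p.2.1 p.2.2.1 _ hp.1 hp.2).2).ne'
  have h1 := (analyticOnNhd_funCL hk _ (h.range _ p.2.1 p.2.2.1 _ hp.1 hp.2)).comp
    (f := fun p : ℝ × ℝ × ℝ × ℝ => (p.1, 𝒢 p.1 p.2.1 p.2.2.1 p.2.2.2, p.2.1, p.2.2.1))
    (h.analyticAt_vector hp)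
  have hε : AnalyticAt ℝ (fun p : ℝ × ℝ × ℝ × ℝ => p.2.2.2 / 2 * α * Ω ^ 2) p :=
    ContDiffAt.analyticAt (by fun_prop)
  have hω : AnalyticAt ℝ (fun p : ℝ × ℝ × ℝ × ℝ => k ^ 2 / p.1 ^ 3) p :=
    analyticAt_const.div (analyticAt_fst.pow 3) (pow_ne_zero 3 hL0)
  exact ((analyticAt_const.mul (hω.add (hε.mul h1))).div (h.analyticAt_clockFactor hk hp) hc).neg

include h in
theorem clockFactor_add_two_pi {L ε : ℝ} (hL : |L - L₀| < δ) (hε : |ε| < δ) (l g : ℝ) :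
    clockFactor k Ω α 𝒢 ε L (l + 2 * Real.pi) g = clockFactor k Ω α 𝒢 ε L l g ∧
    slopeL k Ω α 𝒢 ε L (l + 2 * Real.pi) g = slopeL k Ω α 𝒢 ε L l g ∧
    slopeEll k Ω α 𝒢 ε L (l + 2 * Real.pi) g = slopeEll k Ω α 𝒢 ε L l g := by
  obtain ⟨h0, hlt⟩ := h.range L l g ε hL hε
  obtain ⟨-, h1, h2, h3⟩ := funCVec_periodic_ell (k := k) h0 hlt l g
  simp only [clockFactor, slopeL, slopeEll, h.periodic_ell L l g ε hL hε, h1, h2, h3, and_self]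

include h in
theorem clockFactor_add_pi {L ε : ℝ} (hL : |L - L₀| < δ) (hε : |ε| < δ) (l g : ℝ) :
    clockFactor k Ω α 𝒢 ε L l (g + Real.pi) = clockFactor k Ω α 𝒢 ε L l g ∧
    slopeL k Ω α 𝒢 ε L l (g + Real.pi) = slopeL k Ω α 𝒢 ε L l g ∧
    slopeEll k Ω α 𝒢 ε L l (g + Real.pi) = slopeEll k Ω α 𝒢 ε L l g := by
  obtain ⟨-, h1, h2, h3⟩ := funCVec_periodic_g (k := k) (L := L) (G := 𝒢 L l g ε) l g
  simp only [clockFactor, slopeL, slopeEll, h.periodic_g L l g ε hL hε, h1, h2, h3, and_self]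

include h in
/-- All angles that differ by multiples of the periods give the same values. -/
theorem slope_shift {L ε : ℝ} (hL : |L - L₀| < δ) (hε : |ε| < δ) (l g : ℝ) (i : ℤ) (j : ℕ) :
    clockFactor k Ω α 𝒢 ε L (l + i * (2 * Real.pi)) (g + j * Real.pi) =
      clockFactor k Ω α 𝒢 ε L l g ∧
    slopeL k Ω α 𝒢 ε L (l + i * (2 * Real.pi)) (g + j * Real.pi) = slopeL k Ω α 𝒢 ε L l g ∧
    slopeEll k Ω α 𝒢 ε L (l + i * (2 * Real.pi)) (g + j * Real.pi) =
      slopeEll k Ω α 𝒢 ε L l g := by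
  have hl : ∀ g, Function.Periodic (fun l => (clockFactor k Ω α 𝒢 ε L l g,
      slopeL k Ω α 𝒢 ε L l g, slopeEll k Ω α 𝒢 ε L l g)) (2 * Real.pi) := fun g l => by
    obtain ⟨h1, h2, h3⟩ := h.clockFactor_add_two_pi hL hε l g
    simp only [h1, h2, h3]
  have hg : Function.Periodic (fun g => (clockFactor k Ω α 𝒢 ε L l g,
      slopeL k Ω α 𝒢 ε L l g, slopeEll k Ω α 𝒢 ε L l g)) Real.pi := fun g => by
    obtain ⟨h1, h2, h3⟩ := h.clockFactor_add_pi hL hε l g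
    simp only [h1, h2, h3]
  have := ((hl (g + j * Real.pi)).int_mul i l).trans (hg.nat_mul j g)
  simpa only [Prod.mk.injEq] using this

include h in
theorem shift_nat {L ε : ℝ} (hL : |L - L₀| < δ) (hε : |ε| < δ) (l g : ℝ) (i : ℤ) (j : ℕ) :
    𝒢 L (l + i * (2 * Real.pi)) (g + j * Real.pi) ε = 𝒢 L l g ε := by
  have hl : ∀ g, Function.Periodic (fun l => 𝒢 L l g ε) (2 * Real.pi) := fun g l =>
    h.periodic_ell L l g ε hL hε
  have hg : Function.Periodic (fun g => 𝒢 L l g ε) Real.pi := fun g => h.periodic_g L l g ε hL hε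
  exact ((hl (g + j * Real.pi)).int_mul i l).trans (hg.nat_mul j g)

include h in
-- At `ε = 0` the clock factor is `1` and `dℓ/dg` is the Kepler frequency times `-2/Ω`, whatever `𝒢`
-- is; the frequency is strictly monotone in `L`.
theorem deriv_redEll_ne_zero (hk : k ≠ 0) (hΩ : Ω ≠ 0) (hδ : 0 < δ) (l g : ℝ) :
    deriv (fun L => redEll k Ω α 𝒢 0 L l g) L₀ ≠ 0 := by
  have hL₀ : 0 < L₀ :=
    (abs_nonneg _).trans_lt (h.range L₀ l g 0 (by simpa using hδ) (by simpa using hδ)).2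
  have hnear : (fun L => redEll k Ω α 𝒢 0 L l g) =ᶠ[𝓝 L₀]
      fun L => -(2 / Ω * (k ^ 2 / L ^ 3)) := by
    have hc : ContinuousAt (fun L => |L - L₀|) L₀ := by fun_prop
    filter_upwards [hc.eventually (gt_mem_nhds (show |L₀ - L₀| < δ by simpa using hδ))] with L hL
    rw [h.redEll_eq hk hΩ hL (by simpa using hδ), slopeEll_zero]
  have hd : HasDerivAt (fun L : ℝ => -(2 / Ω * (k ^ 2 / L ^ 3))) (6 * k ^ 2 / (Ω * L₀ ^ 4)) L₀ := by
    refine (((hasDerivAt_const L₀ (k ^ 2)).div (hasDerivAt_pow 3 L₀)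
      (pow_ne_zero 3 hL₀.ne')).const_mul (2 / Ω)).neg.congr_deriv ?_
    field_simp
    push_cast
    ring
  rw [hnear.deriv_eq, hd.deriv]
  positivity

include h in
theorem deriv_redL_zero (hk : k ≠ 0) (hΩ : Ω ≠ 0) (hδ : 0 < δ) (l g : ℝ) :
    deriv (fun ε => redL k Ω α 𝒢 ε L₀ l g) 0 = α * Ω * funCEll k L₀ G₀ l g := by
  have hδ' : |L₀ - L₀| < δ := by simpa using hδ
  have hnear : (fun ε => redL k Ω α 𝒢 ε L₀ l g) =ᶠ[𝓝 0]
      fun ε => ε * slopeL k Ω α 𝒢 ε L₀ l g := by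
    have hc : ContinuousAt (fun ε : ℝ => |ε|) 0 := by fun_prop
    filter_upwards [hc.eventually (gt_mem_nhds (show |(0 : ℝ)| < δ by simpa using hδ))] with ε hε
    exact h.redL_eq hk hΩ hδ' hε l g
  have hs : DifferentiableAt ℝ (fun ε => slopeL k Ω α 𝒢 ε L₀ l g) 0 := by
    have h1 := h.analyticAt_slopeL hk (p := (L₀, l, g, 0)) ⟨hδ', by simpa using hδ⟩
      (by rw [clockFactor_zero]; exact one_ne_zero)
    exact h1.differentiableAt.comp (f := fun ε : ℝ => (L₀, l, g, ε)) (0 : ℝ) (by fun_prop)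
  -- Since `dL/dg` is `ε` times a differentiable function, its first-order part is that function at
  -- `ε = 0`; the derivative of `𝒢` in `ε` does not enter.
  have hd := (hasDerivAt_id (0 : ℝ)).mul hs.hasDerivAt
  rw [hnear.deriv_eq]
  refine hd.deriv.trans ?_
  rw [← h.slopeL_zero hΩ hδ]
  simp

end IsIsoenergetic

end Reduced

/-! ### The bifurcation function -/

theorem integral_eq_zero_of_odd_reflection {f : ℝ → ℝ} {a : ℝ} (h : ∀ u, f (a - u) = -f u) :
    ∫ u in (0 : ℝ)..a, f u = 0 := by
  have h1 := intervalIntegral.integral_comp_sub_left (a := 0) (b := a) f a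
  simp only [h, sub_self, sub_zero, intervalIntegral.integral_neg] at h1
  linarith

section Fourier

variable {k L G : ℝ}

/-- `C` is quadratic in the position, so rotation by `g` produces only the harmonics `cos 2g` and
`sin 2g`. -/
theorem funCEll_eq (l g : ℝ) : funCEll k L G l g =
    2 * (orbX k L G l * orbXl k L G l - orbY k L G l * orbYl k L G l) * Real.cos (2 * g) -
    2 * (orbX k L G l * orbYl k L G l + orbXl k L G l * orbY k L G l) * Real.sin (2 * g) := by
  rw [Real.cos_two_mul', Real.sin_two_mul, funCEll, posX, posY]
  ring

/-- The derivative `∂C/∂ℓ` at the eccentric anomaly `u`, with the Jacobian `dℓ/du`. -/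
theorem funCEll_kepler (h0 : 0 < |G|) (hlt : |G| < L) (u g : ℝ) :
    funCEll k L G (u - ecc L G * Real.sin u) g * (1 - ecc L G * Real.cos u) =
    semiAxis k L ^ 2 * ((2 * ecc L G * Real.sin u -
      (2 - ecc L G ^ 2) * (2 * Real.sin u * Real.cos u)) * Real.cos (2 * g) -
    G / L * (2 * (2 * Real.cos u ^ 2 - 1 - ecc L G * Real.cos u)) * Real.sin (2 * g)) := by
  have hL0 : 0 < L := (abs_nonneg _).trans_lt hlt
  have hr := (one_sub_mul_cos_pos (abs_ecc_lt_one h0 hlt) u).ne'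
  have hG2 : (G / L) ^ 2 = 1 - ecc L G ^ 2 := by
    have := ecc_sq hlt
    field_simp
    linarith
  have hu : anom L G (u - ecc L G * Real.sin u) = u :=
    eccAnomaly_kepler (abs_ecc_lt_one h0 hlt) u
  have hsc := Real.sin_sq_add_cos_sq u
  have hYl : ∀ C D : ℝ, L * G / k * C / D = semiAxis k L * (G / L) * C / D := fun C D => by
    rw [semiAxis]; field_simp
  rw [funCEll_eq]
  simp only [orbX, orbY, orbXl, orbYl, hYl, radial]
  simp only [anom] at hu ⊢
  rw [hu]
  generalize 1 - ecc L G * Real.cos u = D at *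
  generalize Real.cos (2 * g) = c2
  generalize Real.sin (2 * g) = s2
  generalize Real.cos u = C at *
  generalize Real.sin u = S at *
  generalize ecc L G = e at *
  generalize G / L = b at *
  field_simp
  linear_combination (-(semiAxis k L ^ 2) * S * C * c2) * hG2 + (semiAxis k L ^ 2 * b * s2) * hsc

end Fourier

end GravWave

namespace GravWave

open Topology Filter

section FourierIntegral

variable {k L G : ℝ}

theorem continuous_funCEll_comp (hk : k ≠ 0) (h0 : 0 < |G|) (hlt : |G| < L) {f₁ f₂ : ℝ → ℝ}
    (h₁ : Continuous f₁) (h₂ : Continuous f₂) :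
    Continuous fun t => funCEll k L G (f₁ t) (f₂ t) := by
  refine continuous_iff_continuousAt.2 fun t => ?_
  exact (analyticOnNhd_funCEll hk (L, G, f₁ t, f₂ t) ⟨h0, hlt⟩).continuousAt.comp
    (f := fun t => (L, G, f₁ t, f₂ t)) (by fun_prop)

theorem funCEll_shift (h0 : 0 < |G|) (hlt : |G| < L) (l g : ℝ) (i j : ℤ) :
    funCEll k L G (l + i * (2 * Real.pi)) (g + j * Real.pi) = funCEll k L G l g := by
  have hl : ∀ g, Function.Periodic (fun l => funCEll k L G l g) (2 * Real.pi) := fun g l =>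
    (funCVec_periodic_ell h0 hlt l g).2.2.2
  have hg : Function.Periodic (fun g => funCEll k L G l g) Real.pi := fun g =>
    (funCVec_periodic_g l g).2.2.2
  exact ((hl (g + j * Real.pi)).int_mul i l).trans (hg.int_mul j g)

/-- The integral over an arc of resonance, with the mean anomaly as the variable. -/
theorem integral_funCEll_resonant {m : ℕ} (hm : 1 ≤ m) {s : ℝ} (hs : s = 1 ∨ s = -1)
    (h0 : 0 < |G|) (hlt : |G| < L) (l : ℝ) :
    ∫ g in (0 : ℝ)..(m * Real.pi), funCEll k L G (l - 2 * s / m * g) g =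
    m / 2 * ∫ φ in (0 : ℝ)..(2 * Real.pi), funCEll k L G φ (m * s / 2 * (l - φ)) := by
  have hm0 : (m : ℝ) ≠ 0 := by positivity
  have hs2 : s * s = 1 := by rcases hs with rfl | rfl <;> norm_num
  have hs0 : s ≠ 0 := left_ne_zero_of_mul_eq_one hs2
  set F : ℝ → ℝ := fun φ => funCEll k L G φ (m * s / 2 * (l - φ)) with hF
  -- A turn of `φ` changes the second argument by `-m s π`, a multiple of the period `π` of `C` in
  -- `g`.
  have hper : Function.Periodic F (2 * Real.pi) := fun φ => by
    obtain ⟨i, hi⟩ : ∃ i : ℤ, (i : ℝ) = -(m * s) := by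
      rcases hs with rfl | rfl
      · exact ⟨-m, by push_cast; ring⟩
      · exact ⟨m, by push_cast; ring⟩
    have := funCEll_shift (k := k) h0 hlt φ (m * s / 2 * (l - φ)) 1 i
    rw [hi] at this
    simp only [hF]
    rw [← this]
    congr 1 <;> push_cast <;> ring
  have hint : ∀ g, funCEll k L G (l - 2 * s / m * g) g = F (l - 2 * s / m * g) := fun g => by
    simp only [hF]
    congr 1
    have : m * s / 2 * (l - (l - 2 * s / m * g)) = (s * s) * g := by field_simp; ring
    rw [this, hs2, one_mul]
  simp only [hint]
  rw [intervalIntegral.integral_comp_sub_mul F (c := 2 * s / m) (by positivity)]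
  have hend : l - 2 * s / m * (m * Real.pi) = l - 2 * s * Real.pi := by field_simp
  rw [hend, mul_zero, sub_zero]
  -- For `s = 1` the range is `[l - 2π, l]`; for `s = -1` it is `[l, l + 2π]` traversed backwards,
  -- and the sign is compensated by the negative Jacobian.
  rcases hs with rfl | rfl
  · have := hper.intervalIntegral_add_eq (l - 2 * Real.pi) 0
    rw [sub_add_cancel, zero_add] at this
    simp only [mul_one, this, smul_eq_mul]
    field_simp
  · have := hper.intervalIntegral_add_eq l 0
    rw [zero_add] at this
    have h2 : l - 2 * -1 * Real.pi = l + 2 * Real.pi := by ring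
    rw [h2, intervalIntegral.integral_symm, this, smul_eq_mul]
    field_simp

/-- The integral over an arc of resonance in terms of `A_m` and `B_m`. -/
theorem integral_funCEll_eq_coeff (hk : k ≠ 0) {m : ℕ} (hm : 1 ≤ m) {s : ℝ} (hs : s = 1 ∨ s = -1)
    {η e : ℝ} (he0 : e ≠ 0) (h0 : 0 < |G|) (hlt : |G| < L) (he : ecc L G = e)
    (hG : G / L = η * s * Real.sqrt (1 - e ^ 2)) (l : ℝ) :
    ∫ φ in (0 : ℝ)..(2 * Real.pi), funCEll k L G φ (m * s / 2 * (l - φ)) =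
    -(Real.pi * m * semiAxis k L ^ 2 * ((coeffA m e + η * coeffB m e) * Real.sin (m * l))) := by
  have hs2 : s * s = 1 := by rcases hs with rfl | rfl <;> norm_num
  have hcos : ∀ x : ℝ, Real.cos (s * x) = Real.cos x := fun x => by
    rcases hs with rfl | rfl <;> simp
  have hsin : ∀ x : ℝ, Real.sin (s * x) = s * Real.sin x := fun x => by
    rcases hs with rfl | rfl <;> simp
  -- Kepler's equation as a change of variables; it maps `[0, 2π]` onto itself.
  have hsub := intervalIntegral.integral_comp_mul_deriv (a := 0) (b := 2 * Real.pi)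
    (f := fun u => u - e * Real.sin u) (f' := fun u => 1 - e * Real.cos u)
    (g := fun φ => funCEll k L G φ (m * s / 2 * (l - φ)))
    (fun u _ => (hasDerivAt_id u).sub ((Real.hasDerivAt_sin u).const_mul e))
    (by fun_prop) (continuous_funCEll_comp hk h0 hlt (by fun_prop) (by fun_prop))
  simp only [Real.sin_zero, Real.sin_two_pi, mul_zero, sub_zero] at hsub
  rw [← hsub]
  set P : ℝ → ℝ := fun u => 2 * e * Real.sin u - (2 - e ^ 2) * (2 * Real.sin u * Real.cos u) with hP
  set Q : ℝ → ℝ := fun u => 2 * (2 * Real.cos u ^ 2 - 1 - e * Real.cos u) with hQ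
  set Φ : ℝ → ℝ := fun u => m * u - m * e * Real.sin u with hΦ
  have hPc : Continuous P := by fun_prop
  have hQc : Continuous Q := by fun_prop
  have hΦc : Continuous Φ := by fun_prop
  -- Under `u ↦ 2π - u` the factor `P` is odd, `Q` is even and `Φ` is odd modulo `2π`. This
  -- annihilates both integrals that multiply `cos mℓ`.
  have hPr : ∀ u, P (2 * Real.pi - u) = -P u := fun u => by
    simp only [hP, Real.sin_two_pi_sub, Real.cos_two_pi_sub]; ring
  have hQr : ∀ u, Q (2 * Real.pi - u) = Q u := fun u => by
    simp only [hQ, Real.cos_two_pi_sub]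
  have hΦr : ∀ u, Φ (2 * Real.pi - u) = m * (2 * Real.pi) - Φ u := fun u => by
    simp only [hΦ, Real.sin_two_pi_sub]; ring
  have hz1 : ∫ u in (0 : ℝ)..(2 * Real.pi), P u * Real.cos (Φ u) = 0 :=
    integral_eq_zero_of_odd_reflection fun u => by
      rw [hPr, hΦr, Real.cos_nat_mul_two_pi_sub]; ring
  have hz2 : ∫ u in (0 : ℝ)..(2 * Real.pi), Q u * Real.sin (Φ u) = 0 :=
    integral_eq_zero_of_odd_reflection fun u => by
      rw [hQr, hΦr, Real.sin_nat_mul_two_pi_sub]; ring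
  have hA := coeffA_eq_integral hm he0
  have hB := coeffB_eq_integral hm he0
  change ∫ u in (0 : ℝ)..(2 * Real.pi), P u * Real.sin (Φ u) = _ at hA
  change Real.sqrt (1 - e ^ 2) * ∫ u in (0 : ℝ)..(2 * Real.pi), Q u * Real.cos (Φ u) = _ at hB
  set b := Real.sqrt (1 - e ^ 2) with hb
  set A2 := semiAxis k L ^ 2 with hA2
  have hpt : ∀ u, ((fun φ => funCEll k L G φ (m * s / 2 * (l - φ))) ∘
      fun u => u - e * Real.sin u) u * (1 - e * Real.cos u) =
      A2 * Real.cos (m * l) * (P u * Real.cos (Φ u)) +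
      A2 * Real.sin (m * l) * (P u * Real.sin (Φ u)) -
      A2 * (η * b) * Real.sin (m * l) * (Q u * Real.cos (Φ u)) +
      A2 * (η * b) * Real.cos (m * l) * (Q u * Real.sin (Φ u)) := fun u => by
    have h1 := funCEll_kepler (k := k) h0 hlt u (m * s / 2 * (l - (u - e * Real.sin u)))
    have h2 : 2 * (m * s / 2 * (l - (u - e * Real.sin u))) = s * (m * l - Φ u) := by
      simp only [hΦ]; ring
    rw [he, hG, h2, hcos, hsin, Real.cos_sub, Real.sin_sub (m * l)] at h1
    simp only [Function.comp_apply]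
    rw [h1]
    -- The orientation `s` enters once through `G / L` and once through `sin 2g`; `s * s = 1` leaves
    -- only `η`.
    linear_combination (-A2 * η * b * Q u * (Real.sin (m * l) * Real.cos (Φ u) -
      Real.cos (m * l) * Real.sin (Φ u))) * hs2
  simp only [hpt]
  have hi : ∀ c : ℝ, ∀ f : ℝ → ℝ, Continuous f →
      IntervalIntegrable (fun u => c * f u) volume 0 (2 * Real.pi) := fun c f hf =>
    (hf.const_mul c).intervalIntegrable _ _
  have c1 : Continuous fun u => P u * Real.cos (Φ u) := by fun_prop
  have c2 : Continuous fun u => P u * Real.sin (Φ u) := by fun_prop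
  have c3 : Continuous fun u => Q u * Real.cos (Φ u) := by fun_prop
  have c4 : Continuous fun u => Q u * Real.sin (Φ u) := by fun_prop
  rw [intervalIntegral.integral_add (((hi _ _ c1).add (hi _ _ c2)).sub (hi _ _ c3)) (hi _ _ c4),
    intervalIntegral.integral_sub ((hi _ _ c1).add (hi _ _ c2)) (hi _ _ c3),
    intervalIntegral.integral_add (hi _ _ c1) (hi _ _ c2)]
  simp only [intervalIntegral.integral_const_mul, hz1, hz2, hA]
  linear_combination (-A2 * η * Real.sin (m * l)) * hB

end FourierIntegral

section Bifurcation

variable {k Ω α L₀ δ η e : ℝ} {𝒢 : ℝ → ℝ → ℝ → ℝ → ℝ} {m : ℕ}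

/-- The unperturbed angular momentum of the orbit of eccentricity `e`. -/
noncomputable def orbitG (Ω L₀ η e : ℝ) : ℝ := η * Real.sign Ω * L₀ * Real.sqrt (1 - e ^ 2)

theorem sign_eq_one_or (hΩ : Ω ≠ 0) : Real.sign Ω = 1 ∨ Real.sign Ω = -1 :=
  (Real.sign_apply_eq_of_ne_zero Ω hΩ).symm

theorem abs_orbitG (hΩ : Ω ≠ 0) (hL : 0 < L₀) (hη : η = 1 ∨ η = -1) :
    |orbitG Ω L₀ η e| = L₀ * Real.sqrt (1 - e ^ 2) := by
  have h1 : |η| = 1 := by rcases hη with rfl | rfl <;> simp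
  have h2 : |Real.sign Ω| = 1 := by rcases sign_eq_one_or hΩ with h | h <;> simp [h]
  rw [orbitG, abs_mul, abs_mul, abs_mul, h1, h2, abs_of_pos hL, abs_of_nonneg (Real.sqrt_nonneg _)]
  ring

theorem orbitG_mem (hΩ : Ω ≠ 0) (hL : 0 < L₀) (hη : η = 1 ∨ η = -1) (he : e ∈ Ioo (0 : ℝ) 1) :
    0 < |orbitG Ω L₀ η e| ∧ |orbitG Ω L₀ η e| < L₀ := by
  have h1 : 0 < 1 - e ^ 2 := by nlinarith [he.1, he.2]
  have h2 : Real.sqrt (1 - e ^ 2) < 1 := by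
    rw [Real.sqrt_lt' one_pos]; nlinarith [he.1]
  rw [abs_orbitG hΩ hL hη]
  exact ⟨mul_pos hL (Real.sqrt_pos.2 h1), mul_lt_of_lt_one_right hL h2⟩

theorem ecc_orbitG (hΩ : Ω ≠ 0) (hL : 0 < L₀) (hη : η = 1 ∨ η = -1) (he : e ∈ Ioo (0 : ℝ) 1) :
    ecc L₀ (orbitG Ω L₀ η e) = e := by
  have h1 : 0 ≤ 1 - e ^ 2 := by nlinarith [he.1, he.2]
  have h2 : L₀ ^ 2 - orbitG Ω L₀ η e ^ 2 = (L₀ * e) ^ 2 := by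
    rw [← sq_abs (orbitG Ω L₀ η e), abs_orbitG hΩ hL hη, mul_pow, Real.sq_sqrt h1]; ring
  rw [ecc, h2, Real.sqrt_sq (mul_pos hL he.1).le]
  field_simp

/-- Resonance leaves only the sign of `Ω`, so the unperturbed `ℓ` has slope `∓2/m` in `g`. -/
theorem freq_ratio (hΩ : Ω ≠ 0) (hm : 1 ≤ m) (hres : (m : ℝ) * keplerFreq k L₀ = |Ω|) :
    2 * keplerFreq k L₀ / Ω = 2 * Real.sign Ω / m := by
  have hm0 : (m : ℝ) ≠ 0 := by positivity
  rw [div_eq_div_iff hΩ hm0]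
  have h1 : Real.sign Ω * Ω = |Ω| := by
    rcases hΩ.lt_or_gt with h | h
    · rw [Real.sign_of_neg h, abs_of_neg h]; ring
    · rw [Real.sign_of_pos h, abs_of_pos h]; ring
  linear_combination 2 * hres - 2 * h1

/-- The bifurcation function is a multiple of `(A_m + η B_m) sin mℓ`. -/
theorem IsIsoenergetic.bifurcation_eq
    (h : IsIsoenergetic k Ω α L₀ (orbitG Ω L₀ η e) δ 𝒢) (hk : k ≠ 0) (hΩ : Ω ≠ 0) (hδ : 0 < δ)
    (hm : 1 ≤ m) (hL : 0 < L₀) (hres : (m : ℝ) * keplerFreq k L₀ = |Ω|) (hη : η = 1 ∨ η = -1)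
    (he : e ∈ Ioo (0 : ℝ) 1) (l : ℝ) :
    bifurcation k Ω α m L₀ 𝒢 l = -(α * Ω * m * semiAxis k L₀ ^ 2 / 2) *
      ((coeffA m e + η * coeffB m e) * Real.sin (m * l)) := by
  have hm0 : (m : ℝ) ≠ 0 := by positivity
  obtain ⟨h0, hlt⟩ := orbitG_mem hΩ hL hη he
  have hs := sign_eq_one_or hΩ
  have hG : orbitG Ω L₀ η e / L₀ = η * Real.sign Ω * Real.sqrt (1 - e ^ 2) := by
    rw [orbitG]; field_simp
  rw [bifurcation]
  simp only [h.deriv_redL_zero hk hΩ hδ, freq_ratio hΩ hm hres,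
    intervalIntegral.integral_const_mul]
  -- The constant is `α Ω` times `1/(mπ)` for the average, `m/2` for the Jacobian and `-π m a²` for
  -- the Fourier integral.
  rw [integral_funCEll_resonant hm hs h0 hlt,
    integral_funCEll_eq_coeff hk hm hs he.1.ne' h0 hlt (ecc_orbitG hΩ hL hη he) hG]
  field_simp

end Bifurcation

end GravWave

/-! ### Continuation from simple zeros of the bifurcation function -/

namespace GravWave

open Topology Filter

section Continuation

variable {k Ω α L₀ G₀ δ ℓ₀ : ℝ} {𝒢 : ℝ → ℝ → ℝ → ℝ → ℝ} {m : ℕ}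

theorem exists_int_sign (hΩ : Ω ≠ 0) : ∃ i : ℤ, (i : ℝ) = Real.sign Ω := by
  rcases sign_eq_one_or hΩ with h | h
  · exact ⟨1, by rw [h]; norm_num⟩
  · exact ⟨-1, by rw [h]; norm_num⟩

/-- Over an arc of length `mπ` the unperturbed mean anomaly makes one turn. -/
theorem freq_ratio_mul_arc (hΩ : Ω ≠ 0) (hm : 1 ≤ m) (hres : (m : ℝ) * keplerFreq k L₀ = |Ω|) :
    2 * keplerFreq k L₀ / Ω * (m * Real.pi) = Real.sign Ω * (2 * Real.pi) := by
  have hm0 : (m : ℝ) ≠ 0 := by positivity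
  rw [freq_ratio hΩ hm hres]
  field_simp

/-- In the variables `L - L₀` and `ℓ - ℓ₀ + (2ω/Ω) g` the reduced system is a twist system. -/
theorem IsIsoenergetic.isTwistSystem (h : IsIsoenergetic k Ω α L₀ G₀ δ 𝒢) (hδ : 0 < δ)
    (hc : ∀ L l g ε, |L - L₀| < δ → |ε| < δ → 1 / 2 ≤ clockFactor k Ω α 𝒢 ε L l g)
    (hk : k ≠ 0) (hΩ : Ω ≠ 0) (hm : 1 ≤ m) (hL : 0 < L₀)
    (hres : (m : ℝ) * keplerFreq k L₀ = |Ω|)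
    (hz : IsSimpleZero (bifurcation k Ω α m L₀ 𝒢) ℓ₀) :
    IsTwistSystem (m * Real.pi) δ
      (fun p => slopeL k Ω α 𝒢 p.1.1 (L₀ + p.1.2.1)
        (ℓ₀ - 2 * keplerFreq k L₀ / Ω * p.2 + p.1.2.2) p.2)
      (fun p => slopeEll k Ω α 𝒢 p.1.1 (L₀ + p.1.2.1)
        (ℓ₀ - 2 * keplerFreq k L₀ / Ω * p.2 + p.1.2.2) p.2 + 2 * keplerFreq k L₀ / Ω)
      (fun x => -(2 / Ω * (k ^ 2 / (L₀ + x) ^ 3)) + 2 * keplerFreq k L₀ / Ω)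
      (6 * k ^ 2 / (Ω * L₀ ^ 4)) (m * Real.pi * deriv (bifurcation k Ω α m L₀ 𝒢) ℓ₀) := by
  have hm0 : (m : ℝ) ≠ 0 := by positivity
  have hpi := Real.pi_pos
  set w := 2 * keplerFreq k L₀ / Ω with hw
  have harc : w * (m * Real.pi) = Real.sign Ω * (2 * Real.pi) := freq_ratio_mul_arc hΩ hm hres
  obtain ⟨i, hi⟩ := exists_int_sign hΩ
  -- While `g` grows by `mπ`, the drift changes `ℓ` by one full turn, so the field in the new
  -- variables has period `mπ`.
  have hshift : ∀ p : ℝ × ℝ × ℝ, |p.1| < δ → |p.2.1| < δ → ∀ g,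
      slopeL k Ω α 𝒢 p.1 (L₀ + p.2.1) (ℓ₀ - w * (g + m * Real.pi) + p.2.2) (g + m * Real.pi) =
        slopeL k Ω α 𝒢 p.1 (L₀ + p.2.1) (ℓ₀ - w * g + p.2.2) g ∧
      slopeEll k Ω α 𝒢 p.1 (L₀ + p.2.1) (ℓ₀ - w * (g + m * Real.pi) + p.2.2) (g + m * Real.pi) =
        slopeEll k Ω α 𝒢 p.1 (L₀ + p.2.1) (ℓ₀ - w * g + p.2.2) g := fun p h1 h2 g => by
    have := (h.slope_shift (L := L₀ + p.2.1) (by simpa using h2) h1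
      (ℓ₀ - w * g + p.2.2) g (-i) m).2
    have h3 : ℓ₀ - w * (g + m * Real.pi) + p.2.2 =
        ℓ₀ - w * g + p.2.2 + (-i : ℤ) * (2 * Real.pi) := by
      push_cast
      rw [hi]
      linear_combination -harc
    rwa [h3]
  have hmap : ContDiff ℝ 1 fun p : (ℝ × ℝ × ℝ) × ℝ =>
      (L₀ + p.1.2.1, ℓ₀ - w * p.2 + p.1.2.2, p.2, p.1.1) := by fun_prop
  have hdom : ∀ p ∈ {p : ℝ × ℝ × ℝ | |p.1| < δ ∧ |p.2.1| < δ} ×ˢ (univ : Set ℝ),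
      |L₀ + p.1.2.1 - L₀| < δ ∧ |p.1.1| < δ := fun p hp => ⟨by simpa using hp.1.2, hp.1.1⟩
  have havg : ∀ y, ∫ g in (0 : ℝ)..(m * Real.pi),
      slopeL k Ω α 𝒢 0 (L₀ + 0) (ℓ₀ - w * g + y) g =
      m * Real.pi * bifurcation k Ω α m L₀ 𝒢 (ℓ₀ + y) := fun y => by
    rw [bifurcation, ← mul_assoc, mul_one_div_cancel (by positivity), one_mul]
    refine intervalIntegral.integral_congr fun g _ => ?_
    simp only [h.deriv_redL_zero hk hΩ hδ, add_zero, h.slopeL_zero hΩ hδ]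
    congr 2
    ring
  -- The derivative of a nondifferentiable function is `0` by default, so a nonzero `deriv` already
  -- implies differentiability.
  have hbd : HasDerivAt (bifurcation k Ω α m L₀ 𝒢)
      (deriv (bifurcation k Ω α m L₀ 𝒢) ℓ₀) (ℓ₀ + 0) := by
    rw [add_zero]
    exact (differentiableAt_of_deriv_ne_zero hz.2).hasDerivAt
  constructor
  case period_pos => positivity
  case radius_pos => exact hδ
  case smoothR => 
    intro p hp
    have h1 := hdom p hp
    exact ((h.analyticAt_slopeL hk
      (p := (L₀ + p.1.2.1, ℓ₀ - w * p.2 + p.1.2.2, p.2, p.1.1)) h1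
      (by have := hc _ (ℓ₀ - w * p.2 + p.1.2.2) p.2 _ h1.1 h1.2; simp only; positivity)).contDiffAt.comp p
        hmap.contDiffAt).contDiffWithinAt
  case smoothN => 
    intro p hp
    have h1 := hdom p hp
    exact (((h.analyticAt_slopeEll hk
      (p := (L₀ + p.1.2.1, ℓ₀ - w * p.2 + p.1.2.2, p.2, p.1.1)) h1
      (by have := hc _ (ℓ₀ - w * p.2 + p.1.2.2) p.2 _ h1.1 h1.2; simp only; positivity)).contDiffAt.comp p
        hmap.contDiffAt).add contDiffAt_const).contDiffWithinAt
  case periodicR => exact fun p h1 h2 g => (hshift p h1 h2 g).1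
  case periodicN => exact fun p h1 h2 g => congrArg (· + w) (hshift p h1 h2 g).2
  case twist =>
    intro x y g hx
    simp only [slopeEll_zero]
  case twist_zero =>
    simp only [add_zero, hw, keplerFreq]
    ring
  case twist_deriv =>
    have hL0 : L₀ + 0 ≠ 0 := by simpa using hL.ne'
    have h1 : HasDerivAt (fun x : ℝ => (L₀ + x) ^ 3) (3 * (L₀ + 0) ^ 2 * 1) 0 :=
      ((hasDerivAt_id (0 : ℝ)).const_add L₀).fun_pow 3 |>.congr_deriv (by simp)
    refine ((((hasDerivAt_const (0 : ℝ) (k ^ 2)).div h1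
      (pow_ne_zero 3 hL0)).const_mul (2 / Ω)).neg.add_const w).congr_deriv ?_
    rw [add_zero]
    field_simp
    ring
  case twist_ne => positivity
  case average => 
    have := havg 0
    rwa [add_zero ℓ₀, hz.1, mul_zero] at this
  case average_deriv =>
    simp only [havg]
    exact (hbd.comp_const_add ℓ₀ 0).const_mul _
  case average_ne => exact mul_ne_zero (by positivity) hz.2

/-- Undoes the change of variables: periodic deviations from the drift become solutions whose `ℓ`
closes up to one turn. -/
theorem IsIsoenergetic.exists_reducedPeriodic (h : IsIsoenergetic k Ω α L₀ G₀ δ 𝒢) (hδ : 0 < δ)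
    (hc : ∀ L l g ε, |L - L₀| < δ → |ε| < δ → 1 / 2 ≤ clockFactor k Ω α 𝒢 ε L l g)
    (hk : k ≠ 0) (hΩ : Ω ≠ 0) (hm : 1 ≤ m) (hL : 0 < L₀)
    (hres : (m : ℝ) * keplerFreq k L₀ = |Ω|)
    (hz : IsSimpleZero (bifurcation k Ω α m L₀ 𝒢) ℓ₀) :
    ∃ ε₀ > 0, ε₀ ≤ δ ∧ ∃ Λ lam : ℝ → ℝ → ℝ, Λ 0 0 = L₀ ∧ lam 0 0 = ℓ₀ ∧
      ContinuousOn (fun ε => (Λ ε 0, lam ε 0)) (Ioo (-ε₀) ε₀) ∧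
      ∀ ε ∈ Ioo (-ε₀) ε₀, (∀ g, |Λ ε g - L₀| < δ) ∧
        IsReducedPeriodic k Ω α m 𝒢 ε (Λ ε) (lam ε) := by
  obtain ⟨ε₀, hε₀, hle, X, Y, hX0, hY0, hcont, hsol⟩ :=
    (h.isTwistSystem hδ hc hk hΩ hm hL hres hz).exists_periodic_family
  set w := 2 * keplerFreq k L₀ / Ω with hw
  refine ⟨ε₀, hε₀, hle, fun ε g => L₀ + X ε g, fun ε g => ℓ₀ - w * g + Y ε g, by simp [hX0],
    by simp [hY0], ?_, fun ε hε => ⟨fun g => by simpa using (hsol ε hε g).1, fun g => ?_⟩⟩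
  · have : (fun ε => (L₀ + X ε 0, ℓ₀ - w * 0 + Y ε 0)) =
        fun ε => (L₀, ℓ₀) + (X ε 0, Y ε 0) := by
      ext ε <;> simp
    rw [this]
    exact hcont.const_add _
  · obtain ⟨hXδ, hX, hY, hXp, hYp⟩ := hsol ε hε g
    have hεδ : |ε| < δ := (abs_lt.2 hε).trans_le hle
    have hLδ : |L₀ + X ε g - L₀| < δ := by simpa using hXδ
    refine ⟨?_, ?_, congrArg (L₀ + ·) hXp, ?_⟩
    · rw [h.redL_eq hk hΩ hLδ hεδ]
      exact hX.const_add L₀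
    · rw [h.redEll_eq hk hΩ hLδ hεδ]
      refine ((((hasDerivAt_id g).const_mul w).const_sub ℓ₀).add hY).congr_deriv ?_
      ring
    · simp only [hYp]
      linear_combination -(freq_ratio_mul_arc hΩ hm hres)

end Continuation

end GravWave

/-! ### Return to the physical time -/

namespace GravWave

open Topology Filter

/-- The flow of a positive periodic velocity on the line. -/
theorem exists_flow_of_pos {f : ℝ → ℝ} {P : ℝ} (hf : Continuous f) (hpos : ∀ x, 0 < f x)
    (hP : 0 < P) (hper : Function.Periodic f P) :
    ∃ T > 0, ∃ ρ : ℝ → ℝ, ρ 0 = 0 ∧ (∀ t, HasDerivAt ρ (f (ρ t)) t) ∧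
      ∀ t, ρ (t + T) = ρ t + P := by
  have hic : Continuous fun x => (f x)⁻¹ := hf.inv₀ fun x => (hpos x).ne'
  have hiper : Function.Periodic (fun x => (f x)⁻¹) P := fun x => by simp only [hper x]
  -- The travel time as a function of the position; the flow is its inverse and the period is `τ P`.
  set τ : ℝ → ℝ := fun x => ∫ y in (0 : ℝ)..x, (f y)⁻¹ with hτ
  have hd : ∀ x, HasDerivAt τ (f x)⁻¹ x := fun x => hic.integral_hasStrictDerivAt 0 x |>.hasDerivAt
  have hmono : StrictMono τ := strictMono_of_deriv_pos fun x => by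
    rw [(hd x).deriv]; exact inv_pos.2 (hpos x)
  have hcont : Continuous τ := continuous_iff_continuousAt.2 fun x => (hd x).continuousAt
  have hτ0 : τ 0 = 0 := by simp [hτ]
  have hshift : ∀ x, τ (x + P) = τ x + τ P := fun x => by
    have h1 := hiper.intervalIntegral_add_eq x 0
    rw [zero_add] at h1
    simp only [hτ]
    rw [← h1, intervalIntegral.integral_add_adjacent_intervals (hic.intervalIntegrable _ _)
      (hic.intervalIntegrable _ _)]
  have hTpos : 0 < τ P := by rw [← hτ0]; exact hmono hP
  -- The travel time grows by `τ P` over every period, hence is unbounded in both directions and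
  -- onto.
  have hnat : ∀ n : ℕ, τ (n * P) = n * τ P ∧ τ (-(n * P)) = -(n * τ P) := fun n => by
    induction n with
    | zero => simp [hτ0]
    | succ n ih =>
      have h1 := hshift (n * P)
      have h2 := hshift (-((n + 1 : ℕ) * P))
      have h3 : -(((n + 1 : ℕ) : ℝ) * P) + P = -(n * P) := by push_cast; ring
      have h4 : ((n + 1 : ℕ) : ℝ) * P = n * P + P := by push_cast; ring
      rw [h3, ih.2] at h2
      rw [ih.1] at h1
      refine ⟨by rw [h4, h1]; push_cast; ring, by push_cast at h2 ⊢; linarith⟩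
  have hsurj : Function.Surjective τ := fun t => by
    obtain ⟨n, hn⟩ := exists_nat_gt (|t| / τ P)
    rw [div_lt_iff₀ hTpos] at hn
    have h1 := abs_lt.1 hn
    obtain ⟨x, -, hx⟩ := intermediate_value_Icc (a := -(n * P)) (b := n * P)
      (by have : 0 ≤ n * P := by positivity
          linarith) hcont.continuousOn
      (show t ∈ Icc _ _ by rw [(hnat n).1, (hnat n).2]; exact ⟨h1.1.le, h1.2.le⟩)
    exact ⟨x, hx⟩
  set E := hmono.orderIsoOfSurjective τ hsurj with hE
  have hEτ : ∀ x, E x = τ x := fun x => rfl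
  have hinv : ∀ t, τ (E.symm t) = t := fun t => E.apply_symm_apply t
  refine ⟨τ P, hTpos, E.symm, ?_, fun t => ?_, fun t => ?_⟩
  · apply hmono.injective
    rw [hinv, hτ0]
  · have := HasDerivAt.of_local_left_inverse (f := τ) (g := E.symm) (a := t)
      E.symm.continuous.continuousAt (hd _) (inv_ne_zero (hpos _).ne')
      (Eventually.of_forall hinv)
    rwa [inv_inv] at this
  · apply hmono.injective
    rw [hinv, hshift, hinv]

section Time

variable {k Ω α L₀ G₀ δ ε : ℝ} {𝒢 : ℝ → ℝ → ℝ → ℝ → ℝ} {m : ℕ} {Λ lam : ℝ → ℝ}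

/-- The physical time along a periodic solution of the reduced system. -/
theorem IsIsoenergetic.exists_clock (h : IsIsoenergetic k Ω α L₀ G₀ δ 𝒢)
    (hc : ∀ L l g ε, |L - L₀| < δ → |ε| < δ → 1 / 2 ≤ clockFactor k Ω α 𝒢 ε L l g)
    (hk : k ≠ 0) (hΩ : Ω ≠ 0) (hm : 1 ≤ m) (hε : |ε| < δ) (hΛ : ∀ g, |Λ g - L₀| < δ)
    (hred : IsReducedPeriodic k Ω α m 𝒢 ε Λ lam) :
    ∃ T > 0, ∃ γ : ℝ → ℝ, γ 0 = 0 ∧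
      (∀ t, HasDerivAt γ (hamG k Ω α ε (Λ (γ t)) (𝒢 (Λ (γ t)) (lam (γ t)) (γ t) ε)
        (lam (γ t)) (γ t)) t) ∧
      ∀ t, γ (t + T) = γ t - Real.sign Ω * (2 * Real.pi * m) := by
  have hpi := Real.pi_pos
  have hΛc : Continuous Λ := continuous_iff_continuousAt.2 fun g => (hred g).1.continuousAt
  have hlc : Continuous lam := continuous_iff_continuousAt.2 fun g => (hred g).2.1.continuousAt
  obtain ⟨i, hi⟩ := exists_int_sign hΩ
  -- `f` is the absolute value of `dg/dt`; the direction is restored below by running the flow with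
  -- the time `-sgn Ω · t`.
  set f : ℝ → ℝ := fun g => |Ω| / 2 * clockFactor k Ω α 𝒢 ε (Λ g) (lam g) g with hf
  have hfc : Continuous f := continuous_const.mul <| continuous_iff_continuousAt.2 fun g =>
    (h.analyticAt_clockFactor hk (p := (Λ g, lam g, g, ε)) ⟨hΛ g, hε⟩).continuousAt.comp
      (f := fun g => (Λ g, lam g, g, ε)) (by fun_prop)
  have hfpos : ∀ g, 0 < f g := fun g => by
    have := hc _ (lam g) g ε (hΛ g) hε
    have : 0 < |Ω| := abs_pos.2 hΩ
    simp only [hf]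
    positivity
  have hper1 : Function.Periodic f (m * Real.pi) := fun g => by
    have h1 := (h.slope_shift (hΛ g) hε (lam g) g (-i) m).1
    simp only [hf, (hred g).2.2.1, (hred g).2.2.2]
    rw [← h1]
    congr 2
    push_cast
    rw [hi]
    ring
  -- Two arcs of length `mπ`: a single one returns `g` only modulo `π`, which is not enough for the
  -- position when `m` is odd.
  have hper : Function.Periodic f (2 * Real.pi * m) := by
    have := hper1.nat_mul 2
    rwa [show ((2 : ℕ) : ℝ) * (m * Real.pi) = 2 * Real.pi * m by push_cast; ring] at this
  obtain ⟨T, hT, ρ, hρ0, hρ, hρT⟩ := exists_flow_of_pos hfc hfpos (by positivity) hper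
  refine ⟨T, hT, fun t => ρ (-Real.sign Ω * t), by simp [hρ0], fun t => ?_, fun t => ?_⟩
  · rw [h.hamG_eq hk (hΛ _) hε]
    refine ((hρ _).comp t ((hasDerivAt_id t).const_mul (-Real.sign Ω))).congr_deriv ?_
    have hsΩ : Real.sign Ω * |Ω| = Ω := by
      rcases hΩ.lt_or_gt with h | h
      · rw [Real.sign_of_neg h, abs_of_neg h]; ring
      · rw [Real.sign_of_pos h, abs_of_pos h]; ring
    simp only [hf, id]
    linear_combination (-(1 / 2) * clockFactor k Ω α 𝒢 ε (Λ (ρ (-Real.sign Ω * t)))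
      (lam (ρ (-Real.sign Ω * t))) (ρ (-Real.sign Ω * t))) * hsΩ
  · rcases sign_eq_one_or hΩ with hs | hs
    · have := hρT (-1 * (t + T))
      simp only [hs]
      rw [show -1 * (t + T) + T = -1 * t by ring] at this
      linarith
    · have := hρT (-(-1) * t)
      simp only [hs]
      rw [show -(-1) * (t + T) = -(-1) * t + T by ring, this]
      ring

end Time

end GravWave

namespace GravWave

open Topology Filter

section Time

variable {k Ω α L₀ G₀ δ ε T : ℝ} {𝒢 : ℝ → ℝ → ℝ → ℝ → ℝ} {m : ℕ} {Λ lam γ : ℝ → ℝ}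

/-- A solution of the reduced system, run at the speed `∂H/∂G` of the angle `g`, solves Hamilton's
equations. -/
theorem IsIsoenergetic.isDelaunaySolution (h : IsIsoenergetic k Ω α L₀ G₀ δ 𝒢)
    (hc : ∀ L l g ε, |L - L₀| < δ → |ε| < δ → 1 / 2 ≤ clockFactor k Ω α 𝒢 ε L l g)
    (hk : k ≠ 0) (hΩ : Ω ≠ 0) (hε : |ε| < δ) (hΛ : ∀ g, |Λ g - L₀| < δ)
    (hred : IsReducedPeriodic k Ω α m 𝒢 ε Λ lam)
    (hγ : ∀ t, HasDerivAt γ (hamG k Ω α ε (Λ (γ t)) (𝒢 (Λ (γ t)) (lam (γ t)) (γ t) ε)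
      (lam (γ t)) (γ t)) t) :
    IsDelaunaySolution k Ω α ε (fun t => Λ (γ t))
      (fun t => 𝒢 (Λ (γ t)) (lam (γ t)) (γ t) ε) (fun t => lam (γ t)) γ := by
  intro t
  obtain ⟨h0, hlt⟩ := h.range _ (lam (γ t)) (γ t) ε (hΛ (γ t)) hε
  obtain ⟨hd1, hd2, -, -⟩ := hred (γ t)
  have hne : hamG k Ω α ε (Λ (γ t)) (𝒢 (Λ (γ t)) (lam (γ t)) (γ t) ε) (lam (γ t)) (γ t) ≠ 0 := by
    have := hc _ (lam (γ t)) (γ t) ε (hΛ (γ t)) hε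
    rw [h.hamG_eq hk (hΛ _) hε]
    exact mul_ne_zero (by simpa using hΩ) (by positivity)
  have hL : HasDerivAt (fun t => Λ (γ t))
      (-hamEll k Ω α ε (Λ (γ t)) (𝒢 (Λ (γ t)) (lam (γ t)) (γ t) ε) (lam (γ t)) (γ t)) t :=
    (hd1.comp t (hγ t)).congr_deriv (div_mul_cancel₀ _ hne)
  have hl : HasDerivAt (fun t => lam (γ t))
      (hamL k Ω α ε (Λ (γ t)) (𝒢 (Λ (γ t)) (lam (γ t)) (γ t) ε) (lam (γ t)) (γ t)) t :=
    (hd2.comp t (hγ t)).congr_deriv (div_mul_cancel₀ _ hne)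
  have hGd : DifferentiableAt ℝ (fun t => 𝒢 (Λ (γ t)) (lam (γ t)) (γ t) ε) t :=
    (h.analytic (Λ (γ t), lam (γ t), γ t, ε) ⟨hΛ _, hε⟩).differentiableAt.comp
      (f := fun t => (Λ (γ t), lam (γ t), γ t, ε)) t
      (hL.differentiableAt.prodMk (hl.differentiableAt.prodMk
        ((hγ t).differentiableAt.prodMk (differentiableAt_const ε))))
  refine ⟨h0, hlt, hL, ?_, hl, hγ t⟩
  -- Conservation of energy determines `dG/dt`: the terms in `dL/dt` and `dℓ/dt` cancel by
  -- Hamilton's equations, and what remains is divided by `dg/dt = ∂H/∂G`, which is nonzero.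
  have hen := hasDerivAt_ham (Ω := Ω) (α := α) (ε := ε) hk hL hGd.hasDerivAt hl (hγ t) h0 hlt
  have hconst : (fun t => ham k Ω α ε (Λ (γ t)) (𝒢 (Λ (γ t)) (lam (γ t)) (γ t) ε)
      (lam (γ t)) (γ t)) = fun _ => -(k ^ 2 / (2 * L₀ ^ 2)) - Ω / 2 * G₀ :=
    funext fun t => h.energy _ _ _ _ (hΛ _) hε
  rw [hconst] at hen
  have hzero := hen.unique (hasDerivAt_const t _)
  refine hGd.hasDerivAt.congr_deriv ?_
  refine mul_left_cancel₀ hne ?_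
  simp only [hamL_eq _ _ hk h0 hlt, GravWave.hamG_eq _ _ hk h0 hlt, hamEll_eq _ _ hk h0 hlt,
    hamg_eq _ _ hk h0 hlt] at hzero ⊢
  linear_combination hzero

theorem pos_shift {L G l g : ℝ} (h0 : 0 < |G|) (hlt : |G| < L) (i j : ℤ) :
    posX k L G (l + i * (2 * Real.pi)) (g + j * (2 * Real.pi)) = posX k L G l g ∧
    posY k L G (l + i * (2 * Real.pi)) (g + j * (2 * Real.pi)) = posY k L G l g := by
  have hl : ∀ g, Function.Periodic (fun l => (posX k L G l g, posY k L G l g)) (2 * Real.pi) :=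
    fun g l => Prod.ext (posX_periodic_ell h0 hlt l g).1 (posX_periodic_ell h0 hlt l g).2
  have hg : Function.Periodic (fun g => (posX k L G l g, posY k L G l g)) (2 * Real.pi) :=
    fun g => by simp only [posX, posY, Real.cos_add_two_pi, Real.sin_add_two_pi]
  have := ((hl (g + j * (2 * Real.pi))).int_mul i l).trans (hg.int_mul j g)
  simpa only [Prod.mk.injEq] using this

theorem IsIsoenergetic.isRotatingPeriodic (h : IsIsoenergetic k Ω α L₀ G₀ δ 𝒢)
    (hc : ∀ L l g ε, |L - L₀| < δ → |ε| < δ → 1 / 2 ≤ clockFactor k Ω α 𝒢 ε L l g)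
    (hk : 0 < k) (hΩ : Ω ≠ 0) (hε : |ε| < δ) (hΛ : ∀ g, |Λ g - L₀| < δ)
    (hred : IsReducedPeriodic k Ω α m 𝒢 ε Λ lam)
    (hγ : ∀ t, HasDerivAt γ (hamG k Ω α ε (Λ (γ t)) (𝒢 (Λ (γ t)) (lam (γ t)) (γ t) ε)
      (lam (γ t)) (γ t)) t)
    (hT : 0 < T) (hγT : ∀ t, γ (t + T) = γ t - Real.sign Ω * (2 * Real.pi * m)) :
    IsRotatingPeriodic k Ω α ε T (fun t => Λ (γ t))
      (fun t => 𝒢 (Λ (γ t)) (lam (γ t)) (γ t) ε) (fun t => lam (γ t)) γ := by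
  have hsol := h.isDelaunaySolution hc hk.ne' hΩ hε hΛ hred hγ
  obtain ⟨i, hi⟩ := exists_int_sign hΩ
  have hper : Function.Periodic (fun g => (Λ g, 𝒢 (Λ g) (lam g) g ε)) (m * Real.pi) := fun g => by
    have h1 := h.shift_nat (hΛ g) hε (lam g) g (-i) m
    simp only [(hred g).2.2.1, (hred g).2.2.2]
    rw [← h1]
    congr 3
    push_cast
    rw [hi]
    ring
  have hT' : ∀ t, γ (t + T) = γ t + (-(2 * i) : ℤ) * (m * Real.pi) := fun t => by
    rw [hγT t]
    push_cast
    rw [hi]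
    ring
  have hLG : ∀ t, Λ (γ (t + T)) = Λ (γ t) ∧ 𝒢 (Λ (γ (t + T))) (lam (γ (t + T))) (γ (t + T)) ε =
      𝒢 (Λ (γ t)) (lam (γ t)) (γ t) ε := fun t => by
    have := hper.int_mul (-(2 * i)) (γ t)
    rw [← hT'] at this
    simpa only [Prod.mk.injEq] using this
  -- One period `T` covers two arcs, so `ℓ` makes two turns. Its sign is positive for either sign of
  -- `Ω`, because `g` runs against `Ω`.
  have hell : ∀ t, lam (γ (t + T)) = lam (γ t) + (2 : ℤ) * (2 * Real.pi) := fun t => by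
    rw [hγT t]
    rcases sign_eq_one_or hΩ with hs | hs
    · have h1 := (hred (γ t - 2 * Real.pi * m)).2.2.2
      have h2 := (hred (γ t - 2 * Real.pi * m + m * Real.pi)).2.2.2
      rw [show γ t - 2 * Real.pi * m + m * Real.pi + m * Real.pi = γ t by ring] at h2
      rw [hs] at h1 h2 ⊢
      rw [one_mul]
      push_cast
      linarith
    · have h1 := (hred (γ t)).2.2.2
      have h2 := (hred (γ t + m * Real.pi)).2.2.2
      rw [show γ t + m * Real.pi + m * Real.pi = γ t - -1 * (2 * Real.pi * m) by ring] at h2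
      rw [hs] at h1 h2 ⊢
      push_cast
      linarith
  have hg : ∀ t, γ (t + T) = γ t + (-(i * m) : ℤ) * (2 * Real.pi) := fun t => by
    rw [hγT t]
    push_cast
    rw [hi]
    ring
  have hpos : ∀ t, posX k (Λ (γ (t + T))) (𝒢 (Λ (γ (t + T))) (lam (γ (t + T))) (γ (t + T)) ε)
        (lam (γ (t + T))) (γ (t + T)) =
        posX k (Λ (γ t)) (𝒢 (Λ (γ t)) (lam (γ t)) (γ t) ε) (lam (γ t)) (γ t) ∧
      posY k (Λ (γ (t + T))) (𝒢 (Λ (γ (t + T))) (lam (γ (t + T))) (γ (t + T)) ε)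
        (lam (γ (t + T))) (γ (t + T)) =
        posY k (Λ (γ t)) (𝒢 (Λ (γ t)) (lam (γ t)) (γ t) ε) (lam (γ t)) (γ t) := fun t => by
    rw [(hLG t).2, (hLG t).1, hell t, hg t]
    exact pos_shift (hsol t).1 (hsol t).2.1 _ _
  exact
    { pos := hT
      delaunay := hsol
      periodic_L := fun t => (hLG t).1
      periodic_G := fun t => (hLG t).2
      periodic_ell := ⟨2, fun t => by rw [hell t]; ring⟩
      periodic_g := ⟨-(i * m), fun t => by rw [hg t]; ring⟩
      cartesian := hsol.isRotatingSolution hk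
      momentum_x := fun t => by rw [(hsol.hasDerivAt_posX hk t).deriv]; ring
      momentum_y := fun t => by rw [(hsol.hasDerivAt_posY hk t).deriv]; ring
      periodic_x := fun t => (hpos t).1
      periodic_y := fun t => (hpos t).2 }

/-- A simple zero of the bifurcation function gives rise to periodic orbits. -/
theorem IsIsoenergetic.isContinuable (h : IsIsoenergetic k Ω α L₀ G₀ δ 𝒢) (hδ : 0 < δ)
    (hc : ∀ L l g ε, |L - L₀| < δ → |ε| < δ → 1 / 2 ≤ clockFactor k Ω α 𝒢 ε L l g)
    (hk : 0 < k) (hΩ : Ω ≠ 0) (hm : 1 ≤ m) (hL : 0 < L₀)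
    (hres : (m : ℝ) * keplerFreq k L₀ = |Ω|) {ℓ₀ : ℝ}
    (hz : IsSimpleZero (bifurcation k Ω α m L₀ 𝒢) ℓ₀) :
    IsContinuable k Ω α m L₀ δ 𝒢 ℓ₀ := by
  obtain ⟨ε₀, hε₀, hle, Λ, lam, h1, h2, h3, h4⟩ :=
    h.exists_reducedPeriodic hδ hc hk.ne' hΩ hm hL hres hz
  refine ⟨ε₀, hε₀, hle, Λ, lam, h1, h2, h3, fun ε hε => ⟨(h4 ε hε).1, (h4 ε hε).2, ?_⟩⟩
  obtain ⟨hΛ, hred⟩ := h4 ε hε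
  have hεδ : |ε| < δ := (abs_lt.2 hε).trans_le hle
  obtain ⟨T, hT, γ, hγ0, hγ, hγT⟩ := h.exists_clock hc hk.ne' hΩ hm hεδ hΛ hred
  exact ⟨T, hT, γ, hγ0, hγT, h.isRotatingPeriodic hc hk hΩ hεδ hΛ hred hγ hT hγT⟩

end Time

end GravWave

/-! ### The theorem -/

theorem mainTheorem6 (k Ω α L₀ : ℝ) (m : ℕ) (hk : 0 < k) (hΩ : Ω ≠ 0) (hα : α ≠ 0) (hm : 1 ≤ m)
    (hL : 0 < L₀) (hres : (m : ℝ) * GravWave.keplerFreq k L₀ = |Ω|) :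
    ∃ c : ℝ, c ≠ 0 ∧ ∀ η : ℝ, (η = 1 ∨ η = -1) →
      -- for almost all eccentricities, `ℓ ↦ (A_m + η B_m) sin mℓ` has zeros, all simple
      (∀ᵐ e ∂(volume.restrict (Ioo (0 : ℝ) 1)),
        (∃ l, GravWave.IsSimpleZero
          (fun l => (GravWave.coeffA m e + η * GravWave.coeffB m e) * Real.sin (m * l)) l) ∧
        ∀ l, (GravWave.coeffA m e + η * GravWave.coeffB m e) * Real.sin (m * l) = 0 →
          GravWave.IsSimpleZero
            (fun l => (GravWave.coeffA m e + η * GravWave.coeffB m e) * Real.sin (m * l)) l) ∧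
      ∀ e ∈ Ioo (0 : ℝ) 1, ∃ δ > 0, ∃ 𝒢 : ℝ → ℝ → ℝ → ℝ → ℝ,
        GravWave.IsIsoenergetic k Ω α L₀ (η * Real.sign Ω * L₀ * Real.sqrt (1 - e ^ 2)) δ 𝒢 ∧
        -- normal nondegeneracy of the resonant torus (twist)
        (∀ l g, deriv (fun L => GravWave.redEll k Ω α 𝒢 0 L l g) L₀ ≠ 0) ∧
        (∀ l, GravWave.bifurcation k Ω α m L₀ 𝒢 l =
          c * ((GravWave.coeffA m e + η * GravWave.coeffB m e) * Real.sin (m * l))) ∧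
        ∀ ℓ₀, GravWave.IsSimpleZero (GravWave.bifurcation k Ω α m L₀ 𝒢) ℓ₀ →
          GravWave.IsContinuable k Ω α m L₀ δ 𝒢 ℓ₀ := by
  have hm0 : (m : ℝ) ≠ 0 := by positivity
  have ha : GravWave.semiAxis k L₀ ≠ 0 := by rw [GravWave.semiAxis]; positivity
  -- The constant of `bifurcation_eq`; it contains neither `η` nor `e`.
  refine ⟨-(α * Ω * m * GravWave.semiAxis k L₀ ^ 2 / 2), by simp [*], fun η hη =>
    ⟨GravWave.ae_simple_zeros hm hη, fun e he => ?_⟩⟩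
  obtain ⟨h0, hlt⟩ := GravWave.orbitG_mem hΩ hL hη he
  obtain ⟨δ, hδ, 𝒢, h𝒢, hc⟩ := GravWave.exists_isIsoenergetic (α := α) hk.ne' hΩ h0 hlt
  exact ⟨δ, hδ, 𝒢, h𝒢, h𝒢.deriv_redEll_ne_zero hk.ne' hΩ hδ,
    h𝒢.bifurcation_eq hk.ne' hΩ hδ hm hL hres hη he,
    fun ℓ₀ hz => h𝒢.isContinuable hδ hc hk hΩ hm hL hres hz⟩
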